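/- All digraphs are finite and may have loops, parallel arcs and anti-parallel arcs. A digraph is \emph{quartic Eulerian} if every vertex has in-degree $2$ and out-degree $2$ (a loop counts towards both). An Eulerian digraph is \emph{diplanar} if it has an embedding in the plane in which in-arcs and out-arcs alternate in the rotation at every vertex. For quartic Eulerian digraphs, $H$ is \emph{strictly smaller} than $G$ if $H$ is obtained from $G$ by removing the arcs of one or more directed cycles, deleting isolated vertices, and suppressing vertices of degree $2$ (replacing arcs $wx$, $xy$ at such a vertex $x$ with one arc $wy$). A \emph{diplanar obstruction} is a quartic Eulerian digraph that is not diplanar while all strictly smaller quartic Eulerian digraphs are diplanar. A \emph{digon} is a pair of arcs $xy$, $yx$ with $x\ne y$, and an \emph{anti-digon} is a pair of distinct parallel arcs $xy$, $xy$ with $x\neq y$. Define the following digraphs. - $\overrightarrow{C}_n^{(2)}$ has vertices $i\in\mathbb Z_n$ and two parallel arcs from $i$ to $i+1$ for every $i$. - The anti-ladder ($n$ even) or Möbius anti-ladder ($n$ odd) $\overrightarrow{L}_n$ has vertices $x_i,y_i$ $(i\in\mathbb Z_n)$ and, for every $i$, two parallel arcs $x_iy_i$ and the arcs $y_ix_{i+1}$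 and $y_{i+1}x_i$. - For positive integers $p,n_1,\dots,n_p$, the digraph $\overrightarrow{N}(n_1,\dots,n_p)$ is obtained from blocks $B_{n_1},\dots,B_{n_p}$ by identifying the right vertex of each block with the left vertex of the next one, cyclically (for $p=1$, the right and the left vertex of the only block are identified). Here the block $B_m$ has a left vertex $l$, a right vertex $r$ and vertices $x_1,y_1,\dots,x_m,y_m$; its arcs are two parallel arcs $x_jy_j$ for $1\le j\le m$, the arcs $y_jx_{j+1}$ and $y_{j+1}x_j$ for $1\le j<m$, and the arcs $lx_1$, $y_1l$, $rx_m$, $y_mr$. Theorem. Let $G$ be a diplanar obstruction that has no digons but contains an anti-digon $D$. If every directed cycle of $G$ meets $D$ (has a vertex in common with it), then $G$ is isomorphic to $\overrightarrow{C}_n^{(2)}$ for some $n\ge 3$. Otherwise, $G$ is isomorphic to $\overrightarrow{L}_n$ for some $n\ge 2$, or to $\overrightarrow{N}(n_1,\dots,n_p)$ for some positive integers $p,n_1,\dots,n_p$. -/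

import Mathlib

universe u v

/-- A finite directed multigraph: loops, parallel arcs and anti-parallel arcs are allowed,
and it need not be connected. -/
structure FinDigraph : Type (u + 1) where
  /-- the vertices -/
  V : Type u
  /-- the arcs -/
  E : Type u
  finite_V : Finite V
  finite_E : Finite E
  /-- the vertex at which an arc starts -/
  tail : E → V
  /-- the vertex at which an arc ends -/
  head : E → V

namespace FinDigraph

attribute [instance] finite_V finite_E

/-- Isomorphism of directed multigraphs. -/
def Isomorphic (G : FinDigraph.{u}) (H : FinDigraph.{v}) : Prop :=
  ∃ (φ : G.V ≃ H.V) (ψ : G.E ≃ H.E),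
    (∀ e, H.tail (ψ e) = φ (G.tail e)) ∧ (∀ e, H.head (ψ e) = φ (G.head e))

variable (G : FinDigraph.{u})

/-- A loop counts both towards the in-degree and towards the out-degree of its vertex. -/
noncomputable def inDegree (x : G.V) : ℕ := Nat.card {e : G.E // G.head e = x}

noncomputable def outDegree (x : G.V) : ℕ := Nat.card {e : G.E // G.tail e = x}

/-- Quartic Eulerian digraphs: in-degree and out-degree of every vertex are equal, and they
add up to four. -/
def IsQuarticEulerian : Prop := ∀ x, G.inDegree x = 2 ∧ G.outDegree x = 2

/-! ### Embeddings in the plane -/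

/-- The darts (half-arcs): `(e, false)` is the end of the arc `e` at its tail, an out-dart there,
and `(e, true)` is the end of `e` at its head, an in-dart there. -/
abbrev Dart : Type u := G.E × Bool

/-- The vertex at which a dart is attached. -/
def dartVertex (d : G.Dart) : G.V := if d.2 then G.head d.1 else G.tail d.1

/-- The involution that exchanges the two darts of every arc. -/
def flip : Equiv.Perm G.Dart := Equiv.prodCongr (Equiv.refl G.E) Equiv.boolNot

/-- A rotation system: a permutation of the darts whose cycles (fixed points included) are
exactly the sets of darts at the non-isolated vertices, so that it puts the darts at each vertex
in a cyclic order. -/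
def IsRotationSystem (σ : Equiv.Perm G.Dart) : Prop :=
  ∀ d d' : G.Dart, σ.SameCycle d d' ↔ G.dartVertex d = G.dartVertex d'

/-- In-darts and out-darts alternate in the rotation at each vertex. -/
def IsAlternating (σ : Equiv.Perm G.Dart) : Prop := ∀ d : G.Dart, (σ d).2 ≠ d.2

/-- The number of cycles of a permutation, fixed points included. -/
noncomputable def _root_.Equiv.Perm.numCycles {X : Type u} (π : Equiv.Perm X) : ℕ :=
  Nat.card (MulAction.orbitRel.Quotient (Subgroup.zpowers π) X)

/-- The number of connected components that contain an arc. -/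
noncomputable def numComponents (σ : Equiv.Perm G.Dart) : ℕ :=
  Nat.card (MulAction.orbitRel.Quotient (Subgroup.closure {σ, G.flip}) G.Dart)

/-- The embedding given by a rotation system is spherical, i.e. all its connected components have
genus zero: `V - E + F = 2 c`, where `V` is the number of (non-isolated) vertices, `E` the number
of arcs, `F` the number of facial walks, which are the cycles of `σ * flip`, and `c` is the number
of components. As `V - E + F ≤ 2` holds on every component, the equality for the total
says that every component is embedded in the sphere. -/
def IsSpherical (σ : Equiv.Perm G.Dart) : Prop :=
  σ.numCycles + (σ * G.flip).numCycles = Nat.card G.E + 2 * G.numComponents σ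

/-- A digraph is diplanar if it has an embedding in the plane such that in-arcs and out-arcs
alternate in the rotation at each vertex. -/
def IsDiplanar : Prop :=
  ∃ σ : Equiv.Perm G.Dart, G.IsRotationSystem σ ∧ G.IsAlternating σ ∧ G.IsSpherical σ

/-! ### Removing cycles and suppressing vertices -/

/-- `C` is the arc set of a directed cycle (without repeated vertices; a loop is a cycle of
length one). Here `finRotate n` is the map `i ↦ i + 1` modulo `n`. -/
def IsDirectedCycle (C : Set G.E) : Prop :=
  ∃ n : ℕ, 0 < n ∧ ∃ c : Fin n → G.E,
    (∀ i, G.head (c i) = G.tail (c (finRotate n i))) ∧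
    Function.Injective (fun i => G.tail (c i)) ∧ Set.range c = C

/-- Removal of a set of arcs; all vertices are kept. -/
def deleteArcs (C : Set G.E) : FinDigraph.{u} where
  V := G.V
  E := {e : G.E // e ∉ C}
  finite_V := inferInstance
  finite_E := inferInstance
  tail e := G.tail e
  head e := G.head e

/-- Removal of an isolated vertex `x`. -/
def deleteIsolated (x : G.V) (hx : ∀ a, G.tail a ≠ x ∧ G.head a ≠ x) : FinDigraph.{u} where
  V := {y : G.V // y ≠ x}
  E := G.E
  finite_V := inferInstance
  finite_E := inferInstance
  tail a := ⟨G.tail a, (hx a).1⟩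
  head a := ⟨G.head a, (hx a).2⟩

open Classical in
/-- Suppression of a vertex `x` of degree two, whose only in-arc is `e` and whose only out-arc is
`f ≠ e`: the arcs `e = wx` and `f = xy` are replaced with a single arc `wy`, which is again called
`e`. -/
noncomputable def suppress (x : G.V) (e f : G.E) (hef : e ≠ f)
    (he : ∀ a, G.head a = x ↔ a = e) (hf : ∀ a, G.tail a = x ↔ a = f) : FinDigraph.{u} where
  V := {y : G.V // y ≠ x}
  E := {a : G.E // a ≠ f}
  finite_V := inferInstance
  finite_E := inferInstance
  tail a := ⟨G.tail a, fun h => a.2 ((hf a).1 h)⟩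
  head a :=
    if h : a.1 = e then ⟨G.head f, fun h' => hef ((he f).1 h').symm⟩
    else ⟨G.head a, fun h' => h ((he a).1 h')⟩

/-- The elementary operations: the removal of (the arcs of) a directed cycle, the removal of an
isolated vertex and the suppression of a vertex of degree two. -/
inductive Step : FinDigraph.{u} → FinDigraph.{u} → Prop
  | removeCycle (G : FinDigraph.{u}) (C : Set G.E) (hC : G.IsDirectedCycle C) :
      Step G (G.deleteArcs C)
  | removeIsolated (G : FinDigraph.{u}) (x : G.V) (hx : ∀ a, G.tail a ≠ x ∧ G.head a ≠ x) :
      Step G (G.deleteIsolated x hx)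
  | suppressVertex (G : FinDigraph.{u}) (x : G.V) (e f : G.E) (hef : e ≠ f)
      (he : ∀ a, G.head a = x ↔ a = e) (hf : ∀ a, G.tail a = x ↔ a = f) :
      Step G (G.suppress x e f hef he hf)

/-- `H` is strictly smaller than `G` in the partial order of quartic Eulerian digraphs: it arises
from `G` by at least one operation. As all vertices of `G` have degree four, the first operation
is the removal of a directed cycle. -/
def StrictlySmaller (H G : FinDigraph.{u}) : Prop :=
  H.IsQuarticEulerian ∧ G.IsQuarticEulerian ∧ Relation.TransGen Step G H

/-- The diplanar obstructions: the minimal non-diplanar quartic Eulerian digraphs. -/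
def IsDiplanarObstruction : Prop :=
  G.IsQuarticEulerian ∧ ¬ G.IsDiplanar ∧
    ∀ H : FinDigraph.{u}, StrictlySmaller H G → H.IsDiplanar

/-! ### Digons and anti-digons -/

/-- The arcs `e = xy` and `f = yx` form a digon. -/
def IsDigon (e f : G.E) : Prop :=
  G.tail e ≠ G.head e ∧ G.tail f = G.head e ∧ G.head f = G.tail e

/-- The arcs `e` and `f` form an anti-digon: they are distinct and have the same tail `x` and the
same head `y ≠ x`. -/
def IsAntiDigon (e f : G.E) : Prop :=
  e ≠ f ∧ G.tail e ≠ G.head e ∧ G.tail f = G.tail e ∧ G.head f = G.head e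

/-- The directed cycle with arc set `C` passes through an end of the arc `e`. -/
def Meets (C : Set G.E) (e : G.E) : Prop :=
  ∃ c ∈ C, G.tail c = G.tail e ∨ G.tail c = G.head e

/-! ### The three families -/

/-- The doubled directed cycle: two parallel arcs from `i` to `i + 1` for every `i` modulo `n`. -/
def doubledCycle (n : ℕ) : FinDigraph.{0} where
  V := Fin n
  E := Fin n × Bool
  finite_V := inferInstance
  finite_E := inferInstance
  tail a := a.1
  head a := finRotate n a.1

/-- The anti-ladder (for even `n`) or Möbius anti-ladder (for odd `n`) with `n` anti-digons.
Its vertices are `x i = (i, false)` and `y i = (i, true)` for `i` modulo `n`. For every `i` there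
are two parallel arcs from `x i` to `y i`, an arc from `y i` to `x (i + 1)`, and an arc from
`y (i + 1)` to `x i`. -/
def antiLadder (n : ℕ) : FinDigraph.{0} where
  V := Fin n × Bool
  E := Fin n × (Bool ⊕ Bool)
  finite_V := inferInstance
  finite_E := inferInstance
  tail
    | (i, .inl _) => (i, false)
    | (i, .inr false) => (i, true)
    | (i, .inr true) => (finRotate n i, true)
  head
    | (i, .inl _) => (i, true)
    | (i, .inr false) => (finRotate n i, false)
    | (i, .inr true) => (i, false)

/-- The vertices of the cyclic concatenation of `p` building blocks, the `i`-th of which has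
`n i` anti-digons: `inl i` is the left vertex of the `i`-th block, which is identified with the
right vertex of the block before it (cyclically); `inr ⟨i, j, false⟩` and `inr ⟨i, j, true⟩` are
the tail `x j` and the head `y j` of the `j`-th anti-digon of the `i`-th block. -/
abbrev BlockVertex {p : ℕ} (n : Fin p → ℕ) : Type :=
  Fin p ⊕ (Σ i : Fin p, Fin (n i) × Bool)

/-- In a block, the left vertex, the `n i` anti-digons and the right vertex form a sequence of
`n i + 2` objects, with `n i + 1` gaps between consecutive ones. This is the object to the left of
the gap `g`, given by its entry (at `false`) and its exit (at `true`): these are the tail and the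
head of an anti-digon, and they coincide for the left vertex. -/
def leftOfGap {p : ℕ} (n : Fin p → ℕ) (i : Fin p) (g : Fin (n i + 1)) (s : Bool) :
    BlockVertex n :=
  Fin.cases (motive := fun _ => BlockVertex n) (Sum.inl i) (fun j => Sum.inr ⟨i, j, s⟩) g

/-- The object to the right of the gap `g`. The right vertex of the block `i` is the left vertex
of the block `i + 1` modulo `p`. -/
def rightOfGap {p : ℕ} (n : Fin p → ℕ) (i : Fin p) (g : Fin (n i + 1)) (s : Bool) :
    BlockVertex n :=
  Fin.lastCases (motive := fun _ => BlockVertex n) (Sum.inl (finRotate p i))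
    (fun j => Sum.inr ⟨i, j, s⟩) g

/-- The cyclic concatenation `N(n 0, …, n (p - 1))` of building blocks. A building block with `m`
anti-digons has a left vertex `l`, a right vertex `r`, two parallel arcs from `x j` to `y j` for
`0 ≤ j < m`, and for every two consecutive objects of the sequence `l, (x 0, y 0), …,
(x (m - 1), y (m - 1)), r` an arc from the exit of each of the two to the entry of the other. -/
def blockCycle {p : ℕ} (n : Fin p → ℕ) : FinDigraph.{0} where
  V := BlockVertex n
  E := (Σ i : Fin p, Fin (n i) × Bool) ⊕ (Σ i : Fin p, Fin (n i + 1) × Bool)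
  finite_V := inferInstance
  finite_E := inferInstance
  tail
    | .inl ⟨i, j, _⟩ => .inr ⟨i, j, false⟩
    | .inr ⟨i, g, false⟩ => leftOfGap n i g true
    | .inr ⟨i, g, true⟩ => rightOfGap n i g true
  head
    | .inl ⟨i, j, _⟩ => .inr ⟨i, j, true⟩
    | .inr ⟨i, g, false⟩ => rightOfGap n i g false
    | .inr ⟨i, g, true⟩ => leftOfGap n i g false

end FinDigraph

/-! Let the anti-digon consist of the arcs `e`, `f` from x to y.

If every directed cycle meets it, degree counting suffices. Given a path of doubled arcs that ends
with the anti-digon, the arcs among the unused vertices form no directed cycle, so some unused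
vertex sends both its arcs into the path, and only the first vertex of the path has room for them.
The path therefore grows until it spans the digraph and closes up (`IsDoublePath.extend`).

Otherwise sphericity is used in homological form: every cycle modulo two bounds a two-colouring of
the faces (`isSpherical_iff`). This gives two facts. (a) In a diplanar digraph the anti-digon is a
closed curve, and alternation puts the two arcs that leave y on different sides of it. In an
obstruction this applies after the removal of any non-empty balanced set of arcs that avoids x and y
(`IsDiplanarObstruction.exists_colouring`). (b) In the obstruction itself the anti-digon does not
separate these two arcs. Otherwise each side, together with one arc of the anti-digon, would be
balanced; both sides would be diplanar by minimality, and their embeddings could be glued along the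
anti-digon (`IsDiplanarObstruction.mem_of_isClosedOff`).

Decompose the arcs into directed cycles, one of which avoids the anti-digon, and call two cycles
linked if they share a vertex other than x and y. By (b) the cycles of `e` and `f` are joined by a
path of links; by (a) no cycle lies off a shortest such path. So the cycles form a chain
(`exists_isCycleChain`). Applying (a) after the removal of closed pieces of two consecutive cycles
shows that their common vertices appear in the same order on both, with nothing in between. Three of
them would yield a new anti-digon whose head has both out-arcs ending at one vertex, against (a). So
consecutive cycles share a vertex or an anti-digon (`exists_common`).

The last and the first cycle share the given anti-digon, so the sequence closes up cyclically
(`exists_isNecklace`). Without digons, no two single vertices are consecutive: the result is an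
anti-ladder if there are none, and a cycle of blocks otherwise (`IsNecklace.isomorphic`). -/

open Module

/-! ### Spherical embeddings in terms of homology modulo two. -/

/-- The functions that are invariant under every permutation in `S`. -/
def invariantFunctions {X : Type u} (S : Set (Equiv.Perm X)) :
    Submodule (ZMod 2) (X → ZMod 2) where
  carrier := {φ | ∀ s ∈ S, ∀ x, φ (s x) = φ x}
  add_mem' ha hb s hs x := by simp [ha s hs x, hb s hs x]
  zero_mem' _ _ _ := rfl
  smul_mem' c _ ha s hs x := by simp [ha s hs x]

theorem mem_invariantFunctions {X : Type u} {S : Set (Equiv.Perm X)} {φ : X → ZMod 2} :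
    φ ∈ invariantFunctions S ↔ ∀ s ∈ S, ∀ x, φ (s x) = φ x := Iff.rfl

theorem invariant_of_mem_closure {X : Type u} {S : Set (Equiv.Perm X)} {φ : X → ZMod 2}
    (hφ : φ ∈ invariantFunctions S) {g : Equiv.Perm X} (hg : g ∈ Subgroup.closure S) (x : X) :
    φ (g x) = φ x := by
  induction hg using Subgroup.closure_induction generalizing x with
  | mem s hs => exact hφ s hs x
  | one => rfl
  | mul a b _ _ iha ihb => rw [Equiv.Perm.mul_apply, iha, ihb]
  | inv a _ ih => rw [← ih (a⁻¹ x)]; simp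

/-- The invariant functions are the functions on the orbits of the generated group. -/
noncomputable def orbitFunctionsEquiv {X : Type u} (S : Set (Equiv.Perm X)) :
    (MulAction.orbitRel.Quotient (Subgroup.closure S) X → ZMod 2) ≃ₗ[ZMod 2]
      invariantFunctions S where
  toFun ψ := ⟨fun x => ψ (Quotient.mk'' x), fun s hs x => 
    congrArg ψ (Quotient.sound' (s₁ := MulAction.orbitRel (Subgroup.closure S) X)
      (a := s x) (b := x) ⟨⟨s, Subgroup.subset_closure hs⟩, rfl⟩)⟩
  map_add' _ _ := rfl
  map_smul' _ _ := rfl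
  invFun φ := fun q => Quotient.liftOn'
    (s₁ := MulAction.orbitRel (Subgroup.closure S) X) q φ.1 (by
      rintro a b ⟨g, rfl⟩
      exact invariant_of_mem_closure φ.2 g.2 b)
  left_inv ψ := by
    funext q
    induction q using Quotient.inductionOn'
    rfl
  right_inv φ := rfl

/-- This turns the orbit counts in Euler's formula into dimensions over the field with two elements.
-/
theorem finrank_invariantFunctions {X : Type u} [Finite X] (S : Set (Equiv.Perm X)) :
    finrank (ZMod 2) (invariantFunctions S) =
      Nat.card (MulAction.orbitRel.Quotient (Subgroup.closure S) X) := by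
  have : Finite (MulAction.orbitRel.Quotient (Subgroup.closure S) X) :=
    Quotient.finite _
  have := Fintype.ofFinite (MulAction.orbitRel.Quotient (Subgroup.closure S) X)
  rw [← (orbitFunctionsEquiv S).finrank_eq, Module.finrank_fintype_fun_eq_card,
    Nat.card_eq_fintype_card]

theorem finrank_invariantFunctions_singleton {X : Type u} [Finite X] (π : Equiv.Perm X) :
    finrank (ZMod 2) (invariantFunctions {π}) = π.numCycles := by
  rw [finrank_invariantFunctions, Equiv.Perm.numCycles, Subgroup.zpowers_eq_closure]

namespace FinDigraph

variable (G : FinDigraph.{u})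

noncomputable instance : Fintype G.E := Fintype.ofFinite _
noncomputable instance : Fintype G.V := Fintype.ofFinite _

/-- `z` is a cycle modulo two. -/
def IsCycleModTwo (z : G.E → ZMod 2) : Prop :=
  ∀ g : G.V → ZMod 2, ∑ a, z a * (g (G.tail a) + g (G.head a)) = 0

/-- `φ` is a two-colouring of the faces of `σ`, with boundary `z`. -/
def IsFaceColouring (σ : Equiv.Perm G.Dart) (z : G.E → ZMod 2) (φ : G.Dart → ZMod 2) : Prop :=
  (∀ d, φ (σ d) = φ (G.flip d)) ∧ ∀ d, φ d + φ (G.flip d) = z d.1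

@[simp] theorem flip_mk (a : G.E) (s : Bool) : G.flip (a, s) = (a, !s) := rfl
@[simp] theorem flip_flip (d : G.Dart) : G.flip (G.flip d) = d := by
  rcases d with ⟨a, s⟩; simp
@[simp] theorem dartVertex_false (a : G.E) : G.dartVertex (a, false) = G.tail a := rfl
@[simp] theorem dartVertex_true (a : G.E) : G.dartVertex (a, true) = G.head a := rfl

/-- The sum of the values at the two darts of an arc. -/
def dartSum : (G.Dart → ZMod 2) →ₗ[ZMod 2] (G.E → ZMod 2) where
  toFun φ a := φ (a, false) + φ (a, true)
  map_add' φ ψ := by funext a; simp; ring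
  map_smul' c φ := by funext a; simp; ring

theorem sum_dart (F : G.Dart → ZMod 2) : ∑ d, F d = ∑ a, (F (a, false) + F (a, true)) := by
  rw [Fintype.sum_prod_type]
  simp [add_comm]

theorem flip_invariant_of_dartSum {φ : G.Dart → ZMod 2} (h : G.dartSum φ = 0) (d : G.Dart) :
    φ (G.flip d) = φ d := by
  rcases d with ⟨a, s⟩
  have h1 := congrFun h a
  have h2 : φ (a, false) = φ (a, true) := by
    have : φ (a, false) + φ (a, true) = 0 := h1
    rwa [CharTwo.add_eq_zero] at this
  cases s <;> simp [h2]

/-- The kernel of the dart sum consists of the functions that are also invariant under `flip`, hence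
constant on components. It is applied with `π = σ` (vertices) and with `π = σ * flip` (faces). -/
theorem dartSum_ker_invariant (σ π : Equiv.Perm G.Dart)
    (h : ∀ φ : G.Dart → ZMod 2, (∀ d, φ (G.flip d) = φ d) →
      ((∀ d, φ (π d) = φ d) ↔ ∀ d, φ (σ d) = φ d)) :
    finrank (ZMod 2) ((G.dartSum.domRestrict (invariantFunctions {π})).ker) =
      G.numComponents σ := by
  rw [numComponents, ← finrank_invariantFunctions]
  have : (G.dartSum.domRestrict (invariantFunctions {π})).ker.map
      (invariantFunctions {π}).subtype = invariantFunctions {σ, G.flip} := by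
    ext φ
    simp only [Submodule.mem_map, LinearMap.mem_ker, LinearMap.domRestrict_apply,
      Submodule.subtype_apply, Subtype.exists, exists_and_left, exists_prop,
      mem_invariantFunctions, Set.mem_insert_iff, Set.mem_singleton_iff, forall_eq_or_imp,
      forall_eq]
    constructor
    · rintro ⟨φ', h0, hπ, rfl⟩
      have hf := G.flip_invariant_of_dartSum h0
      exact ⟨(h φ' hf).1 hπ, hf⟩
    · rintro ⟨hσ, hf⟩
      refine ⟨φ, ?_, (h φ hf).2 hσ, rfl⟩
      funext a
      have := hf (a, false)
      simp only [flip_mk, Bool.not_false] at this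
      simp [dartSum, this, CharTwo.add_self_eq_zero]
  rw [← this]
  exact (LinearEquiv.finrank_eq (Submodule.equivMapOfInjective _ (Submodule.subtype_injective _) _))

theorem invariant_of_sameCycle {X : Type u} {Y : Type v} {σ : Equiv.Perm X} {ψ : X → Y}
    (hψ : ∀ d, ψ (σ d) = ψ d) {d d' : X} (h : σ.SameCycle d d') : ψ d = ψ d' := by
  obtain ⟨n, rfl⟩ := h
  induction n using Int.induction_on generalizing d with
  | zero => rfl
  | succ n ih => rw [zpow_add_one, Equiv.Perm.mul_apply, ← ih, hψ]
  | pred n ih =>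
    rw [zpow_sub_one, Equiv.Perm.mul_apply, ← ih, ← hψ (σ⁻¹ d)]
    simp

variable {G}

theorem IsRotationSystem.dartVertex_apply {σ : Equiv.Perm G.Dart} (hσ : G.IsRotationSystem σ)
    (d : G.Dart) : G.dartVertex (σ d) = G.dartVertex d :=
  (hσ _ _).1 (Equiv.Perm.sameCycle_apply_left.2 (Equiv.Perm.SameCycle.refl _ _))

/-- The orbits of a rotation system are the stars of the vertices, so its invariant functions are
those that come from vertices. The cycle space thus becomes the orthogonal complement of the
coboundaries. -/
theorem isCycleModTwo_iff {σ : Equiv.Perm G.Dart} (hσ : G.IsRotationSystem σ)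
    (z : G.E → ZMod 2) :
    G.IsCycleModTwo z ↔
      ∀ ψ : G.Dart → ZMod 2, (∀ d, ψ (σ d) = ψ d) → ∑ a, G.dartSum ψ a * z a = 0 := by
  classical
  constructor
  · intro h ψ hψ
    have key : ∃ g : G.V → ZMod 2, ∀ d, ψ d = g (G.dartVertex d) := by
      refine ⟨fun v => if hv : ∃ d, G.dartVertex d = v then ψ hv.choose else 0, fun d => ?_⟩
      have hv : ∃ d', G.dartVertex d' = G.dartVertex d := ⟨d, rfl⟩
      simp only [dif_pos hv]
      exact invariant_of_sameCycle hψ ((hσ _ _).2 hv.choose_spec.symm)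
    obtain ⟨g, hg⟩ := key
    rw [← h g]
    refine Finset.sum_congr rfl fun a _ => ?_
    simp [dartSum, hg, mul_comm]
  · intro h g
    rw [← h (fun d => g (G.dartVertex d)) (fun d => by rw [hσ.dartVertex_apply])]
    refine Finset.sum_congr rfl fun a _ => ?_
    simp [dartSum, mul_comm]

/-- Boundaries are cycles: reindexing the sum by `σ`, which fixes vertex functions, turns the
colours on one side of the arcs into those on the other side, and the two sums cancel. -/
theorem IsFaceColouring.isCycleModTwo {σ : Equiv.Perm G.Dart} (hσ : G.IsRotationSystem σ)
    {z : G.E → ZMod 2} {φ : G.Dart → ZMod 2} (hφ : G.IsFaceColouring σ z φ) :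
    G.IsCycleModTwo z := by
  rw [isCycleModTwo_iff hσ]
  intro ψ hψ
  have h1 : ∀ a, G.dartSum ψ a * z a = ψ (a, false) * z a + ψ (a, true) * z a := fun a => by
    simp [dartSum]; ring
  rw [Finset.sum_congr rfl fun a _ => h1 a, ← G.sum_dart (fun d => ψ d * z d.1)]
  have h2 : ∑ d, ψ d * φ (G.flip d) = ∑ d, ψ d * φ d := by
    rw [← Equiv.sum_comp σ (fun d => ψ d * φ d)]
    refine Finset.sum_congr rfl fun d _ => ?_
    rw [hψ, hφ.1]
  have h3 : ∀ d, ψ d * z d.1 = ψ d * φ d + ψ d * φ (G.flip d) := fun d => by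
    rw [← hφ.2 d]; ring
  rw [Finset.sum_congr rfl fun d _ => h3 d, Finset.sum_add_distrib, h2,
    CharTwo.add_self_eq_zero]

/-- An embedding is spherical if and only if every cycle modulo two is a boundary. -/
theorem isSpherical_iff {σ : Equiv.Perm G.Dart} (hσ : G.IsRotationSystem σ) :
    G.IsSpherical σ ↔ ∀ z, G.IsCycleModTwo z → ∃ φ, G.IsFaceColouring σ z φ := by
  classical
  -- `B` is the boundary map on functions of the faces, `Δ` the coboundary map on functions of the
  -- vertices.
  set B := G.dartSum.domRestrict (invariantFunctions {σ * G.flip}) with hB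
  set Δ := G.dartSum.domRestrict (invariantFunctions {σ}) with hΔ
  have hkB : finrank (ZMod 2) B.ker = G.numComponents σ :=
    G.dartSum_ker_invariant σ _ fun φ hf => by
      constructor
      · intro h d
        rw [← hf d, ← h (G.flip d)]; simp
      · intro h d
        rw [Equiv.Perm.mul_apply, h, hf]
  have hkΔ : finrank (ZMod 2) Δ.ker = G.numComponents σ :=
    G.dartSum_ker_invariant σ _ fun φ hf => Iff.rfl
  have hrB := B.finrank_range_add_finrank_ker
  have hrΔ := Δ.finrank_range_add_finrank_ker
  rw [hkB, finrank_invariantFunctions_singleton] at hrB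
  rw [hkΔ, finrank_invariantFunctions_singleton] at hrΔ
  set bil := Matrix.toBilin' (1 : Matrix G.E G.E (ZMod 2)) with hbil
  have hnd : bil.Nondegenerate :=
    LinearMap.BilinForm.nondegenerate_toBilin'_of_det_ne_zero' _ (by simp)
  have hbil_apply : ∀ v w : G.E → ZMod 2, bil v w = ∑ a, v a * w a := fun v w => by
    rw [hbil, Matrix.toBilin'_apply']; simp [dotProduct]
  have hZ : ∀ z, z ∈ bil.orthogonal Δ.range ↔ G.IsCycleModTwo z := by
    intro z
    rw [isCycleModTwo_iff hσ, LinearMap.BilinForm.mem_orthogonal_iff]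
    constructor
    · intro h ψ hψ
      rw [← hbil_apply]
      exact h _ ⟨⟨ψ, by simpa [mem_invariantFunctions] using hψ⟩, rfl⟩
    · rintro h _ ⟨⟨ψ, hψ⟩, rfl⟩
      rw [hbil_apply]
      exact h ψ (by simpa [mem_invariantFunctions] using hψ)
  have hBr : ∀ z, z ∈ B.range ↔ ∃ φ, G.IsFaceColouring σ z φ := by
    intro z
    constructor
    · rintro ⟨⟨φ, hφ⟩, rfl⟩
      refine ⟨φ, fun d => ?_, fun d => ?_⟩
      · have := hφ _ rfl (G.flip d)
        simpa using this
      · rcases d with ⟨a, s⟩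
        cases s <;> simp [hB, dartSum, add_comm]
    · rintro ⟨φ, h1, h2⟩
      refine ⟨⟨φ, ?_⟩, ?_⟩
      · intro s hs d
        rw [Set.mem_singleton_iff.1 hs, Equiv.Perm.mul_apply, h1, flip_flip]
      · funext a
        exact h2 (a, false)
  have hle : B.range ≤ bil.orthogonal Δ.range := fun z hz => by
    obtain ⟨φ, hφ⟩ := (hBr z).1 hz
    exact (hZ z).2 (hφ.isCycleModTwo hσ)
  have hdim := LinearMap.BilinForm.finrank_orthogonal hnd Δ.range
  have hle' := Submodule.finrank_le Δ.range
  rw [Module.finrank_fintype_fun_eq_card, ← Nat.card_eq_fintype_card] at hdim hle'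
  -- With V, E, F and c as in Euler's formula, `B` has rank F - c and the orthogonal complement of
  -- the range of `Δ` has dimension E - (V - c); these agree exactly when V - E + F = 2c.
  have h1 : G.IsSpherical σ ↔
      finrank (ZMod 2) B.range = finrank (ZMod 2) (bil.orthogonal Δ.range) := by
    rw [IsSpherical]
    omega
  have h2 : finrank (ZMod 2) B.range = finrank (ZMod 2) (bil.orthogonal Δ.range) ↔
      bil.orthogonal Δ.range ≤ B.range :=
    ⟨fun h => (Submodule.eq_of_le_of_finrank_eq hle h).ge,
      fun h => by rw [le_antisymm hle h]⟩
  rw [h1, h2]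
  constructor
  · intro h z hz
    exact (hBr z).1 (h ((hZ z).2 hz))
  · intro h z hz
    exact (hBr z).2 (h z ((hZ z).1 hz))

end FinDigraph

/-! ### Diplanarity under the insertion of isolated vertices, loops and vertices of degree two. -/

namespace FinDigraph

variable {G H : FinDigraph.{u}}

theorem sameCycle_map {X : Type u} {Y : Type v} {σ : Equiv.Perm X} {σ' : Equiv.Perm Y} {j : X → Y}
    (h : ∀ d, σ' (j d) = j (σ d)) {d d' : X} (hd : σ.SameCycle d d') :
    σ'.SameCycle (j d) (j d') := by
  obtain ⟨n, rfl⟩ := hd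
  refine ⟨n, ?_⟩
  induction n using Int.induction_on generalizing d with
  | zero => rfl
  | succ n ih => rw [zpow_add_one, zpow_add_one, Equiv.Perm.mul_apply, h, ih, Equiv.Perm.mul_apply]
  | pred n ih =>
    have : σ'⁻¹ (j d) = j (σ⁻¹ d) := by
      rw [Equiv.Perm.inv_eq_iff_eq, h]; simp
    rw [zpow_sub_one, zpow_sub_one, Equiv.Perm.mul_apply, this, ih, Equiv.Perm.mul_apply]

theorem isRotationSystem_of {σ : Equiv.Perm G.Dart}
    (h : ∀ d, G.dartVertex (σ d) = G.dartVertex d)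
    (h' : ∀ d d', G.dartVertex d = G.dartVertex d' → σ.SameCycle d d') :
    G.IsRotationSystem σ :=
  fun d d' => ⟨fun hd => invariant_of_sameCycle h hd, h' d d'⟩

/-- All later arguments use diplanarity in this form: embeddings are handled through their face
colourings, without counting faces or components. -/
theorem isDiplanar_iff : G.IsDiplanar ↔ ∃ σ, G.IsRotationSystem σ ∧ G.IsAlternating σ ∧
    ∀ z, G.IsCycleModTwo z → ∃ φ, G.IsFaceColouring σ z φ := by
  constructor
  · rintro ⟨σ, h1, h2, h3⟩
    exact ⟨σ, h1, h2, (isSpherical_iff h1).1 h3⟩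
  · rintro ⟨σ, h1, h2, h3⟩
    exact ⟨σ, h1, h2, (isSpherical_iff h1).2 h3⟩

/-- Diplanarity depends on the arcs and the incidences at the non-isolated vertices only. -/
theorem IsDiplanar.of_arcEquiv (hH : H.IsDiplanar) (ψ : H.E ≃ G.E) (ι : H.V → G.V)
    (hι : Function.Injective ι) (ht : ∀ a, G.tail (ψ a) = ι (H.tail a))
    (hh : ∀ a, G.head (ψ a) = ι (H.head a)) : G.IsDiplanar := by
  obtain ⟨σ, h1, h2, h3⟩ := isDiplanar_iff.1 hH
  set j : H.Dart ≃ G.Dart := ψ.prodCongr (Equiv.refl Bool) with hj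
  have hjdv : ∀ d, G.dartVertex (j d) = ι (H.dartVertex d) := by
    rintro ⟨a, s⟩; cases s <;> simp [hj, ht, hh]
  have hjf : ∀ d, G.flip (j d) = j (H.flip d) := by rintro ⟨a, s⟩; rfl
  have hc : ∀ d, (j.permCongr σ) (j d) = j (σ d) := fun d => by simp [Equiv.permCongr_apply]
  refine isDiplanar_iff.2 ⟨j.permCongr σ, isRotationSystem_of ?_ ?_, ?_, ?_⟩
  · intro d
    obtain ⟨d, rfl⟩ := j.surjective d
    rw [hc, hjdv, hjdv, h1.dartVertex_apply]
  · intro d d' hd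
    obtain ⟨d, rfl⟩ := j.surjective d
    obtain ⟨d', rfl⟩ := j.surjective d'
    rw [hjdv, hjdv] at hd
    exact sameCycle_map hc ((h1 _ _).2 (hι hd))
  · intro d
    obtain ⟨d, rfl⟩ := j.surjective d
    rw [hc]
    exact h2 d
  · intro z hz
    have hz' : H.IsCycleModTwo (z ∘ ψ) := fun g => by
      rw [← hz (Function.extend ι g 0), ← Equiv.sum_comp ψ]
      refine Finset.sum_congr rfl fun a _ => ?_
      rw [ht, hh, hι.extend_apply, hι.extend_apply]; rfl
    obtain ⟨φ, hφ1, hφ2⟩ := h3 _ hz'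
    refine ⟨φ ∘ j.symm, fun d => ?_, fun d => ?_⟩
    · obtain ⟨d, rfl⟩ := j.surjective d
      rw [hc, hjf]; simpa using hφ1 d
    · obtain ⟨d, rfl⟩ := j.surjective d
      rw [hjf, Function.comp, Function.comp, j.symm_apply_apply, j.symm_apply_apply, hφ2]; rfl

/-- Adding a vertex with two darts to a rotation system. -/
theorem exists_rotation_add_vertex {σ : Equiv.Perm H.Dart} (h1 : H.IsRotationSystem σ)
    (h2 : H.IsAlternating σ) (j : H.Dart ↪ G.Dart) (ι : H.V → G.V) (hι : Function.Injective ι)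
    {p q : G.Dart} (hj : ∀ d, d ≠ p → d ≠ q → d ∈ Set.range j)
    (hjdv : ∀ d, G.dartVertex (j d) = ι (H.dartVertex d)) (hpq : G.dartVertex p = G.dartVertex q)
    (hp : ∀ d, G.dartVertex (j d) ≠ G.dartVertex p) (hs : ∀ d, (j d).2 = d.2) (hpq2 : p.2 ≠ q.2) :
    ∃ σ' : Equiv.Perm G.Dart, G.IsRotationSystem σ' ∧ G.IsAlternating σ' ∧
      (∀ d, σ' (j d) = j (σ d)) ∧ σ' p = q ∧ σ' q = p := by
  classical
  have hjp : ∀ d, j d ≠ p := fun d h => hp d (by rw [h])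
  have hjq : ∀ d, j d ≠ q := fun d h => hp d (by rw [h, hpq])
  have hc : ∀ d, (σ.viaEmbedding j * Equiv.swap p q) (j d) = j (σ d) := fun d => by
    rw [Equiv.Perm.mul_apply, Equiv.swap_apply_of_ne_of_ne (hjp d) (hjq d),
      Equiv.Perm.viaEmbedding_apply]
  have hcp : (σ.viaEmbedding j * Equiv.swap p q) p = q := by
    rw [Equiv.Perm.mul_apply, Equiv.swap_apply_left, Equiv.Perm.viaEmbedding_apply_of_notMem]
    rintro ⟨d, hd⟩; exact hjq d hd
  have hcq : (σ.viaEmbedding j * Equiv.swap p q) q = p := by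
    rw [Equiv.Perm.mul_apply, Equiv.swap_apply_right, Equiv.Perm.viaEmbedding_apply_of_notMem]
    rintro ⟨d, hd⟩; exact hjp d hd
  generalize σ.viaEmbedding j * Equiv.swap p q = σ' at hc hcp hcq
  have hcase : ∀ d, d = p ∨ d = q ∨ ∃ d', j d' = d := fun d => by
    by_cases h : d = p
    · exact .inl h
    by_cases h' : d = q
    · exact .inr (.inl h')
    exact .inr (.inr (hj d h h'))
  have hsc : σ'.SameCycle p q := ⟨1, by simpa using hcp⟩
  refine ⟨σ', isRotationSystem_of ?_ ?_, ?_, hc, hcp, hcq⟩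
  · intro d
    rcases hcase d with rfl | rfl | ⟨d, rfl⟩
    · rw [hcp, hpq]
    · rw [hcq, hpq]
    · rw [hc, hjdv, hjdv, h1.dartVertex_apply]
  · intro d d' hd
    rcases hcase d with rfl | rfl | ⟨d, rfl⟩ <;> rcases hcase d' with rfl | rfl | ⟨d', rfl⟩
    · exact .refl _ _
    · exact hsc
    · exact absurd hd.symm (hp _)
    · exact hsc.symm
    · exact .refl _ _
    · exact absurd (hd.symm.trans hpq.symm) (hp _)
    · exact absurd hd (hp _)
    · exact absurd (hd.trans hpq.symm) (hp _)
    · rw [hjdv, hjdv] at hd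
      exact sameCycle_map hc ((h1 _ _).2 (hι hd))
  · intro d
    rcases hcase d with rfl | rfl | ⟨d, rfl⟩
    · rw [hcp]; exact hpq2.symm
    · rw [hcq]; exact hpq2
    · rw [hc, hs, hs]; exact h2 d

theorem IsDiplanar.of_deleteIsolated (x : G.V) (hx : ∀ a, G.tail a ≠ x ∧ G.head a ≠ x)
    (h : (G.deleteIsolated x hx).IsDiplanar) : G.IsDiplanar :=
  h.of_arcEquiv (Equiv.refl _) Subtype.val Subtype.val_injective (fun _ => rfl) (fun _ => rfl)

theorem sum_deleteArcs (C : Set G.E) (F : G.E → ZMod 2) (hF : ∀ a ∈ C, F a = 0) :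
    ∑ a : (G.deleteArcs C).E, F a.1 = ∑ a, F a := by
  classical
  rw [← Finset.sum_filter_of_ne (p := fun a => a ∉ C) (fun a _ h hC => h (hF a hC))]
  exact (Finset.sum_subtype _ (by simp) F).symm

theorem IsDiplanar.of_deleteLoop (x : G.V) (e : G.E)
    (he : ∀ a, G.head a = x ↔ a = e) (hf : ∀ a, G.tail a = x ↔ a = e)
    (h : (G.deleteArcs {e}).IsDiplanar) : G.IsDiplanar := by
  classical
  obtain ⟨σ, h1, h2, h3⟩ := isDiplanar_iff.1 h
  let j : (G.deleteArcs {e}).Dart ↪ G.Dart :=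
    ⟨fun d => (d.1.1, d.2), fun d d' hd => by
      rcases d with ⟨⟨a, ha⟩, s⟩; rcases d' with ⟨⟨a', ha'⟩, s'⟩
      simp only [Prod.mk.injEq] at hd
      obtain ⟨rfl, rfl⟩ := hd
      rfl⟩
  have hjdv : ∀ d, G.dartVertex (j d) = id ((G.deleteArcs {e}).dartVertex d) := by
    rintro ⟨a, s⟩; cases s <;> rfl
  have hte : G.tail e = x := (hf e).2 rfl
  have hhe : G.head e = x := (he e).2 rfl
  obtain ⟨σ', r1, r2, hc, hp, hq⟩ := exists_rotation_add_vertex h1 h2 j id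
    Function.injective_id (p := (e, false)) (q := (e, true))
    (by
      rintro ⟨a, s⟩ hp hq
      have : a ≠ e := by
        rintro rfl; cases s <;> simp at hp hq
      exact ⟨(⟨a, this⟩, s), rfl⟩) hjdv (by simp [hte, hhe])
    (by
      rintro ⟨⟨a, ha⟩, s⟩ hd
      rw [dartVertex_false, hte] at hd
      cases s
      · exact ha ((hf a).1 hd)
      · exact ha ((he a).1 hd)) (fun _ => rfl) (by simp)
  refine isDiplanar_iff.2 ⟨σ', r1, r2, fun z hz => ?_⟩
  have hz' : (G.deleteArcs {e}).IsCycleModTwo (fun a => z a.1) := fun g => by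
    rw [← hz g]
    refine sum_deleteArcs {e} (fun a => z a * (g (G.tail a) + g (G.head a))) ?_
    rintro a rfl
    rw [hte, hhe, CharTwo.add_self_eq_zero, mul_zero]
  obtain ⟨φ, hφ1, hφ2⟩ := h3 _ hz'
  have hcase : ∀ d : G.Dart, d = (e, false) ∨ d = (e, true) ∨ ∃ d', j d' = d := by
    rintro ⟨a, s⟩
    by_cases h : a = e
    · subst h; cases s <;> simp
    · exact .inr (.inr ⟨(⟨a, h⟩, s), rfl⟩)
  -- Each dart of the loop is a facial walk of its own, so its two sides can be coloured freely.
  let φ' : G.Dart → ZMod 2 := fun d => if hd : d.1 = e then (if d.2 then 0 else z e) else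
    φ (⟨d.1, hd⟩, d.2)
  have hφ'j : ∀ d, φ' (j d) = φ d := fun d => dif_neg d.1.2
  have hjf : ∀ d, G.flip (j d) = j ((G.deleteArcs {e}).flip d) := by rintro ⟨a, s⟩; rfl
  refine ⟨φ', fun d => ?_, fun d => ?_⟩
  · rcases hcase d with rfl | rfl | ⟨d, rfl⟩
    · rw [hp]; rfl
    · rw [hq]; rfl
    · rw [hc, hjf, hφ'j, hφ'j, hφ1]
  · rcases hcase d with rfl | rfl | ⟨d, rfl⟩
    · simp [φ']
    · simp [φ']
    · rw [hjf, hφ'j, hφ'j, hφ2]; rfl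

/-- If `G` arises from `H` by the subdivision of the arc `e'` with a vertex `x`, then the
diplanarity of `H` implies that of `G`. -/
theorem IsDiplanar.of_subdivision (hH : H.IsDiplanar) (ψ : H.E ↪ G.E) (ι : H.V → G.V)
    (hι : Function.Injective ι) (e' : H.E) (f : G.E) (x : G.V)
    (hψ : ∀ a, a ≠ f → ∃ b, ψ b = a) (hψf : ∀ b, ψ b ≠ f)
    (ht : ∀ b, G.tail (ψ b) = ι (H.tail b)) (hh : ∀ b, b ≠ e' → G.head (ψ b) = ι (H.head b))
    (he : G.head (ψ e') = x) (hfh : G.head f = ι (H.head e')) (hft : G.tail f = x)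
    (hx : ∀ v, ι v ≠ x) : G.IsDiplanar := by
  classical
  obtain ⟨σ, h1, h2, h3⟩ := isDiplanar_iff.1 hH
  -- The arc `e'` becomes `ψ e'` followed by `f`, so its head dart becomes the head dart of `f`. The
  -- darts that are left over are the two at `x`.
  let jf : H.Dart → G.Dart := fun d => if d.1 = e' ∧ d.2 = true then (f, true) else (ψ d.1, d.2)
  have hj1 : jf (e', true) = (f, true) := if_pos ⟨rfl, rfl⟩
  have hj2 : ∀ b s, ¬ (b = e' ∧ s = true) → jf (b, s) = (ψ b, s) := fun b s h => if_neg h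
  have hcase : ∀ d : H.Dart, d = (e', true) ∨ jf d = (ψ d.1, d.2) := by
    rintro ⟨b, s⟩
    by_cases h : b = e' ∧ s = true
    · obtain ⟨rfl, rfl⟩ := h; exact .inl rfl
    · exact .inr (hj2 b s h)
  -- Both halves of the subdivided arc are sent back to `e'`; face colourings are pulled back along
  -- this map.
  let k : G.Dart → H.Dart := fun d => (if h : ∃ b, ψ b = d.1 then h.choose else e', d.2)
  have hk1 : ∀ b s, k (ψ b, s) = (b, s) := fun b s => by
    have h : ∃ b', ψ b' = ψ b := ⟨b, rfl⟩
    simp only [k, dif_pos h]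
    rw [ψ.injective h.choose_spec]
  have hk2 : ∀ s, k (f, s) = (e', s) := fun s => by
    have h : ¬ ∃ b', ψ b' = f := fun ⟨b, hb⟩ => hψf b hb
    simp only [k, dif_neg h]
  have hkj : ∀ d, k (jf d) = d := fun d => by
    rcases hcase d with rfl | h
    · rw [hj1, hk2]
    · rw [h, hk1]
  let j : H.Dart ↪ G.Dart := ⟨jf, Function.LeftInverse.injective hkj⟩
  have hjdv : ∀ d, G.dartVertex (jf d) = ι (H.dartVertex d) := by
    rintro ⟨b, s⟩
    cases s
    · rw [hj2 _ _ (by simp)]; exact ht b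
    · by_cases hb : b = e'
      · subst hb; rw [hj1]; exact hfh
      · rw [hj2 _ _ (by simp [hb])]; exact hh b hb
  have hgcase : ∀ d : G.Dart, d = (ψ e', true) ∨ d = (f, false) ∨ ∃ d', jf d' = d := by
    rintro ⟨a, s⟩
    by_cases h : a = f
    · subst h
      cases s
      · exact .inr (.inl rfl)
      · exact .inr (.inr ⟨_, hj1⟩)
    · obtain ⟨b, rfl⟩ := hψ a h
      by_cases h' : b = e' ∧ s = true
      · obtain ⟨rfl, rfl⟩ := h'; exact .inl rfl
      · exact .inr (.inr ⟨_, hj2 _ _ h'⟩)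
  obtain ⟨σ', r1, r2, hc, hp, hq⟩ := exists_rotation_add_vertex h1 h2 j ι hι
    (p := (ψ e', true)) (q := (f, false))
    (fun d hp hq => (hgcase d).resolve_left hp |>.resolve_left hq) hjdv (by simp [he, hft])
    (fun d => by rw [dartVertex_true, he]; exact fun h => hx _ ((hjdv d).symm.trans h))
    (fun d => by
      change (jf d).2 = d.2
      rcases hcase d with rfl | h
      · rw [hj1]
      · rw [h]) (by simp)
  refine isDiplanar_iff.2 ⟨σ', r1, r2, fun z hz => ?_⟩
  have huniv : (Finset.univ : Finset G.E) = insert f (Finset.univ.map ψ) := by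
    ext a
    by_cases h : a = f
    · simp [h]
    · simpa [h] using hψ a h
  have hsum : ∀ F : G.E → ZMod 2, ∑ a, F a = F f + ∑ b, F (ψ b) := fun F => by
    rw [huniv, Finset.sum_insert (by simpa using hψf), Finset.sum_map]
  -- The cycle condition at `x`, tested with the indicator function of `x`.
  have hzef : z f = z (ψ e') := by
    have := hz (Pi.single x 1)
    rw [hsum, Finset.sum_eq_single e'] at this
    · rw [hft, hfh, ht, he] at this
      simpa [hx, CharTwo.add_eq_zero] using this
    · intro b _ hb
      rw [ht, hh b hb]
      simp [hx]
    · simp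
  have hz' : H.IsCycleModTwo (z ∘ ψ) := fun g => by
    -- With the value at `x` copied from the head of `e'`, the arc `f` contributes nothing.
    let g' : G.V → ZMod 2 := fun w => if w = x then g (H.head e') else Function.extend ι g 0 w
    have hg' : ∀ v, g' (ι v) = g v := fun v => by
      simp only [g', if_neg (hx v), hι.extend_apply]
    have hg'x : g' x = g (H.head e') := if_pos rfl
    rw [← hz g', hsum, hft, hfh, hg', hg'x, CharTwo.add_self_eq_zero, mul_zero, zero_add]
    refine Finset.sum_congr rfl fun b _ => ?_
    by_cases hb : b = e'
    · subst hb; rw [ht, he, hg', hg'x]; rfl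
    · rw [ht, hh b hb, hg', hg']; rfl
  obtain ⟨φ, hφ1, hφ2⟩ := h3 _ hz'
  have hkf : ∀ d, k (G.flip d) = H.flip (k d) := by rintro ⟨a, s⟩; rfl
  refine ⟨φ ∘ k, fun d => ?_, fun d => ?_⟩
  · rcases hgcase d with rfl | rfl | ⟨d, rfl⟩
    · rw [hp]; simp [hk1, hk2]
    · rw [hq]; simp [hk1, hk2]
    · have : σ' (jf d) = jf (σ d) := hc d
      rw [this, Function.comp, Function.comp, hkj, hkf, hkj, hφ1]
  · rw [Function.comp, Function.comp, hkf, hφ2]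
    rcases d with ⟨a, s⟩
    by_cases h : a = f
    · subst h; rw [hk2]; exact hzef.symm
    · obtain ⟨b, rfl⟩ := hψ a h
      rw [hk1]; rfl

theorem IsDiplanar.of_suppress (x : G.V) (e f : G.E) (hef : e ≠ f)
    (he : ∀ a, G.head a = x ↔ a = e) (hf : ∀ a, G.tail a = x ↔ a = f)
    (h : (G.suppress x e f hef he hf).IsDiplanar) : G.IsDiplanar := by
  classical
  refine h.of_subdivision (⟨Subtype.val, Subtype.val_injective⟩ : {a // a ≠ f} ↪ G.E)
    Subtype.val Subtype.val_injective (⟨e, hef⟩ : {a // a ≠ f}) f x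
    (fun a ha => ⟨⟨a, ha⟩, rfl⟩) (fun b => b.2) (fun _ => rfl) ?_ ((he e).2 rfl) ?_ ((hf f).2 rfl)
    (fun v => v.2)
  · intro b hb
    have : b.1 ≠ e := fun h => hb (Subtype.ext h)
    simp only [suppress, dif_neg this]
    rfl
  · simp [suppress]

end FinDigraph

namespace FinDigraph

variable {G H : FinDigraph.{u}}

/-! ### Directed cycles -/

/-- `c` runs around a directed cycle of length `n` again and again. -/
structure IsCyc (G : FinDigraph.{u}) (n : ℕ) (c : ℕ → G.E) : Prop where
  pos : 0 < n
  next : ∀ i, G.head (c i) = G.tail (c (i + 1))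
  period : ∀ i, c (i + n) = c i
  inj : ∀ i < n, ∀ j < n, G.tail (c i) = G.tail (c j) → i = j

namespace IsCyc

variable {n : ℕ} {c : ℕ → G.E}

theorem apply_mod (h : G.IsCyc n c) (i : ℕ) : c (i % n) = c i := by
  have : ∀ k i, c (i + n * k) = c i := by
    intro k
    induction k with
    | zero => simp
    | succ k ih => intro i; rw [Nat.mul_succ, ← add_assoc, h.period, ih]
  conv_rhs => rw [← Nat.mod_add_div i n]
  exact (this _ _).symm

theorem mod_eq_of_tail (h : G.IsCyc n c) {i j : ℕ} (hij : G.tail (c i) = G.tail (c j)) :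
    i % n = j % n := by
  rw [← h.apply_mod i, ← h.apply_mod j] at hij
  exact h.inj _ (Nat.mod_lt _ h.pos) _ (Nat.mod_lt _ h.pos) hij

theorem eq_of_tail (h : G.IsCyc n c) {i j : ℕ} (hij : G.tail (c i) = G.tail (c j)) :
    c i = c j := by
  rw [← h.apply_mod i, ← h.apply_mod j, h.mod_eq_of_tail hij]

theorem mem_range_iff (h : G.IsCyc n c) {a : G.E} : a ∈ Set.range c ↔ ∃ i < n, c i = a :=
  ⟨fun ⟨i, hi⟩ => ⟨i % n, Nat.mod_lt _ h.pos, by rw [h.apply_mod, hi]⟩,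
    fun ⟨i, _, hi⟩ => ⟨i, hi⟩⟩

theorem shift (h : G.IsCyc n c) (k : ℕ) : G.IsCyc n (fun i => c (i + k)) where
  pos := h.pos
  next i := by rw [h.next]; congr 2; omega
  period i := by rw [add_right_comm, h.period]
  inj i hi j hj hij := by
    have h1 : (i + k) ≡ (j + k) [MOD n] := h.mod_eq_of_tail hij
    have h2 : i % n = j % n := Nat.ModEq.add_right_cancel' k h1
    rwa [Nat.mod_eq_of_lt hi, Nat.mod_eq_of_lt hj] at h2

theorem range_shift (h : G.IsCyc n c) (k : ℕ) : Set.range (fun i => c (i + k)) = Set.range c := by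
  ext a
  constructor
  · rintro ⟨i, rfl⟩; exact ⟨_, rfl⟩
  · rintro ⟨i, rfl⟩
    refine ⟨i + (n - 1) * k, ?_⟩
    have : i + (n - 1) * k + k = i + n * k := by
      obtain ⟨m, rfl⟩ : ∃ m, n = m + 1 := ⟨n - 1, by have := h.pos; omega⟩
      simp; ring
    dsimp only
    rw [this, ← h.apply_mod, Nat.add_mul_mod_self_left, h.apply_mod]

end IsCyc

/-- Periodic sequences over the natural numbers make it easy to move the starting arc of a cycle and
to speak of its segments. -/
theorem isDirectedCycle_iff {C : Set G.E} :
    G.IsDirectedCycle C ↔ ∃ n c, G.IsCyc n c ∧ Set.range c = C := by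
  constructor
  · rintro ⟨n, hn, c, h1, h2, rfl⟩
    obtain ⟨m, rfl⟩ : ∃ m, n = m + 1 := ⟨n - 1, by omega⟩
    refine ⟨m + 1, fun i => c ⟨i % (m + 1), Nat.mod_lt _ hn⟩, ⟨hn, fun i => ?_, fun i => ?_, ?_⟩, ?_⟩
    · rw [h1]
      congr 2
      rw [finRotate_apply]
      apply Fin.ext
      simp [Fin.val_add]
    · simp
    · intro i hi j hj hij
      have := h2 hij
      simpa [Nat.mod_eq_of_lt hi, Nat.mod_eq_of_lt hj] using this
    · ext a
      constructor
      · rintro ⟨i, rfl⟩; exact ⟨_, rfl⟩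
      · rintro ⟨i, rfl⟩; exact ⟨i, by simp [Nat.mod_eq_of_lt i.2]⟩
  · rintro ⟨n, c, h, rfl⟩
    have hn := h.pos
    obtain ⟨m, rfl⟩ : ∃ m, n = m + 1 := ⟨n - 1, by omega⟩
    refine ⟨m + 1, hn, fun i => c i, fun i => ?_, fun i j hij => ?_, ?_⟩
    · rw [h.next, finRotate_apply, ← h.apply_mod (i + 1)]
      simp [Fin.val_add]
    · exact Fin.ext (h.inj _ i.2 _ j.2 hij)
    · ext a
      rw [h.mem_range_iff]
      constructor
      · rintro ⟨i, rfl⟩; exact ⟨i, i.2, rfl⟩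
      · rintro ⟨i, hi, rfl⟩; exact ⟨⟨i, hi⟩, rfl⟩

/-- A set of arcs in which every arc has a successor contains a directed cycle. -/
theorem exists_cyc_subset {Z : Set G.E} (hne : Z.Nonempty)
    (hZ : ∀ a ∈ Z, ∃ b ∈ Z, G.tail b = G.head a) :
    ∃ n c, G.IsCyc n c ∧ Set.range c ⊆ Z := by
  classical
  obtain ⟨a0, ha0⟩ := hne
  choose! s hsZ hs using hZ
  let w : ℕ → G.E := fun k => s^[k] a0
  have hwZ : ∀ k, w k ∈ Z := by
    intro k
    induction k with
    | zero => exact ha0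
    | succ k ih => simp only [w, Function.iterate_succ_apply']; exact hsZ _ ih
  have hw : ∀ k, G.head (w k) = G.tail (w (k + 1)) := fun k => by
    simp only [w, Function.iterate_succ_apply']; exact (hs _ (hwZ k)).symm
  -- The walk repeats a vertex; a shortest return between equal vertices has no inner repetition and
  -- is a directed cycle.
  have hex : ∃ n, 0 < n ∧ ∃ i, G.tail (w i) = G.tail (w (i + n)) := by
    obtain ⟨i, j, hij, h⟩ := Finite.exists_ne_map_eq_of_infinite (fun k => G.tail (w k))
    rcases lt_or_gt_of_ne hij with hlt | hlt
    · exact ⟨j - i, by omega, i, by rw [Nat.add_sub_cancel' hlt.le]; exact h⟩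
    · exact ⟨i - j, by omega, j, by rw [Nat.add_sub_cancel' hlt.le]; exact h.symm⟩
  obtain ⟨hn, i, hi⟩ := Nat.find_spec hex
  have hmin : ∀ m, m < Nat.find hex → ¬ _ := fun m hm => Nat.find_min hex hm
  set n := Nat.find hex
  refine ⟨n, fun k => w (i + k % n), ⟨hn, fun k => ?_, fun k => by simp, ?_⟩, ?_⟩
  · rw [hw]
    by_cases hk : k % n + 1 = n
    · have h1 : (k + 1) % n = 0 := by
        rw [Nat.add_mod]
        rcases Nat.lt_or_ge 1 n with h | h
        · rw [Nat.mod_eq_of_lt h, hk, Nat.mod_self]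
        · have : n = 1 := by omega
          rw [this]; exact Nat.mod_one _
      rw [h1, add_zero, hi, add_assoc, hk]
    · have hlt := Nat.mod_lt k hn
      have h1 : (k + 1) % n = k % n + 1 := by
        rw [Nat.add_mod, Nat.mod_eq_of_lt (a := 1) (by omega), Nat.mod_eq_of_lt (by omega)]
      rw [h1, add_assoc]
  · intro p hp q hq h
    simp only [Nat.mod_eq_of_lt hp, Nat.mod_eq_of_lt hq] at h
    by_contra hne
    rcases lt_or_gt_of_ne hne with hlt | hlt
    · exact hmin (q - p) (by omega) ⟨by omega, i + p, by
        rw [h]; congr 2; omega⟩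
    · exact hmin (p - q) (by omega) ⟨by omega, i + q, by
        rw [← h]; congr 2; omega⟩
  · rintro _ ⟨k, rfl⟩; exact hwZ _

/-! ### Balanced sets of arcs -/

/-- Every vertex is the head of as many arcs of `Z` as it is the tail. -/
def Balanced (Z : Finset G.E) : Prop :=
  ∀ g : G.V → ℤ, ∑ a ∈ Z, (g (G.head a) - g (G.tail a)) = 0

open Classical in
theorem inDegree_eq (v : G.V) : G.inDegree v = (Finset.univ.filter fun a => G.head a = v).card := by
  rw [inDegree, Nat.card_eq_fintype_card, Fintype.card_subtype]

open Classical in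
theorem outDegree_eq (v : G.V) :
    G.outDegree v = (Finset.univ.filter fun a => G.tail a = v).card := by
  rw [outDegree, Nat.card_eq_fintype_card, Fintype.card_subtype]

-- Testing with all integer functions makes sums along cycles and segments telescope; indicator
-- functions recover the count at each vertex.
open Classical in
theorem balanced_iff {Z : Finset G.E} : Balanced Z ↔
    ∀ v, (Z.filter fun a => G.head a = v).card = (Z.filter fun a => G.tail a = v).card := by
  constructor
  · intro h v
    have := h (fun w => if w = v then 1 else 0)
    rw [Finset.sum_sub_distrib, Finset.sum_boole, Finset.sum_boole, sub_eq_zero] at this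
    exact_mod_cast this
  · intro h g
    have key : ∀ p : G.E → G.V, ∑ a ∈ Z, g (p a) =
        ∑ v, ((Z.filter fun a => p a = v).card : ℤ) * g v := fun p => by
      rw [← Finset.sum_fiberwise Z p]
      refine Finset.sum_congr rfl fun v _ => ?_
      rw [Finset.sum_congr rfl (g := fun _ => g v) fun a ha => by rw [(Finset.mem_filter.1 ha).2]]
      simp
    rw [Finset.sum_sub_distrib, key, key, sub_eq_zero]
    exact Finset.sum_congr rfl fun v _ => by rw [h]

/-- In-degree and out-degree agree at every vertex, and they are at most two. -/
def IsSubquartic (G : FinDigraph.{u}) : Prop :=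
  ∀ v, G.inDegree v = G.outDegree v ∧ G.inDegree v ≤ 2

theorem IsQuarticEulerian.isSubquartic (h : G.IsQuarticEulerian) : G.IsSubquartic :=
  fun v => ⟨(h v).1.trans (h v).2.symm, (h v).1.le⟩

theorem IsSubquartic.balanced_univ (h : G.IsSubquartic) : Balanced (Finset.univ : Finset G.E) := by
  rw [balanced_iff]
  intro v
  rw [← inDegree_eq, ← outDegree_eq, (h v).1]

theorem Balanced.exists_next {Z : Finset G.E} (hZ : Balanced Z) {a : G.E} (ha : a ∈ Z) :
    ∃ b ∈ Z, G.tail b = G.head a := by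
  classical
  have h := balanced_iff.1 hZ (G.head a)
  have : 0 < (Z.filter fun b => G.tail b = G.head a).card := by
    rw [← h]
    exact Finset.card_pos.2 ⟨a, by simp [ha]⟩
  obtain ⟨b, hb⟩ := Finset.card_pos.1 this
  exact ⟨b, by simpa using hb⟩

open Classical in
theorem Balanced.sdiff {Z C : Finset G.E} (hZ : Balanced Z) (hC : Balanced C) (h : C ⊆ Z) :
    Balanced (Z \ C) := fun g => by
  have := Finset.sum_sdiff (f := fun a => g (G.head a) - g (G.tail a)) h
  rw [hZ g, hC g, add_zero] at this
  exact this

theorem IsCyc.balanced {n : ℕ} {c : ℕ → G.E} (h : G.IsCyc n c) {C : Finset G.E}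
    (hC : Set.range c = C) : Balanced C := by
  classical
  intro g
  have : C = (Finset.range n).image c := by
    ext a
    rw [← Finset.mem_coe, ← hC, h.mem_range_iff]
    simp
  rw [this, Finset.sum_image]
  · rw [Finset.sum_congr rfl fun i _ => by rw [h.next i],
      Finset.sum_range_sub (fun i => g (G.tail (c i)))]
    have := h.period 0
    rw [zero_add] at this
    rw [this, sub_self]
  · intro i hi j hj hij
    exact h.inj i (by simpa using hi) j (by simpa using hj) (by rw [hij])

theorem Balanced.exists_cyc {Z : Finset G.E} (hZ : Balanced Z) (hne : Z.Nonempty) :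
    ∃ (C : Finset G.E) (n : ℕ) (c : ℕ → G.E), C ⊆ Z ∧ G.IsCyc n c ∧ Set.range c = C := by
  classical
  obtain ⟨n, c, hc, hs⟩ := exists_cyc_subset (Z := (Z : Set G.E)) (by simpa using hne)
    (fun a ha => hZ.exists_next ha)
  refine ⟨(Finset.range n).image c, n, c, ?_, hc, ?_⟩
  · intro a ha
    obtain ⟨i, _, rfl⟩ := Finset.mem_image.1 ha
    exact hs ⟨i, rfl⟩
  · ext a
    rw [hc.mem_range_iff]
    simp

/-! ### Smaller digraphs -/

open Classical in
theorem card_deleteArcs (Z : Finset G.E) (p : G.E → G.V) (v : G.V) :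
    Nat.card {a : (G.deleteArcs Z).E // p a.1 = v} + (Z.filter fun a => p a = v).card =
      (Finset.univ.filter fun a => p a = v).card := by
  have h : Nat.card {a : (G.deleteArcs Z).E // p a.1 = v} =
      Nat.card {a : G.E // a ∉ (Z : Set G.E) ∧ p a = v} :=
    Nat.card_congr
      (Equiv.subtypeSubtypeEquivSubtypeInter (fun a => a ∉ (Z : Set G.E)) (fun a => p a = v))
  rw [h, Nat.card_eq_fintype_card, Fintype.card_subtype,
    ← Finset.card_filter_add_card_filter_not (s := Finset.univ.filter fun a => p a = v)
      (fun a => a ∉ (Z : Set G.E)), Finset.filter_filter, Finset.filter_filter]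
  congr 2
  · ext a; simp [and_comm]
  · ext a; simp [and_comm]

theorem IsSubquartic.deleteArcs (h : G.IsSubquartic) {Z : Finset G.E} (hZ : Balanced Z) :
    (G.deleteArcs Z).IsSubquartic := by
  classical
  intro (v : G.V)
  have h1 := card_deleteArcs Z G.head v
  have h2 := card_deleteArcs Z G.tail v
  rw [← inDegree_eq] at h1
  rw [← outDegree_eq] at h2
  have h3 := balanced_iff.1 hZ v
  have h4 := h v
  change (G.deleteArcs Z).inDegree v + _ = _ at h1
  change (G.deleteArcs Z).outDegree v + _ = _ at h2
  omega

theorem IsSubquartic.deleteIsolated (h : G.IsSubquartic) (x : G.V)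
    (hx : ∀ a, G.tail a ≠ x ∧ G.head a ≠ x) : (G.deleteIsolated x hx).IsSubquartic := by
  intro v
  have h1 : (G.deleteIsolated x hx).inDegree v = G.inDegree v.1 :=
    Nat.card_congr (Equiv.subtypeEquivRight fun a => Subtype.ext_iff)
  have h2 : (G.deleteIsolated x hx).outDegree v = G.outDegree v.1 :=
    Nat.card_congr (Equiv.subtypeEquivRight fun a => Subtype.ext_iff)
  rw [h1, h2]
  exact h v.1

theorem IsSubquartic.suppress (h : G.IsSubquartic) (x : G.V) (e f : G.E) (hef : e ≠ f)
    (he : ∀ a, G.head a = x ↔ a = e) (hf : ∀ a, G.tail a = x ↔ a = f) :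
    (G.suppress x e f hef he hf).IsSubquartic := by
  classical
  intro v
  have h1 : (G.suppress x e f hef he hf).inDegree v = G.inDegree v.1 := by
    have hh1 : (G.suppress x e f hef he hf).head ⟨e, hef⟩ = v ↔ G.head f = v.1 := by
      simp only [FinDigraph.suppress, dif_pos]
      exact Subtype.ext_iff
    have hh2 : ∀ a (ha : a ≠ f), a ≠ e →
        ((G.suppress x e f hef he hf).head ⟨a, ha⟩ = v ↔ G.head a = v.1) := fun a ha hae => by
      simp only [FinDigraph.suppress, dif_neg hae]
      exact Subtype.ext_iff
    have hhe : G.head e ≠ v.1 := fun h => v.2 (h.symm.trans ((he e).2 rfl))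
    -- In the suppressed digraph `e` has the head of `f`, so the bijection between in-arcs replaces
    -- `e` by `f`.
    refine Nat.card_congr
      { toFun := fun a => if h : a.1.1 = e then ⟨f, ?_⟩ else ⟨a.1.1, ?_⟩
        invFun := fun a => if h : a.1 = f then ⟨⟨e, hef⟩, ?_⟩ else ⟨⟨a.1, h⟩, ?_⟩
        left_inv := ?_
        right_inv := ?_ }
    · obtain ⟨⟨a, ha⟩, ha'⟩ := a
      dsimp only at h
      subst h
      exact hh1.1 ha'
    · obtain ⟨⟨a, ha⟩, ha'⟩ := a
      exact (hh2 a ha h).1 ha'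
    · obtain ⟨a, ha⟩ := a
      dsimp only at h
      subst h
      exact hh1.2 ha
    · obtain ⟨a, ha⟩ := a
      refine (hh2 a h ?_).2 ha
      rintro rfl
      exact hhe ha
    · rintro ⟨⟨a, ha⟩, ha'⟩
      by_cases hae : a = e
      · subst hae; simp
      · simp only [dif_neg hae, dif_neg ha]
    · rintro ⟨a, ha⟩
      by_cases haf : a = f
      · subst haf; simp
      · have : a ≠ e := by rintro rfl; exact hhe ha
        simp only [dif_neg this, dif_neg haf]
  have h2 : (G.suppress x e f hef he hf).outDegree v = G.outDegree v.1 := by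
    have hhf : G.tail f ≠ v.1 := fun h => v.2 (h.symm.trans ((hf f).2 rfl))
    refine Nat.card_congr
      { toFun := fun a => ⟨a.1.1, congrArg Subtype.val a.2⟩
        invFun := fun a => ⟨⟨a.1, ?_⟩, Subtype.ext a.2⟩
        left_inv := fun _ => rfl
        right_inv := fun _ => rfl }
    exact fun h' => hhf (h' ▸ a.2)
  rw [h1, h2]
  exact h v.1

/-- A digraph with vertices of degree zero, two and four is diplanar if the quartic digraphs that
arise from it are. -/
theorem IsSubquartic.isDiplanar (hG : G.IsSubquartic)
    (hred : ∀ H : FinDigraph.{u}, H.IsQuarticEulerian → Relation.ReflTransGen Step G H →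
      H.IsDiplanar) : G.IsDiplanar := by
  classical
  obtain ⟨n, hn⟩ : ∃ n, n = Nat.card G.V + Nat.card G.E := ⟨_, rfl⟩
  induction n using Nat.strong_induction_on generalizing G with
  | _ n ih =>
  subst hn
  have hstep : ∀ H : FinDigraph.{u}, Step G H → H.IsSubquartic →
      Nat.card H.V + Nat.card H.E < Nat.card G.V + Nat.card G.E → H.IsDiplanar :=
    fun H hs hH hlt => ih _ hlt hH (fun K hK hHK => hred K hK (hHK.head hs)) rfl
  have hlt : ∀ {α : Type u} [Finite α] (p : α → Prop) (a : α), ¬ p a →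
      Nat.card {b // p b} < Nat.card α := fun p a ha => by
    have := Fintype.ofFinite
    rw [Nat.card_eq_fintype_card, Nat.card_eq_fintype_card]
    exact Fintype.card_subtype_lt ha
  by_cases h0 : ∃ x, G.inDegree x = 0
  · obtain ⟨x, hx⟩ := h0
    have hx' := hx
    rw [(hG x).1] at hx'
    rw [inDegree_eq, Finset.card_eq_zero, Finset.filter_eq_empty_iff] at hx
    rw [outDegree_eq, Finset.card_eq_zero, Finset.filter_eq_empty_iff] at hx'
    have hiso : ∀ a, G.tail a ≠ x ∧ G.head a ≠ x :=
      fun a => ⟨hx' (Finset.mem_univ a), hx (Finset.mem_univ a)⟩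
    refine IsDiplanar.of_deleteIsolated x hiso (hstep _ (.removeIsolated G x hiso)
      (hG.deleteIsolated x hiso) ?_)
    exact Nat.add_lt_add_right (hlt (fun y => y ≠ x) x (by simp)) _
  by_cases h1 : ∃ x, G.inDegree x = 1
  · obtain ⟨x, hx⟩ := h1
    have hx' := hx
    rw [(hG x).1] at hx'
    rw [inDegree_eq, Finset.card_eq_one] at hx
    rw [outDegree_eq, Finset.card_eq_one] at hx'
    obtain ⟨e, he⟩ := hx
    obtain ⟨f, hf⟩ := hx'
    have he' : ∀ a, G.head a = x ↔ a = e := fun a => by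
      have := Finset.ext_iff.1 he a
      simpa using this
    have hf' : ∀ a, G.tail a = x ↔ a = f := fun a => by
      have := Finset.ext_iff.1 hf a
      simpa using this
    -- A vertex that carries only a loop cannot be suppressed; its loop is removed as a directed
    -- cycle of length one instead.
    by_cases hef : e = f
    · subst hef
      have hloop : G.IsDirectedCycle {e} := isDirectedCycle_iff.2 ⟨1, fun _ => e,
        ⟨one_pos, fun _ => by rw [(he' e).2 rfl, (hf' e).2 rfl], fun _ => rfl, by omega⟩, by simp⟩
      have hbal : Balanced ({e} : Finset G.E) := fun g => by
        rw [Finset.sum_singleton, (he' e).2 rfl, (hf' e).2 rfl, sub_self]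
      have hsq := hG.deleteArcs hbal
      rw [Finset.coe_singleton] at hsq
      refine IsDiplanar.of_deleteLoop x e he' hf' (hstep _ (.removeCycle G {e} hloop) hsq ?_)
      exact Nat.add_lt_add_left (hlt (fun a => a ∉ ({e} : Set G.E)) e (by simp)) _
    · refine IsDiplanar.of_suppress x e f hef he' hf'
        (hstep _ (.suppressVertex G x e f hef he' hf') (hG.suppress x e f hef he' hf') ?_)
      exact Nat.add_lt_add (hlt (fun y => y ≠ x) x (by simp)) (hlt (fun a => a ≠ f) f (by simp))
  · refine hred G (fun v => ?_) .refl
    have h := hG v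
    have h0' : G.inDegree v ≠ 0 := fun h => h0 ⟨v, h⟩
    have h1' : G.inDegree v ≠ 1 := fun h => h1 ⟨v, h⟩
    omega

/-- The removal of a non-empty balanced set of arcs from a minimal digraph yields a diplanar
digraph. -/
theorem IsSubquartic.isDiplanar_deleteArcs (hG : G.IsSubquartic)
    (hred : ∀ H : FinDigraph.{u}, H.IsQuarticEulerian → Relation.TransGen Step G H →
      H.IsDiplanar) {Z : Finset G.E} (hZ : Balanced Z) (hne : Z.Nonempty) :
    (G.deleteArcs Z).IsDiplanar := by
  classical
  induction hn : Z.card using Nat.strong_induction_on generalizing G with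
  | _ n ih =>
  subst hn
  -- One directed cycle is peeled off. What is left of `Z` is balanced in the remaining digraph,
  -- which inherits the hypothesis on smaller digraphs.
  obtain ⟨C, n, c, hCZ, hc, hcC⟩ := hZ.exists_cyc hne
  have hCbal := hc.balanced hcC
  have hstep : Step G (G.deleteArcs C) :=
    .removeCycle G C (isDirectedCycle_iff.2 ⟨n, c, hc, hcC⟩)
  have hsq := hG.deleteArcs hCbal
  have hc0 : c 0 ∈ C := by rw [← Finset.mem_coe, ← hcC]; exact ⟨0, rfl⟩
  by_cases hZC : Z = C
  · subst hZC
    exact hsq.isDiplanar fun H hH hs => hred H hH (.head' hstep hs)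
  · let Z' : Finset (G.deleteArcs C).E := Z.subtype (fun a => a ∉ (C : Set G.E))
    have hmem : ∀ a : (G.deleteArcs C).E, a ∈ Z' ↔ a.1 ∈ Z := fun a => Finset.mem_subtype
    have hZ'bal : Balanced Z' := fun g => by
      have h := (hZ.sdiff hCbal hCZ) g
      rw [← h]
      refine Finset.sum_bij (fun a _ => a.1) ?_ ?_ ?_ ?_
      · intro a ha
        exact Finset.mem_sdiff.2 ⟨(hmem a).1 ha, a.2⟩
      · intro a _ b _ hab; exact Subtype.ext hab
      · intro b hb
        obtain ⟨h1, h2⟩ := Finset.mem_sdiff.1 hb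
        exact ⟨⟨b, h2⟩, (hmem _).2 h1, rfl⟩
      · intro a _; rfl
    have hne' : Z'.Nonempty := by
      obtain ⟨a, ha, haC⟩ := Finset.exists_of_ssubset (hCZ.ssubset_of_ne (Ne.symm hZC))
      exact ⟨⟨a, haC⟩, (hmem _).2 ha⟩
    have hcard : Z'.card < Z.card := by
      rw [show Z'.card = _ from Finset.card_subtype _ Z]
      exact Finset.card_lt_card (Finset.filter_ssubset.2 ⟨c 0, hCZ hc0, by simpa using hc0⟩)
    have hd := ih _ hcard hsq (fun H hH hs => hred H hH (.head hstep hs)) hZ'bal hne' rfl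
    refine hd.of_arcEquiv
      { toFun := fun a => ⟨a.1.1, fun h => a.2 ((hmem a.1).2 h)⟩
        invFun := fun a => ⟨⟨a.1, fun h => a.2 (hCZ h)⟩, fun h => a.2 ((hmem _).1 h)⟩
        left_inv := fun _ => rfl
        right_inv := fun _ => rfl } id Function.injective_id (fun _ => rfl) (fun _ => rfl)

end FinDigraph

/-! ### Anti-digons as separating curves in plane embeddings. -/

namespace FinDigraph

variable {G : FinDigraph.{u}}

/-- The vertex `w` is an end of the arc `a`. -/
def Inc (G : FinDigraph.{u}) (a : G.E) (w : G.V) : Prop := G.tail a = w ∨ G.head a = w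

theorem inc_tail (a : G.E) : G.Inc a (G.tail a) := .inl rfl
theorem inc_head (a : G.E) : G.Inc a (G.head a) := .inr rfl

theorem IsQuarticEulerian.eq_or_eq_of_tail (hG : G.IsQuarticEulerian) {a b c : G.E} (hab : a ≠ b)
    (hb : G.tail b = G.tail a) (hc : G.tail c = G.tail a) : c = a ∨ c = b := by
  classical
  have h := (hG (G.tail a)).2
  rw [outDegree_eq] at h
  by_contra! hne
  have h3 : ({a, b, c} : Finset G.E).card = 3 := by
    rw [Finset.card_insert_of_notMem (by simp [hab, hne.1.symm]),
      Finset.card_pair hne.2.symm]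
  have := Finset.card_le_card (s := {a, b, c}) (t := Finset.univ.filter fun d => G.tail d = G.tail a)
    (by intro d hd; simp at hd; rcases hd with rfl | rfl | rfl <;> simp [hb, hc])
  omega

theorem IsQuarticEulerian.eq_or_eq_of_head (hG : G.IsQuarticEulerian) {a b c : G.E} (hab : a ≠ b)
    (hb : G.head b = G.head a) (hc : G.head c = G.head a) : c = a ∨ c = b := by
  classical
  have h := (hG (G.head a)).1
  rw [inDegree_eq] at h
  by_contra! hne
  have h3 : ({a, b, c} : Finset G.E).card = 3 := by
    rw [Finset.card_insert_of_notMem (by simp [hab, hne.1.symm]),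
      Finset.card_pair hne.2.symm]
  have := Finset.card_le_card (s := {a, b, c}) (t := Finset.univ.filter fun d => G.head d = G.head a)
    (by intro d hd; simp at hd; rcases hd with rfl | rfl | rfl <;> simp [hb, hc])
  omega

theorem IsAntiDigon.symm {e f : G.E} (h : G.IsAntiDigon e f) : G.IsAntiDigon f e :=
  ⟨h.1.symm, by rw [h.2.2.1, h.2.2.2]; exact h.2.1, h.2.2.1.symm, h.2.2.2.symm⟩

/-- In an alternating plane embedding, an anti-digon is a closed curve that separates the two arcs
that leave its head. -/
theorem IsDiplanar.exists_colouring (h : G.IsDiplanar) {e f : G.E} (hD : G.IsAntiDigon e f)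
    (hin : ∀ a, G.head a = G.head e → a = e ∨ a = f)
    (hout : ∀ c d b, G.tail c = G.head e → G.tail d = G.head e → G.tail b = G.head e →
      c ≠ d → b ≠ c → b = d) :
    ∃ κ : G.E → ZMod 2,
      (∀ a b w, w ≠ G.tail e → w ≠ G.head e → G.Inc a w → G.Inc b w → κ a = κ b) ∧
      ∀ c d, G.tail c = G.head e → G.tail d = G.head e → c ≠ d → κ c ≠ κ d := by
  classical
  obtain ⟨σ, h1, h2, h3⟩ := isDiplanar_iff.1 h
  obtain ⟨hef, hxy, hft, hfh⟩ := hD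
  -- The anti-digon is a cycle modulo two, hence the boundary of a face colouring; the other arcs
  -- have the same colour on both sides, and this is their value under `κ`.
  let z : G.E → ZMod 2 := fun a => if a = e ∨ a = f then 1 else 0
  have hz : G.IsCycleModTwo z := fun g => by
    rw [← Finset.sum_subset (Finset.subset_univ {e, f})]
    · rw [Finset.sum_pair hef, hft, hfh]
      simp [z, CharTwo.add_self_eq_zero]
    · intro a _ ha
      have : ¬ (a = e ∨ a = f) := by simpa using ha
      simp [z, this]
  obtain ⟨φ, hφ1, hφ2⟩ := h3 z hz
  have hz0 : ∀ a, a ≠ e → a ≠ f → φ (a, true) = φ (a, false) := fun a ha hb => by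
    have := hφ2 (a, true)
    simpa [z, ha, hb, CharTwo.add_eq_zero] using this
  refine ⟨fun a => φ (a, false), ?_, ?_⟩
  · intro a b w hwx hwy ha hb
    have hne : ∀ a, G.Inc a w → a ≠ e ∧ a ≠ f := by
      intro a ha
      constructor
      · rintro rfl; rcases ha with rfl | rfl <;> simp_all
      · rintro rfl; rcases ha with rfl | rfl <;> simp_all
    have hd : ∀ a, G.Inc a w → ∃ s, G.dartVertex (a, s) = w ∧ φ (a, s) = φ (a, false) := by
      intro a ha
      rcases ha with h | h
      · exact ⟨false, h, rfl⟩
      · exact ⟨true, h, hz0 a (hne a (.inr h)).1 (hne a (.inr h)).2⟩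
    obtain ⟨s, hs, hs'⟩ := hd a ha
    obtain ⟨t, ht, ht'⟩ := hd b hb
    -- No arc at `w` is crossed with a change of colour, so the colour is constant around `w`.
    have key := invariant_of_sameCycle (σ := σ)
      (ψ := fun d => if G.dartVertex d = w then φ d else 0) (fun d => by
        simp only [h1.dartVertex_apply]
        split_ifs with hdw
        · have hi : G.Inc d.1 w := by
            rcases d with ⟨a, _ | _⟩
            · exact .inl hdw
            · exact .inr hdw
          rw [hφ1]
          rcases d with ⟨a, _ | _⟩
          · exact hz0 a (hne a hi).1 (hne a hi).2
          · exact (hz0 a (hne a hi).1 (hne a hi).2).symm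
        · rfl) ((h1 (a, s) (b, t)).2 (hs.trans ht.symm))
    simp only [hs, ht, if_true] at key
    dsimp only
    rw [← hs', ← ht', key]
  · intro c d hc hd hcd
    have hce : ∀ c, G.tail c = G.head e → c ≠ e ∧ c ≠ f := by
      intro c hc
      constructor
      · rintro rfl; exact hxy hc
      · rintro rfl; exact hxy (hft.symm.trans hc)
    have hdv1 := h1.dartVertex_apply (c, false)
    have hal1 := h2 (c, false)
    have hφc := hφ1 (c, false)
    -- By alternation, the rotation at the head leads from the out-arc `c` to an arc `e'` of the
    -- anti-digon and on to an out-arc `c'`. Exactly one change of colour is passed on the way.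
    obtain ⟨⟨e', s⟩, hes⟩ : ∃ d', σ (c, false) = d' := ⟨_, rfl⟩
    rw [hes] at hdv1 hal1 hφc
    obtain rfl : s = true := by simpa using hal1
    rw [dartVertex_true, dartVertex_false, hc] at hdv1
    have he' := hin e' hdv1
    have hdv2 := h1.dartVertex_apply (e', true)
    have hal2 := h2 (e', true)
    have hφe := hφ1 (e', true)
    obtain ⟨⟨c', t⟩, hct⟩ : ∃ d', σ (e', true) = d' := ⟨_, rfl⟩
    rw [hct] at hdv2 hal2 hφe
    obtain rfl : t = false := by simpa using hal2
    rw [dartVertex_true, dartVertex_false, hdv1] at hdv2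
    -- Otherwise the orbit of `c` would consist of two darts and miss `d`.
    have hne : c' ≠ c := by
      rintro rfl
      have key := invariant_of_sameCycle (σ := σ)
        (ψ := fun d => (d = (c', false) ∨ d = (e', true) : Prop)) (fun d => by
          apply propext
          constructor
          · rintro (h | h)
            · exact .inr (σ.injective (h.trans hct.symm))
            · exact .inl (σ.injective (h.trans hes.symm))
          · rintro (rfl | rfl)
            · exact .inr hes
            · exact .inl hct) ((h1 (c', false) (d, false)).2 (hc.trans hd.symm))
      simp only [true_or, eq_iff_iff, true_iff] at key
      rcases key with h | h
      · exact hcd (by simpa using h.symm)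
      · simp at h
    obtain rfl := hout c d c' hc hd hdv2 hcd hne
    have hze : φ (e', false) = φ (e', true) + 1 := by
      have := hφ2 (e', true)
      have hze' : z e' = 1 := by simp [z, he']
      simp only [flip_mk, Bool.not_true, hze'] at this
      rw [← this, ← add_assoc, CharTwo.add_self_eq_zero, zero_add]
    simp only [flip_mk, Bool.not_true, Bool.not_false] at hφc hφe
    dsimp only
    rw [hφe, hze, hφc, hz0 c (hce c hc).1 (hce c hc).2]
    simp

/-- After the removal of some cycles of an obstruction that avoid an anti-digon, the anti-digon
separates the two arcs that leave its head. -/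
theorem IsDiplanarObstruction.exists_colouring (hG : G.IsDiplanarObstruction) {e f : G.E}
    (hD : G.IsAntiDigon e f) {Z : Finset G.E} (hZ : Balanced Z) (hne : Z.Nonempty)
    (hZt : ∀ a ∈ Z, ¬ G.Inc a (G.tail e)) (hZh : ∀ a ∈ Z, ¬ G.Inc a (G.head e)) :
    ∃ κ : G.E → ZMod 2,
      (∀ a b w, a ∉ Z → b ∉ Z → w ≠ G.tail e → w ≠ G.head e → G.Inc a w → G.Inc b w →
        κ a = κ b) ∧
      ∀ c d, G.tail c = G.head e → G.tail d = G.head e → c ≠ d → κ c ≠ κ d := by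
  classical
  have hd := hG.1.isSubquartic.isDiplanar_deleteArcs
    (fun H hH hs => hG.2.2 H ⟨hH, hG.1, hs⟩) hZ hne
  have he : e ∉ Z := fun h => hZt e h (inc_tail e)
  have hf : f ∉ Z := fun h => hZt f h (.inl hD.2.2.1)
  obtain ⟨κ, hκ1, hκ2⟩ := hd.exists_colouring (e := ⟨e, he⟩) (f := ⟨f, hf⟩)
    ⟨fun h => hD.1 (congrArg Subtype.val h), hD.2⟩
    (fun a ha => by
      rcases hG.1.eq_or_eq_of_head (c := a.1) hD.1 hD.2.2.2 ha with h | h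
      · exact .inl (Subtype.ext h)
      · exact .inr (Subtype.ext h))
    (fun c d b hc hd hb hcd hbc => by
      rcases hG.1.eq_or_eq_of_tail (a := c.1) (b := d.1) (c := b.1)
        (fun h => hcd (Subtype.ext h)) (hd.trans hc.symm) (hb.trans hc.symm) with h | h
      · exact absurd (Subtype.ext h) hbc
      · exact Subtype.ext h)
  let κ' : G.E → ZMod 2 := fun a => if h : a ∉ (Z : Set G.E) then κ ⟨a, h⟩ else 0
  have hκ' : ∀ a (h : a ∉ (Z : Set G.E)), κ' a = κ ⟨a, h⟩ := fun a h => dif_pos h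
  refine ⟨κ', ?_, ?_⟩
  · intro a b w ha hb hwt hwh haw hbw
    rw [hκ' a ha, hκ' b hb]
    exact hκ1 _ _ w hwt hwh haw hbw
  · intro c d hc hd hcd
    have hcZ : c ∉ (Z : Set G.E) := fun h => hZh c h (.inl hc)
    have hdZ : d ∉ (Z : Set G.E) := fun h => hZh d h (.inl hd)
    rw [hκ' c hcZ, hκ' d hdZ]
    exact hκ2 _ _ hc hd (fun h => hcd (congrArg Subtype.val h))

end FinDigraph

/-! ### Gluing two plane embeddings along an anti-digon. -/

namespace FinDigraph

variable {G : FinDigraph.{u}}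

theorem sameCycle_of_eqOn {X : Type u} [Finite X] {σ τ : Equiv.Perm X} {P : X → Prop}
    (hP : ∀ d, P d → P (τ d)) (h : ∀ d, P d → σ d = τ d) {d d' : X} (hd : P d)
    (hs : τ.SameCycle d d') : σ.SameCycle d d' := by
  obtain ⟨n, rfl⟩ := hs.exists_nat_pow_eq
  refine ⟨n, ?_⟩
  rw [zpow_natCast]
  have : ∀ k, P ((τ ^ k) d) ∧ (σ ^ k) d = (τ ^ k) d := by
    intro k
    induction k with
    | zero => exact ⟨hd, rfl⟩
    | succ k ih =>
      rw [pow_succ', pow_succ', Equiv.Perm.mul_apply, Equiv.Perm.mul_apply, ih.2]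
      exact ⟨hP _ ih.1, h _ ih.1⟩
  exact (this n).2

/-- The inclusion of the darts that are left after the removal of a set of arcs. -/
def deleteArcsDart (C : Set G.E) : (G.deleteArcs C).Dart ↪ G.Dart :=
  ⟨fun d => (d.1.1, d.2), fun d d' h => by
    rcases d with ⟨⟨a, ha⟩, s⟩; rcases d' with ⟨⟨a', ha'⟩, s'⟩
    simp only [Prod.mk.injEq] at h
    obtain ⟨rfl, rfl⟩ := h
    rfl⟩

theorem dartVertex_deleteArcsDart (C : Set G.E) (d : (G.deleteArcs C).Dart) :
    G.dartVertex (deleteArcsDart C d) = (G.deleteArcs C).dartVertex d := by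
  rcases d with ⟨a, _ | _⟩ <;> rfl

theorem exists_deleteArcsDart {C : Set G.E} {d : G.Dart} (hd : d.1 ∉ C) :
    ∃ d', deleteArcsDart C d' = d := ⟨(⟨d.1, hd⟩, d.2), rfl⟩

open Classical in
/-- The union of plane embeddings of two complementary sets of arcs. -/
theorem exists_union_rotation {S T : Set G.E} (hST : ∀ a, a ∈ S ↔ a ∉ T)
    (hS : (G.deleteArcs S).IsDiplanar) (hT : (G.deleteArcs T).IsDiplanar) :
    ∃ σ : Equiv.Perm G.Dart, (∀ d, G.dartVertex (σ d) = G.dartVertex d) ∧ G.IsAlternating σ ∧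
      (∀ d, (σ d).1 ∈ S ↔ d.1 ∈ S) ∧
      (∀ d d', (d.1 ∈ S ↔ d'.1 ∈ S) → G.dartVertex d = G.dartVertex d' → σ.SameCycle d d') ∧
      ∀ z, G.IsCycleModTwo (fun a => if a ∈ S then z a else 0) →
        G.IsCycleModTwo (fun a => if a ∈ S then 0 else z a) → ∃ φ, G.IsFaceColouring σ z φ := by
  obtain ⟨σ₁, r1, a1, c1⟩ := isDiplanar_iff.1 hS
  obtain ⟨σ₂, r2, a2, c2⟩ := isDiplanar_iff.1 hT
  set ι₁ := deleteArcsDart S with hι₁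
  set ι₂ := deleteArcsDart T with hι₂
  have hm1 : ∀ d, (ι₁ d).1 ∉ S := fun d => d.1.2
  have hm2 : ∀ d, (ι₂ d).1 ∈ S := fun d => (hST _).2 d.1.2
  -- The two extended permutations move disjoint sets of darts, so their product acts as `σ₁` off
  -- `S` and as `σ₂` on `S`. A vertex with arcs of both kinds still has two orbits.
  have hs1 : ∀ d, (σ₁.viaEmbedding ι₁ * σ₂.viaEmbedding ι₂) (ι₁ d) = ι₁ (σ₁ d) := fun d => by
    rw [Equiv.Perm.mul_apply, Equiv.Perm.viaEmbedding_apply_of_notMem σ₂ ι₂,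
      Equiv.Perm.viaEmbedding_apply]
    rintro ⟨d', h⟩
    exact hm1 d (h ▸ hm2 d')
  have hs2 : ∀ d, (σ₁.viaEmbedding ι₁ * σ₂.viaEmbedding ι₂) (ι₂ d) = ι₂ (σ₂ d) := fun d => by
    rw [Equiv.Perm.mul_apply, Equiv.Perm.viaEmbedding_apply,
      Equiv.Perm.viaEmbedding_apply_of_notMem]
    rintro ⟨d', h⟩
    exact hm1 d' (h ▸ hm2 _)
  generalize σ₁.viaEmbedding ι₁ * σ₂.viaEmbedding ι₂ = σ at hs1 hs2
  have hcase : ∀ d : G.Dart, (∃ d', ι₁ d' = d) ∨ ∃ d', ι₂ d' = d := fun d => by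
    by_cases h : d.1 ∈ S
    · exact .inr (exists_deleteArcsDart ((hST _).1 h))
    · exact .inl (exists_deleteArcsDart h)
  refine ⟨σ, ?_, ?_, ?_, ?_, ?_⟩
  · intro d
    rcases hcase d with ⟨d, rfl⟩ | ⟨d, rfl⟩
    · rw [hs1, dartVertex_deleteArcsDart, dartVertex_deleteArcsDart, r1.dartVertex_apply]
    · rw [hs2, dartVertex_deleteArcsDart, dartVertex_deleteArcsDart, r2.dartVertex_apply]
  · intro d
    rcases hcase d with ⟨d, rfl⟩ | ⟨d, rfl⟩
    · rw [hs1]; exact a1 d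
    · rw [hs2]; exact a2 d
  · intro d
    rcases hcase d with ⟨d, rfl⟩ | ⟨d, rfl⟩
    · rw [hs1]; exact iff_of_false (hm1 _) (hm1 _)
    · rw [hs2]; exact iff_of_true (hm2 _) (hm2 _)
  · intro d d' hdd' hdv
    rcases hcase d with ⟨d, rfl⟩ | ⟨d, rfl⟩ <;> rcases hcase d' with ⟨d', rfl⟩ | ⟨d', rfl⟩
    · rw [dartVertex_deleteArcsDart, dartVertex_deleteArcsDart] at hdv
      exact sameCycle_map hs1 ((r1 _ _).2 hdv)
    · exact absurd (hdd'.2 (hm2 d')) (hm1 d)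
    · exact absurd (hdd'.1 (hm2 d)) (hm1 d')
    · rw [dartVertex_deleteArcsDart, dartVertex_deleteArcsDart] at hdv
      exact sameCycle_map hs2 ((r2 _ _).2 hdv)
  · intro z hz1 hz2
    obtain ⟨φ₁, p1, q1⟩ := c1 (fun a => z a.1) (fun g => by
      refine Eq.trans ?_ ((sum_deleteArcs S (fun a => (if a ∈ S then 0 else z a) *
        (g (G.tail a) + g (G.head a))) (fun a ha => by simp [ha])).trans (hz2 g))
      exact Finset.sum_congr rfl fun a _ =>
        congrArg (· * (g (G.tail a.1) + g (G.head a.1))) (if_neg a.2).symm)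
    obtain ⟨φ₂, p2, q2⟩ := c2 (fun a => z a.1) (fun g => by
      refine Eq.trans ?_ ((sum_deleteArcs T (fun a => (if a ∈ S then z a else 0) *
        (g (G.tail a) + g (G.head a)))
        (fun a ha => by rw [if_neg (fun h => (hST a).1 h ha), zero_mul])).trans (hz1 g))
      exact Finset.sum_congr rfl fun a _ =>
        congrArg (· * (g (G.tail a.1) + g (G.head a.1))) (if_pos ((hST a.1).2 a.2)).symm)
    let φ : G.Dart → ZMod 2 := fun d => if h : d.1 ∈ S then φ₂ (⟨d.1, (hST _).1 h⟩, d.2)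
      else φ₁ (⟨d.1, h⟩, d.2)
    have hφ1 : ∀ d, φ (ι₁ d) = φ₁ d := fun d => dif_neg (hm1 d)
    have hφ2 : ∀ d, φ (ι₂ d) = φ₂ d := fun d => dif_pos (hm2 d)
    have hf1 : ∀ d, G.flip (ι₁ d) = ι₁ ((G.deleteArcs S).flip d) := fun _ => rfl
    have hf2 : ∀ d, G.flip (ι₂ d) = ι₂ ((G.deleteArcs T).flip d) := fun _ => rfl
    refine ⟨φ, fun d => ?_, fun d => ?_⟩
    · rcases hcase d with ⟨d, rfl⟩ | ⟨d, rfl⟩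
      · rw [hs1, hf1, hφ1, hφ1, p1]
      · rw [hs2, hf2, hφ2, hφ2, p2]
    · rcases hcase d with ⟨d, rfl⟩ | ⟨d, rfl⟩
      · rw [hf1, hφ1, hφ1, q1]; rfl
      · rw [hf2, hφ2, hφ2, q2]; rfl

/-- `S` is a union of components of the digraph that is left when the vertices `x` and `y` are
taken apart. -/
def IsClosedOff (G : FinDigraph.{u}) (x y : G.V) (S : Set G.E) : Prop :=
  ∀ a b w, w ≠ x → w ≠ y → G.Inc a w → G.Inc b w → a ∈ S → b ∈ S

theorem IsClosedOff.compl {x y : G.V} {S : Set G.E} (h : G.IsClosedOff x y S) :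
    G.IsClosedOff x y Sᶜ :=
  fun a b w hx hy ha hb haS hbS => haS (h b a w hx hy hb ha hbS)

section Separated

variable {e f : G.E} {S : Set G.E}

-- Off the ends of the anti-digon a vertex has all or none of its arcs in `S`, so only the two ends
-- matter. At the tail, `e` is the only out-arc in `S`, and its value is chosen to satisfy the
-- condition there; the condition at the head follows because every arc is counted at both of its
-- ends.
open Classical in
theorem IsClosedOff.isCycleModTwo (hG : G.IsQuarticEulerian) (hD : G.IsAntiDigon e f)
    (hS : G.IsClosedOff (G.tail e) (G.head e) S) (he : e ∈ S) (hf : f ∉ S) {z : G.E → ZMod 2}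
    (hz : G.IsCycleModTwo z) {z' : G.E → ZMod 2}
    (hz' : ∀ a ∈ S, a ≠ e → z' a = z a)
    (hze : z' e = ∑ a, if a ∈ S ∧ G.head a = G.tail e then z a else 0) :
    G.IsCycleModTwo (fun a => if a ∈ S then z' a else 0) := by
  obtain ⟨hef, hxy, hft, hfh⟩ := hD
  have key : ∀ g : G.V → ZMod 2, g (G.head e) = 0 →
      ∑ a, (if a ∈ S then z' a else 0) * (g (G.tail a) + g (G.head a)) = 0 := by
    intro g hg
    -- The test function is cut down to the inner vertices of `S`, where the cycle condition of `z`
    -- itself applies.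
    let g' : G.V → ZMod 2 := fun w =>
      if w ≠ G.tail e ∧ w ≠ G.head e ∧ ∃ a ∈ S, G.Inc a w then g w else 0
    have hg'x : g' (G.tail e) = 0 := if_neg (by simp)
    have hg'y : g' (G.head e) = 0 := if_neg (by simp)
    have hterm : ∀ a, (if a ∈ S then z' a else 0) * (g (G.tail a) + g (G.head a)) =
        z a * (g' (G.tail a) + g' (G.head a)) +
          (if a ∈ S ∧ G.head a = G.tail e then z a else 0) * g (G.tail e) +
          (if a = e then z' e * g (G.tail e) else 0) := by
      intro a
      by_cases hae : a = e
      · subst hae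
        simp [he, hg'x, hg'y, hg, Ne.symm hxy]
      by_cases haf : a = f
      · subst haf
        simp [hf, hft, hfh, hg'x, hg'y, Ne.symm hef]
      have htx : G.tail a ≠ G.tail e := fun h => by
        rcases hG.eq_or_eq_of_tail hef hft h with h | h <;> contradiction
      have hhy : G.head a ≠ G.head e := fun h => by
        rcases hG.eq_or_eq_of_head hef hfh h with h | h <;> contradiction
      by_cases haS : a ∈ S
      · have h1 : g' (G.tail a) = g (G.tail a) := by
          by_cases h : G.tail a = G.head e
          · rw [h, hg, hg'y]
          · exact if_pos ⟨htx, h, a, haS, inc_tail a⟩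
        by_cases h : G.head a = G.tail e
        · simp only [haS, h, hae, if_true, if_false, h1, hg'x, hz' a haS hae, and_self]
          ring
        · have h2 : g' (G.head a) = g (G.head a) := if_pos ⟨h, hhy, a, haS, inc_head a⟩
          simp [haS, h, hae, h1, h2, hz' a haS hae]
      · have h0 : ∀ w, G.Inc a w → g' w = 0 := by
          intro w haw
          apply if_neg
          rintro ⟨h1, h2, b, hb, hbw⟩
          exact haS (hS b a w h1 h2 hbw haw hb)
        simp [haS, hae, h0 _ (inc_tail a), h0 _ (inc_head a)]
    rw [Finset.sum_congr rfl fun a _ => hterm a, Finset.sum_add_distrib, Finset.sum_add_distrib,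
      hz g', ← Finset.sum_mul, ← hze]
    simp [CharTwo.add_self_eq_zero]
  -- Adding a constant to `g` changes no summand, so `g` may be assumed to vanish at the head of
  -- `e`.
  intro g
  refine Eq.trans ?_ (key (fun w => g w + g (G.head e)) (CharTwo.add_self_eq_zero _))
  refine Finset.sum_congr rfl fun a _ => ?_
  congr 1
  have : g (G.head e) + g (G.head e) = 0 := CharTwo.add_self_eq_zero _
  linear_combination -this

-- Inner vertices have all or none of their arcs in `S`. At the head of the anti-digon, `e` is the
-- only in-arc and `c` the only out-arc in `S`; balance at the tail then follows from balance
-- everywhere else.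
open Classical in
theorem IsClosedOff.balanced (hG : G.IsQuarticEulerian) (hD : G.IsAntiDigon e f)
    (hS : G.IsClosedOff (G.tail e) (G.head e) S) (he : e ∈ S) (hf : f ∉ S)
    {c d : G.E} (hc : G.tail c = G.head e) (hd : G.tail d = G.head e) (hcS : c ∈ S) (hdS : d ∉ S) :
    Balanced (Finset.univ.filter fun a => a ∈ S) := by
  obtain ⟨hef, hxy, hft, hfh⟩ := hD
  have hcd : c ≠ d := by rintro rfl; exact hdS hcS
  have key : ∀ g : G.V → ℤ, g (G.tail e) = 0 →
      ∑ a, (if a ∈ S then (g (G.head a) - g (G.tail a)) else 0) = 0 := by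
    intro g hg
    let g' : G.V → ℤ := fun w =>
      if w ≠ G.tail e ∧ w ≠ G.head e ∧ ∃ a ∈ S, G.Inc a w then g w else 0
    have hg'x : g' (G.tail e) = 0 := if_neg (by simp)
    have hg'y : g' (G.head e) = 0 := if_neg (by simp)
    have hterm : ∀ a, (if a ∈ S then (g (G.head a) - g (G.tail a)) else 0) =
        (g' (G.head a) - g' (G.tail a)) + (if a = e then g (G.head e) else 0) -
          (if a = c then g (G.head e) else 0) := by
      intro a
      by_cases hae : a = e
      · subst hae
        have : a ≠ c := by rintro rfl; exact hxy hc
        simp [he, hg'x, hg'y, hg, this]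
      by_cases haf : a = f
      · subst haf
        have : a ≠ c := by rintro rfl; exact hf hcS
        simp [hf, hft, hfh, hg'x, hg'y, Ne.symm hef, this]
      have htx : G.tail a ≠ G.tail e := fun h => by
        rcases hG.eq_or_eq_of_tail hef hft h with h | h <;> contradiction
      have hhy : G.head a ≠ G.head e := fun h => by
        rcases hG.eq_or_eq_of_head hef hfh h with h | h <;> contradiction
      by_cases haS : a ∈ S
      · have h2 : g' (G.head a) = g (G.head a) := by
          by_cases h : G.head a = G.tail e
          · rw [h, hg, hg'x]
          · exact if_pos ⟨h, hhy, a, haS, inc_head a⟩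
        by_cases h : G.tail a = G.head e
        · have : a = c := by
            rcases hG.eq_or_eq_of_tail hcd (hd.trans hc.symm) (h.trans hc.symm) with h | h
            · exact h
            · exact absurd (h ▸ haS) hdS
          simp only [haS, h, hae, if_true, if_false, h2, hg'y, if_pos this]
          ring
        · have h1 : g' (G.tail a) = g (G.tail a) := if_pos ⟨htx, h, a, haS, inc_tail a⟩
          have : a ≠ c := by rintro rfl; exact h hc
          simp [haS, hae, h1, h2, this]
      · have h0 : ∀ w, G.Inc a w → g' w = 0 := by
          intro w haw
          apply if_neg
          rintro ⟨h1, h2, b, hb, hbw⟩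
          exact haS (hS b a w h1 h2 hbw haw hb)
        have : a ≠ c := by rintro rfl; exact haS hcS
        simp [haS, hae, h0 _ (inc_tail a), h0 _ (inc_head a), this]
    rw [Finset.sum_congr rfl fun a _ => hterm a, Finset.sum_sub_distrib, Finset.sum_add_distrib,
      hG.isSubquartic.balanced_univ g']
    simp
  intro g
  rw [Finset.sum_filter]
  refine Eq.trans ?_ (key (fun w => g w - g (G.tail e)) (sub_self _))
  refine Finset.sum_congr rfl fun a _ => ?_
  congr 1
  ring

open Classical in
/-- Two plane embeddings can be glued together along an anti-digon. -/
theorem IsClosedOff.isDiplanar (hG : G.IsQuarticEulerian) (hD : G.IsAntiDigon e f)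
    (hS : G.IsClosedOff (G.tail e) (G.head e) S) (he : e ∈ S) (hf : f ∉ S)
    (h1 : (G.deleteArcs S).IsDiplanar) (h2 : (G.deleteArcs Sᶜ).IsDiplanar) : G.IsDiplanar := by
  obtain ⟨σ, hdv, halt, hmem, hsc, hφ⟩ := exists_union_rotation (fun a => by simp) h1 h2
  have hS' : G.IsClosedOff (G.tail f) (G.head f) Sᶜ := by
    rw [hD.2.2.1, hD.2.2.2]; exact hS.compl
  have hD' := hD.symm
  have houtx : ∀ a, G.tail a = G.tail e → a = e ∨ a = f :=
    fun a ha => hG.eq_or_eq_of_tail hD.1 hD.2.2.1 ha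
  have hiny : ∀ a, G.head a = G.head e → a = e ∨ a = f :=
    fun a ha => hG.eq_or_eq_of_head hD.1 hD.2.2.2 ha
  obtain ⟨hef, hxy, hft, hfh⟩ := id hD
  -- In the union of the two rotations each end of the anti-digon has two orbits, one with a dart of
  -- `e` and one with a dart of `f`. Exchanging these darts before or after `σ` merges the two
  -- orbits and preserves alternation.
  set px : Equiv.Perm G.Dart := Equiv.swap (e, false) (f, false) with hpx
  set py : Equiv.Perm G.Dart := Equiv.swap (e, true) (f, true) with hpy
  have hpxdv : ∀ d, G.dartVertex (px d) = G.dartVertex d := fun d => by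
    rw [hpx, Equiv.swap_apply_def]; split_ifs with h h <;> simp [*]
  have hpydv : ∀ d, G.dartVertex (py d) = G.dartVertex d := fun d => by
    rw [hpy, Equiv.swap_apply_def]; split_ifs with h h <;> simp [*]
  have hpx2 : ∀ d, (px d).2 = d.2 := fun d => by
    rw [hpx, Equiv.swap_apply_def]; split_ifs with h h <;> simp [*]
  have hpy2 : ∀ d, (py d).2 = d.2 := fun d => by
    rw [hpy, Equiv.swap_apply_def]; split_ifs with h h <;> simp [*]
  have hpxne : ∀ d, (G.dartVertex d ≠ G.tail e ∨ d.2 = true) → px d = d := fun d h => by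
    rw [hpx, Equiv.swap_apply_of_ne_of_ne]
    · rintro rfl; simp at h
    · rintro rfl; simp [hft] at h
  have hpyne : ∀ d, (G.dartVertex d ≠ G.head e ∨ d.2 = false) → py d = d := fun d h => by
    rw [hpy, Equiv.swap_apply_of_ne_of_ne]
    · rintro rfl; simp at h
    · rintro rfl; simp [hfh] at h
  have hrdv : ∀ d, G.dartVertex ((py * σ * px) d) = G.dartVertex d := fun d => by
    rw [Equiv.Perm.mul_apply, Equiv.Perm.mul_apply, hpydv, hdv, hpxdv]
  have hralt : G.IsAlternating (py * σ * px) := fun d => by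
    rw [Equiv.Perm.mul_apply, Equiv.Perm.mul_apply, hpy2, ← hpx2 d]
    exact halt _
  have hboth : ∀ w, w ≠ G.tail e → w ≠ G.head e → ∀ d d', G.dartVertex d = w →
      G.dartVertex d' = w → (d.1 ∈ S ↔ d'.1 ∈ S) := by
    have hinc : ∀ (d : G.Dart) w, G.dartVertex d = w → G.Inc d.1 w := by
      rintro ⟨a, _ | _⟩ w h
      · exact .inl h
      · exact .inr h
    intro w hx hy d d' hd hd'
    exact ⟨hS _ _ w hx hy (hinc _ _ hd) (hinc _ _ hd'),
      hS _ _ w hx hy (hinc _ _ hd') (hinc _ _ hd)⟩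
  refine isDiplanar_iff.2 ⟨py * σ * px, isRotationSystem_of hrdv ?_, hralt, ?_⟩
  · have hx : (py * σ * px).SameCycle (e, false) (f, false) := by
      refine ⟨2, ?_⟩
      rw [zpow_ofNat, pow_two, Equiv.Perm.mul_apply]
      obtain ⟨b, hb⟩ : ∃ b, σ (f, false) = b := ⟨_, rfl⟩
      have hbdv := hdv (f, false)
      have hb2 := halt (f, false)
      have hbS := hmem (f, false)
      rw [hb] at hbdv hb2 hbS
      have hb2' : b.2 = true := by simpa using hb2
      rw [dartVertex_false, hft] at hbdv
      have hstep : (py * σ * px) (e, false) = b := by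
        rw [Equiv.Perm.mul_apply, Equiv.Perm.mul_apply, hpx, Equiv.swap_apply_left, hb]
        exact hpyne b (.inl (by rw [hbdv]; exact hxy))
      rw [hstep]
      have hcdv := hrdv b
      have hc2 := hralt b
      have hcS := hmem b
      have : (py * σ * px) b = σ b := by
        rw [Equiv.Perm.mul_apply, Equiv.Perm.mul_apply, hpxne b (.inr hb2')]
        exact hpyne _ (.inl (by rw [hdv, hbdv]; exact hxy))
      rw [this] at hcdv hc2 ⊢
      have hnS : (σ b).1 ∉ S := fun h => hf (hbS.1 (hcS.1 h))
      have hc2' : (σ b).2 = false := by rw [hb2'] at hc2; simpa using hc2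
      generalize σ b = c at *
      rcases c with ⟨c, s⟩
      obtain rfl : s = false := hc2'
      rw [hbdv] at hcdv
      rcases houtx c hcdv with rfl | rfl
      · exact absurd he hnS
      · rfl
    have hy : (py * σ * px).SameCycle (e, true) (f, true) := by
      refine ⟨2, ?_⟩
      rw [zpow_ofNat, pow_two, Equiv.Perm.mul_apply]
      obtain ⟨b, hb⟩ : ∃ b, σ (e, true) = b := ⟨_, rfl⟩
      have hbdv := hdv (e, true)
      have hb2 := halt (e, true)
      have hbS := hmem (e, true)
      rw [hb] at hbdv hb2 hbS
      have hb2' : b.2 = false := by simpa using hb2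
      rw [dartVertex_true] at hbdv
      have hstep : (py * σ * px) (e, true) = b := by
        rw [Equiv.Perm.mul_apply, Equiv.Perm.mul_apply, hpxne (e, true) (.inr rfl), hb]
        exact hpyne b (.inr hb2')
      rw [hstep]
      have hcdv := hdv b
      have hc2 := halt b
      have hcS := hmem b
      have : (py * σ * px) b = py (σ b) := by
        rw [Equiv.Perm.mul_apply, Equiv.Perm.mul_apply,
          hpxne b (.inl (by rw [hbdv]; exact hxy.symm))]
      rw [this]
      have hinS : (σ b).1 ∈ S := hcS.2 (hbS.2 he)
      have hc2' : (σ b).2 = true := by rw [hb2'] at hc2; simpa using hc2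
      generalize σ b = c at *
      rcases c with ⟨c, s⟩
      obtain rfl : s = true := hc2'
      rw [hbdv] at hcdv
      rcases hiny c hcdv with rfl | rfl
      · rw [hpy, Equiv.swap_apply_left]
      · exact absurd hinS hf
    have hxall : ∀ d, G.dartVertex d = G.tail e → (py * σ * px).SameCycle (e, false) d := by
      have hout : ∀ d, G.dartVertex d = G.tail e → d.2 = false →
          (py * σ * px).SameCycle (e, false) d := by
        rintro ⟨a, s⟩ hd rfl
        rcases houtx a hd with rfl | rfl
        · exact .refl _ _
        · exact hx
      intro d hd
      by_cases hd2 : d.2 = false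
      · exact hout d hd hd2
      · have h2 := hralt d
        have : d.2 = true := by simpa using hd2
        rw [this] at h2
        exact Equiv.Perm.sameCycle_apply_right.1 (hout _ ((hrdv d).trans hd) (by simpa using h2))
    have hyall : ∀ d, G.dartVertex d = G.head e → (py * σ * px).SameCycle (e, true) d := by
      have hin : ∀ d, G.dartVertex d = G.head e → d.2 = true →
          (py * σ * px).SameCycle (e, true) d := by
        rintro ⟨a, s⟩ hd rfl
        rcases hiny a hd with rfl | rfl
        · exact .refl _ _
        · exact hy
      intro d hd
      by_cases hd2 : d.2 = true
      · exact hin d hd hd2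
      · have h2 := hralt d
        have : d.2 = false := by simpa using hd2
        rw [this] at h2
        exact Equiv.Perm.sameCycle_apply_right.1 (hin _ ((hrdv d).trans hd) (by simpa using h2))
    intro d d' hdd'
    by_cases hwx : G.dartVertex d = G.tail e
    · exact (hxall d hwx).symm.trans (hxall d' (hdd'.symm.trans hwx))
    by_cases hwy : G.dartVertex d = G.head e
    · exact (hyall d hwy).symm.trans (hyall d' (hdd'.symm.trans hwy))
    refine sameCycle_of_eqOn (τ := σ) (P := fun d'' => G.dartVertex d'' = G.dartVertex d)
      (fun d'' h => (hdv d'').trans h) (fun d'' h => ?_) rfl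
      (hsc d d' (hboth _ hwx hwy d d' rfl hdd'.symm) hdd')
    rw [Equiv.Perm.mul_apply, Equiv.Perm.mul_apply, hpxne d'' (.inl (by rw [h]; exact hwx)),
      hpyne _ (.inl (by rw [hdv, h]; exact hwy))]
  · intro z hz
    -- These values on `e` and `f` make the restrictions of `z` to both sides cycles.
    let t1 : ZMod 2 := ∑ a, if a ∈ S ∧ G.head a = G.tail e then z a else 0
    let t2 : ZMod 2 := ∑ a, if a ∈ Sᶜ ∧ G.head a = G.tail f then z a else 0
    let z' : G.E → ZMod 2 := fun a => if a = e then t1 else if a = f then t2 else z a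
    have hz'e : z' e = t1 := if_pos rfl
    have hz'f : z' f = t2 := by simp only [z', if_neg hef.symm, if_true]
    have hz' : ∀ a, a ≠ e → a ≠ f → z' a = z a := fun a h h' => by
      simp only [z', if_neg h, if_neg h']
    have hc1 := hS.isCycleModTwo hG hD he hf hz (z' := z')
      (fun a ha hae => hz' a hae (by rintro rfl; exact hf ha)) hz'e
    have hc2 := hS'.isCycleModTwo hG hD' hf (by simpa using he) hz (z' := z')
      (fun a ha haf => hz' a (by rintro rfl; exact ha he) haf)
      (hz'f.trans (Finset.sum_congr rfl fun a _ => by congr))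
    have hc2' : G.IsCycleModTwo (fun a => if a ∈ S then 0 else z' a) := by
      convert! hc2 using 2 with a
      by_cases h : a ∈ S <;> simp [h]
    obtain ⟨ψ, hψ1, hψ2⟩ := hφ z' hc1 hc2'
    -- The cycle condition of `z` at the tail of the anti-digon.
    have ht : t1 + t2 = z e + z f := by
      have h1 : t1 + t2 = ∑ a, if G.head a = G.tail e then z a else 0 := by
        rw [← Finset.sum_add_distrib]
        refine Finset.sum_congr rfl fun a _ => ?_
        by_cases ha : a ∈ S <;> simp [ha, hft]
      have h2 := hz (Pi.single (G.tail e) 1)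
      have h3 : ∀ a, z a * ((Pi.single (G.tail e) 1 : G.V → ZMod 2) (G.tail a) +
          (Pi.single (G.tail e) 1 : G.V → ZMod 2) (G.head a)) =
          (if a = e then z e else 0) + (if a = f then z f else 0) +
            if G.head a = G.tail e then z a else 0 := by
        intro a
        have h4 : (Pi.single (G.tail e) 1 : G.V → ZMod 2) (G.tail a) =
            (if a = e then 1 else 0) + (if a = f then 1 else 0) := by
          by_cases hae : a = e
          · subst hae; simp [hef]
          by_cases haf : a = f
          · subst haf; simp [hft, hae]
          have : G.tail a ≠ G.tail e := fun h => by
            rcases houtx a h with h | h <;> contradiction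
          simp [this, hae, haf]
        have h5 : (Pi.single (G.tail e) 1 : G.V → ZMod 2) (G.head a) =
            if G.head a = G.tail e then 1 else 0 := by
          simp [Pi.single_apply]
        rw [h4, h5]
        have h6 : (if a = e then z e else 0) = z a * (if a = e then 1 else 0) := by
          by_cases h : a = e <;> simp [h]
        have h7 : (if a = f then z f else 0) = z a * (if a = f then 1 else 0) := by
          by_cases h : a = f <;> simp [h]
        have h8 : (if G.head a = G.tail e then z a else 0) =
            z a * (if G.head a = G.tail e then 1 else 0) := by
          by_cases h : G.head a = G.tail e <;> simp [h]
        rw [h6, h7, h8]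
        ring
      rw [Finset.sum_congr rfl fun a _ => h3 a, Finset.sum_add_distrib, Finset.sum_add_distrib,
        ← h1] at h2
      simp only [Finset.sum_ite_eq', Finset.mem_univ, if_true] at h2
      exact (CharTwo.add_eq_zero.1 h2).symm
    -- normalise `ψ` so that it agrees at the heads of `e` and `f`
    let k : ZMod 2 := z e + t1
    let l : ZMod 2 := ψ (e, true) + ψ (f, true)
    let χ : G.Dart → ZMod 2 := fun d => ψ d + if d.1 ∈ S then l + k else 0
    have hχ1 : ∀ d, χ (σ d) = χ (G.flip d) := fun d => by
      simp only [χ, hψ1]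
      by_cases h : d.1 ∈ S
      · rw [if_pos ((hmem d).2 h), if_pos (show (G.flip d).1 ∈ S from h)]
      · rw [if_neg (fun h' => h ((hmem d).1 h')), if_neg (show (G.flip d).1 ∉ S from h)]
    -- This compatibility of the two exchanges is why the face condition survives the gluing.
    have hflip : ∀ d, G.flip (px d) = py (G.flip d) := by
      intro d
      by_cases hd1 : d = (e, false)
      · subst hd1; simp [hpx, hpy]
      by_cases hd2 : d = (f, false)
      · subst hd2; simp [hpx, hpy]
      rw [hpx, hpy, Equiv.swap_apply_of_ne_of_ne hd1 hd2, Equiv.swap_apply_of_ne_of_ne]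
      · intro h; apply hd1; rw [← G.flip_flip d, h]; rfl
      · intro h; apply hd2; rw [← G.flip_flip d, h]; rfl
    have hchar : ∀ t : ZMod 2, t + t = 0 := CharTwo.add_self_eq_zero
    have hE : χ (e, false) + χ (f, true) = z e := by
      have := hψ2 (e, false)
      simp only [flip_mk, Bool.not_false, hz'e] at this
      simp only [χ, he, hf, if_true, if_false, l, k]
      linear_combination this + hchar (ψ (f, true)) + hchar t1
    have hF : χ (f, false) + χ (e, true) = z f := by
      have := hψ2 (f, false)
      simp only [flip_mk, Bool.not_false, hz'f] at this
      simp only [χ, he, hf, if_true, if_false, l, k]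
      linear_combination this + hchar (ψ (e, true)) + ht + hchar (z e)
    -- The head darts of `e` and `f` trade colours, so `hE` and `hF` are the boundary conditions on
    -- these two arcs.
    refine ⟨χ ∘ py, fun d => ?_, fun d => ?_⟩
    · rw [Function.comp, Function.comp, Equiv.Perm.mul_apply, Equiv.Perm.mul_apply, ← hflip, ← hχ1]
      congr 1
      rw [hpy, Equiv.swap_apply_self]
    · rcases d with ⟨a, s⟩
      by_cases hae : a = e
      · subst hae
        have h1 : py (a, true) = (f, true) := Equiv.swap_apply_left _ _
        have h2 : py (a, false) = (a, false) := hpyne _ (.inr rfl)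
        cases s
        · simpa [h1, h2] using hE
        · simpa [h1, h2, add_comm] using hE
      by_cases haf : a = f
      · subst haf
        have h1 : py (a, true) = (e, true) := Equiv.swap_apply_right _ _
        have h2 : py (a, false) = (a, false) := hpyne _ (.inr rfl)
        cases s
        · simpa [h1, h2] using hF
        · simpa [h1, h2, add_comm] using hF
      have h1 : ∀ s, py (a, s) = (a, s) := fun s => by
        rw [hpy, Equiv.swap_apply_of_ne_of_ne] <;> simp [hae, haf]
      have := hψ2 (a, s)
      rw [hz' a hae haf] at this
      simp only [Function.comp, flip_mk, h1, χ] at this ⊢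
      linear_combination this + hchar (if a ∈ S then l + k else 0)

end Separated

/-- In an obstruction, an anti-digon does not separate the arcs that leave its head. -/
theorem IsDiplanarObstruction.mem_of_isClosedOff (hG : G.IsDiplanarObstruction) {e f : G.E}
    (hD : G.IsAntiDigon e f) {S : Set G.E} (hS : G.IsClosedOff (G.tail e) (G.head e) S)
    {c d : G.E} (hc : G.tail c = G.head e) (hd : G.tail d = G.head e) (hcS : c ∈ S) : d ∈ S := by
  classical
  by_contra hdS
  obtain ⟨hef, hxy, hft, hfh⟩ := id hD
  -- The set `S` is adjusted to contain `e` but not `f`; these arcs have no ends other than the two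
  -- exempted vertices, so the set stays closed off. Both `T` and its complement are then balanced
  -- and non-empty, so minimality makes both parts diplanar.
  let T : Set G.E := {a | a ≠ f ∧ (a = e ∨ a ∈ S)}
  have hne : ∀ a w, w ≠ G.tail e → w ≠ G.head e → G.Inc a w → a ≠ e ∧ a ≠ f := by
    intro a w hx hy haw
    constructor
    · rintro rfl; rcases haw with rfl | rfl <;> simp_all
    · rintro rfl; rcases haw with rfl | rfl <;> simp_all
  have hT : G.IsClosedOff (G.tail e) (G.head e) T := by
    intro a b w hx hy ha hb haT
    exact ⟨(hne b w hx hy hb).2, .inr (hS a b w hx hy ha hb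
      (haT.2.resolve_left (hne a w hx hy ha).1))⟩
  have hnout : ∀ c, G.tail c = G.head e → c ≠ e ∧ c ≠ f := by
    intro c hc
    constructor
    · rintro rfl; exact hxy hc
    · rintro rfl; exact hxy (hft.symm.trans hc)
  have heT : e ∈ T := ⟨hef, .inl rfl⟩
  have hfT : f ∉ T := fun h => h.1 rfl
  have hcT : c ∈ T := ⟨(hnout c hc).2, .inr hcS⟩
  have hdT : d ∉ T := fun h => h.2.elim (hnout d hd).1 hdS
  have hb := hT.balanced hG.1 hD heT hfT hc hd hcT hdT
  have hdel : ∀ (R : Set G.E) (Z : Finset G.E), (Z : Set G.E) = R → Balanced Z → Z.Nonempty →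
      (G.deleteArcs R).IsDiplanar := fun R Z h hb hn => h ▸
    hG.1.isSubquartic.isDiplanar_deleteArcs (fun H hH hs => hG.2.2 H ⟨hH, hG.1, hs⟩) hb hn
  refine hG.2.1 (hT.isDiplanar hG.1 hD heT hfT ?_ ?_)
  · exact hdel _ _ (by ext; simp) hb ⟨e, by simpa using heT⟩
  · exact hdel _ _ (by ext; simp)
      (hG.1.isSubquartic.balanced_univ.sdiff hb (Finset.subset_univ _)) ⟨f, by simpa using hfT⟩

end FinDigraph

namespace FinDigraph

variable {G : FinDigraph.{u}}

/-! ### Decompositions into directed cycles -/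

/-- A decomposition of the arc set into directed cycles: `m a` is the cycle that contains `a`. -/
structure IsDecomp (m : G.E → Finset G.E) : Prop where
  mem_self : ∀ a, a ∈ m a
  eq_of_mem : ∀ {a b}, b ∈ m a → m b = m a
  exists_cyc : ∀ a, ∃ n c, G.IsCyc n c ∧ Set.range c = m a

theorem Balanced.exists_decomp {Z : Finset G.E} (hZ : Balanced Z) :
    ∃ m : G.E → Finset G.E, ∀ a ∈ Z, a ∈ m a ∧ m a ⊆ Z ∧ (∀ b ∈ m a, m b = m a) ∧
      ∃ n c, G.IsCyc n c ∧ Set.range c = m a := by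
  classical
  induction hn : Z.card using Nat.strong_induction_on generalizing Z with
  | _ k ih =>
  subst hn
  rcases Z.eq_empty_or_nonempty with rfl | hne
  · exact ⟨fun _ => ∅, by simp⟩
  obtain ⟨C, n, c, hCZ, hc, hcC⟩ := hZ.exists_cyc hne
  have hc0 : c 0 ∈ C := by rw [← Finset.mem_coe, ← hcC]; exact ⟨0, rfl⟩
  obtain ⟨m, hm⟩ := ih _ (Finset.card_lt_card (Finset.sdiff_ssubset hCZ ⟨_, hc0⟩))
    (hZ.sdiff (hc.balanced hcC) hCZ) rfl
  refine ⟨fun a => if a ∈ C then C else m a, fun a ha => ?_⟩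
  by_cases haC : a ∈ C
  · simp only [haC, if_true]
    exact ⟨trivial, hCZ, fun b hb => by simp [hb], n, c, hc, hcC⟩
  · obtain ⟨h1, h2, h3, h4⟩ := hm a (Finset.mem_sdiff.2 ⟨ha, haC⟩)
    simp only [haC, if_false]
    refine ⟨h1, h2.trans Finset.sdiff_subset, fun b hb => ?_, h4⟩
    rw [if_neg (Finset.mem_sdiff.1 (h2 hb)).2, h3 b hb]

/-- Any prescribed directed cycle can be a member, because its complement is balanced. -/
theorem IsSubquartic.exists_decomp (hG : G.IsSubquartic) {C : Finset G.E} {n : ℕ} {c : ℕ → G.E}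
    (hc : G.IsCyc n c) (hcC : Set.range c = C) :
    ∃ m : G.E → Finset G.E, IsDecomp m ∧ ∀ a ∈ C, m a = C := by
  classical
  obtain ⟨m, hm⟩ := (hG.balanced_univ.sdiff (hc.balanced hcC) (Finset.subset_univ C)).exists_decomp
  have hm' : ∀ a, a ∉ C → _ := fun a ha => hm a (Finset.mem_sdiff.2 ⟨Finset.mem_univ a, ha⟩)
  refine ⟨fun a => if a ∈ C then C else m a, ⟨fun a => ?_, fun {a b} hb => ?_, fun a => ?_⟩,
    fun a ha => by simp [ha]⟩
  · by_cases ha : a ∈ C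
    · simp [ha]
    · simp only [ha, if_false]; exact (hm' a ha).1
  · by_cases ha : a ∈ C
    · simp only [ha, if_true] at hb ⊢
      simp [hb]
    · simp only [ha, if_false] at hb ⊢
      rw [if_neg (Finset.mem_sdiff.1 ((hm' a ha).2.1 hb)).2, (hm' a ha).2.2.1 b hb]
  · by_cases ha : a ∈ C
    · simp only [ha, if_true]; exact ⟨n, c, hc, hcC⟩
    · simp only [ha, if_false]; exact (hm' a ha).2.2.2

namespace IsDecomp

variable {m : G.E → Finset G.E}

theorem mem_iff (hm : IsDecomp m) {a b : G.E} : b ∈ m a ↔ m b = m a :=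
  ⟨hm.eq_of_mem, fun h => h ▸ hm.mem_self b⟩

/-- The cycle of `a`, starting with `a`. -/
theorem exists_cyc_at (hm : IsDecomp m) (a : G.E) :
    ∃ n c, G.IsCyc n c ∧ Set.range c = m a ∧ c 0 = a := by
  obtain ⟨n, c, hc, hca⟩ := hm.exists_cyc a
  have ha : a ∈ Set.range c := by rw [hca]; exact hm.mem_self a
  obtain ⟨k, hk⟩ := ha
  exact ⟨n, _, hc.shift k, (hc.range_shift k).trans hca, by simpa using hk⟩

theorem exists_next (hm : IsDecomp m) (a : G.E) : ∃ b, m b = m a ∧ G.tail b = G.head a := by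
  obtain ⟨n, c, hc, hca, h0⟩ := hm.exists_cyc_at a
  refine ⟨c 1, hm.mem_iff.1 ?_, ?_⟩
  · rw [← Finset.mem_coe, ← hca]; exact ⟨1, rfl⟩
  · rw [← h0, hc.next]

theorem exists_prev (hm : IsDecomp m) (a : G.E) : ∃ b, m b = m a ∧ G.head b = G.tail a := by
  obtain ⟨n, c, hc, hca, h0⟩ := hm.exists_cyc_at a
  refine ⟨c (n - 1), hm.mem_iff.1 ?_, ?_⟩
  · rw [← Finset.mem_coe, ← hca]; exact ⟨_, rfl⟩
  · have := hc.pos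
    rw [hc.next, Nat.sub_add_cancel this, ← h0]
    have := hc.period 0
    rw [zero_add] at this
    rw [this]

theorem tail_inj (hm : IsDecomp m) {a b : G.E} (h : m a = m b) (ht : G.tail a = G.tail b) :
    a = b := by
  obtain ⟨n, c, hc, hca⟩ := hm.exists_cyc a
  have ha : a ∈ Set.range c := by rw [hca]; exact hm.mem_self a
  have hb : b ∈ Set.range c := by rw [hca]; exact hm.mem_iff.2 h.symm
  obtain ⟨i, rfl⟩ := ha
  obtain ⟨j, rfl⟩ := hb
  exact hc.eq_of_tail ht

theorem head_inj (hm : IsDecomp m) {a b : G.E} (h : m a = m b) (ht : G.head a = G.head b) :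
    a = b := by
  obtain ⟨n, c, hc, hca⟩ := hm.exists_cyc a
  have ha : a ∈ Set.range c := by rw [hca]; exact hm.mem_self a
  have hb : b ∈ Set.range c := by rw [hca]; exact hm.mem_iff.2 h.symm
  obtain ⟨i, rfl⟩ := ha
  obtain ⟨j, rfl⟩ := hb
  rw [hc.next, hc.next] at ht
  have h1 : i + 1 ≡ j + 1 [MOD n] := hc.mod_eq_of_tail ht
  have h2 : i % n = j % n := Nat.ModEq.add_right_cancel' 1 h1
  rw [← hc.apply_mod i, ← hc.apply_mod j, h2]

theorem balanced (hm : IsDecomp m) (a : G.E) : Balanced (m a) := by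
  obtain ⟨n, c, hc, hca⟩ := hm.exists_cyc a
  exact hc.balanced hca

/-- A cycle through a vertex contains an arc that leaves it. -/
theorem exists_tail_of_inc (hm : IsDecomp m) {a : G.E} {w : G.V} (h : G.Inc a w) :
    ∃ b, m b = m a ∧ G.tail b = w := by
  rcases h with rfl | rfl
  · exact ⟨a, rfl, rfl⟩
  · exact hm.exists_next a

/-- A set that is closed under taking the next arc contains the whole cycle. -/
theorem closed_eq (hm : IsDecomp m) {a : G.E} (P : G.E → Prop) (ha : P a)
    (hP : ∀ b b', m b = m a → m b' = m a → P b → G.tail b' = G.head b → P b') {b : G.E}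
    (hb : m b = m a) : P b := by
  obtain ⟨n, c, hc, hca, h0⟩ := hm.exists_cyc_at a
  have hcm : ∀ i, m (c i) = m a := fun i => hm.mem_iff.1 (by
    rw [← Finset.mem_coe, ← hca]; exact ⟨i, rfl⟩)
  have key : ∀ i, P (c i) := by
    intro i
    induction i with
    | zero => rw [h0]; exact ha
    | succ i ih => exact hP _ _ (hcm i) (hcm (i + 1)) ih (hc.next i).symm
  have hb' : b ∈ Set.range c := by rw [hca]; exact hm.mem_iff.2 hb
  obtain ⟨i, rfl⟩ := hb'
  exact key i

end IsDecomp

/-! ### Colourings along cycles, and the chain of cycles. -/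

/-- `κ` is constant on the components of the digraph that is left when the arcs of `Z` are removed
and the vertices `x` and `y` are taken apart. -/
def IsColouringOff (G : FinDigraph.{u}) (x y : G.V) (Z : Finset G.E) (κ : G.E → ZMod 2) : Prop :=
  ∀ a b w, a ∉ Z → b ∉ Z → w ≠ x → w ≠ y → G.Inc a w → G.Inc b w → κ a = κ b

/-- A colour is carried along a walk as long as its inner vertices avoid `x` and `y` and its arcs
avoid `Z`. -/
theorem IsColouringOff.trail {x y : G.V} {Z : Finset G.E} {κ : G.E → ZMod 2}
    (hκ : G.IsColouringOff x y Z κ) {c : ℕ → G.E} {i j : ℕ} (hij : i ≤ j)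
    (hZ : ∀ k, i ≤ k → k ≤ j → c k ∉ Z) (hnext : ∀ k, G.head (c k) = G.tail (c (k + 1)))
    (hx : ∀ k, i < k → k ≤ j → G.tail (c k) ≠ x ∧ G.tail (c k) ≠ y) : κ (c i) = κ (c j) := by
  induction j, hij using Nat.le_induction with
  | base => rfl
  | succ j hij ih =>
    rw [ih (fun k h1 h2 => hZ k h1 (by omega)) (fun k h1 h2 => hx k h1 (by omega))]
    exact hκ _ _ (G.tail (c (j + 1))) (hZ j hij (by omega)) (hZ _ (by omega) le_rfl)
      (hx _ (by omega) le_rfl).1 (hx _ (by omega) le_rfl).2 (.inr (hnext j)) (inc_tail _)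

section Chain

variable {e f : G.E} {m : G.E → Finset G.E}

/-- The only arcs out of the tail and into the head are `e` and `f`, so a cycle through either end
must use one of them. -/
theorem IsDecomp.eq_of_inc_antiDigon (hG : G.IsQuarticEulerian) (hD : G.IsAntiDigon e f)
    (hm : IsDecomp m) {a : G.E} (ha : G.Inc a (G.tail e) ∨ G.Inc a (G.head e)) :
    m a = m e ∨ m a = m f := by
  have hout : ∀ b, G.tail b = G.tail e → b = e ∨ b = f :=
    fun b hb => hG.eq_or_eq_of_tail hD.1 hD.2.2.1 hb
  have hin : ∀ b, G.head b = G.head e → b = e ∨ b = f :=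
    fun b hb => hG.eq_or_eq_of_head hD.1 hD.2.2.2 hb
  have : ∃ b, m b = m a ∧ (b = e ∨ b = f) := by
    rcases ha with (h | h) | (h | h)
    · exact ⟨a, rfl, hout a h⟩
    · obtain ⟨b, hb, hb'⟩ := hm.exists_next a
      exact ⟨b, hb, hout b (hb'.trans h)⟩
    · obtain ⟨b, hb, hb'⟩ := hm.exists_prev a
      exact ⟨b, hb, hin b (hb'.trans h)⟩
    · exact ⟨a, rfl, hin a h⟩
  obtain ⟨b, hb, rfl | rfl⟩ := this
  · exact .inl hb.symm
  · exact .inr hb.symm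

theorem IsDecomp.antiDigon_ne (hD : G.IsAntiDigon e f) (hm : IsDecomp m) : m e ≠ m f :=
  fun h => hD.1 (hm.tail_inj h hD.2.2.1.symm)

/-- The cycle of `e`, starting after `e`: it passes through the ends of `e` only at its start. -/
theorem IsDecomp.exists_cyc_after (hxy : G.tail e ≠ G.head e) (hm : IsDecomp m) :
    ∃ n c, G.IsCyc n c ∧ Set.range c = m e ∧ G.tail (c 0) = G.head e ∧ 2 ≤ n ∧ c (n - 1) = e ∧
      ∀ k, 0 < k → k < n - 1 → G.tail (c k) ≠ G.tail e ∧ G.tail (c k) ≠ G.head e := by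
  obtain ⟨n, c, hc, hce, h0⟩ := hm.exists_cyc_at e
  have hn : 2 ≤ n := by
    by_contra h
    have h1 : n = 1 := by have := hc.pos; omega
    subst h1
    have h2 := hc.next 0
    rw [hc.period 0, h0] at h2
    exact hxy h2.symm
  have hper := hc.period 0
  rw [zero_add, h0] at hper
  have hc1 := hc.shift 1
  have hlast : c (n - 1 + 1) = e := by rw [Nat.sub_add_cancel (by omega), hper]
  refine ⟨n, _, hc1, (hc.range_shift 1).trans hce, ?_, hn, hlast, ?_⟩
  · rw [← hc.next, h0]
  · intro k hk hkn
    constructor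
    · intro h
      have := hc1.inj k (by omega) (n - 1) (by omega) (by rw [hlast]; exact h)
      omega
    · intro h
      have := hc1.inj k (by omega) 0 (by omega) (h.trans (by rw [← hc.next 0, h0]))
      omega

/-- Without its anti-digon arc, the cycle of `e` or `f` is a path whose inner vertices avoid both
ends; all other cycles avoid the ends altogether. -/
theorem IsColouringOff.eq_of_mem (hG : G.IsQuarticEulerian) (hD : G.IsAntiDigon e f)
    (hm : IsDecomp m) {Z : Finset G.E} {κ : G.E → ZMod 2}
    (hκ : G.IsColouringOff (G.tail e) (G.head e) Z κ) {a b : G.E} (hab : m a = m b)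
    (hZ : ∀ c ∈ m a, c ∉ Z) (hae : a ≠ e) (haf : a ≠ f) (hbe : b ≠ e) (hbf : b ≠ f) :
    κ a = κ b := by
  have hcyc : ∀ n c, G.IsCyc n c → Set.range c = m a → ∀ N, N ≤ n →
      (∀ k, 0 < k → k < N → G.tail (c k) ≠ G.tail e ∧ G.tail (c k) ≠ G.head e) →
      ∀ i < N, ∀ j < N, κ (c i) = κ (c j) := by
    intro n c hc hca N hN hx
    have hle : ∀ i j, i ≤ j → j < N → κ (c i) = κ (c j) := fun i j hij hj =>
      hκ.trail hij (fun k _ _ => hZ _ (by rw [← Finset.mem_coe, ← hca]; exact ⟨k, rfl⟩)) hc.next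
        (fun k h1 h2 => hx k (by omega) (by omega))
    intro i hi j hj
    rcases le_total i j with h | h
    · exact hle i j h hj
    · exact (hle j i h hi).symm
  by_cases hcase : m a = m e ∨ m a = m f
  · have hx : ∀ g, m a = m g → a ≠ g → b ≠ g → G.tail g = G.tail e → G.head g = G.head e →
        κ a = κ b := by
      intro g hag hag' hbg hgt hgh
      have hxy : G.tail g ≠ G.head g := by rw [hgt, hgh]; exact hD.2.1
      obtain ⟨n, c, hc, hca, -, hn, hlast, hk⟩ := hm.exists_cyc_after hxy
      rw [hgt, hgh] at hk
      have hidx : ∀ d, m d = m a → d ≠ g → ∃ i < n - 1, c i = d := by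
        intro d hd hdg
        have : d ∈ Set.range c := by rw [hca]; exact hm.mem_iff.2 (hd.trans hag)
        obtain ⟨i, hi, rfl⟩ := hc.mem_range_iff.1 this
        have : i ≠ n - 1 := by rintro rfl; exact hdg hlast
        exact ⟨i, by omega, rfl⟩
      obtain ⟨i, hi, rfl⟩ := hidx a rfl hag'
      obtain ⟨j, hj, rfl⟩ := hidx b hab.symm hbg
      exact hcyc n c hc (hca.trans (by rw [hag])) (n - 1) (by omega) hk i hi j hj
    rcases hcase with h | h
    · exact hx e h hae hbe rfl rfl
    · exact hx f h haf hbf hD.2.2.1 hD.2.2.2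
  · obtain ⟨n, c, hc, hca⟩ := hm.exists_cyc a
    have hidx : ∀ d, m d = m a → ∃ i < n, c i = d := by
      intro d hd
      exact hc.mem_range_iff.1 (by rw [hca]; exact hm.mem_iff.2 hd)
    have hcm : ∀ i, m (c i) = m a := fun i => hm.mem_iff.1 (by
      rw [← Finset.mem_coe, ← hca]; exact ⟨i, rfl⟩)
    obtain ⟨i, hi, hi'⟩ := hidx a rfl
    obtain ⟨j, hj, hj'⟩ := hidx b hab.symm
    rw [← hi', ← hj']
    refine hcyc n c hc hca n le_rfl (fun k _ _ => ⟨fun h => ?_, fun h => ?_⟩) i hi j hj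
    · exact hcase (hcm k ▸ hm.eq_of_inc_antiDigon hG hD (.inl (.inl h)))
    · exact hcase (hcm k ▸ hm.eq_of_inc_antiDigon hG hD (.inr (.inl h)))

/-- The cycles of the decomposition form a sequence from the cycle of `e` to the cycle of `f`, and
outside the anti-digon, only consecutive cycles have common vertices. -/
structure IsCycleChain (m : G.E → Finset G.E) (e f : G.E) (n : ℕ) (M : ℕ → Finset G.E) :
    Prop where
  two_le : 2 ≤ n
  zero : M 0 = m e
  last : M n = m f
  exists_arc : ∀ i ≤ n, ∃ a, m a = M i
  exists_index : ∀ a, ∃ i ≤ n, m a = M i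
  inj : ∀ i ≤ n, ∀ j ≤ n, M i = M j → i = j
  link : ∀ i < n, ∃ a b, m a = M i ∧ m b = M (i + 1) ∧ G.tail a = G.tail b ∧
    G.tail a ≠ G.tail e ∧ G.tail a ≠ G.head e
  near : ∀ a b i j, i ≤ n → j ≤ n → m a = M i → m b = M j → G.tail a = G.tail b →
    G.tail a ≠ G.tail e → G.tail a ≠ G.head e → i = j ∨ j = i + 1 ∨ i = j + 1

/-- A colouring is constant along a sequence of linked cycles. -/
theorem IsColouringOff.eq_of_links (hG : G.IsQuarticEulerian) (hD : G.IsAntiDigon e f)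
    (hm : IsDecomp m) {Z : Finset G.E} {κ : G.E → ZMod 2}
    (hκ : G.IsColouringOff (G.tail e) (G.head e) Z κ) {M : ℕ → Finset G.E} {i j : ℕ} (hij : i ≤ j)
    (hlink : ∀ k, i ≤ k → k < j → ∃ a b, m a = M k ∧ m b = M (k + 1) ∧ G.tail a = G.tail b ∧
      G.tail a ≠ G.tail e ∧ G.tail a ≠ G.head e)
    (hZ : ∀ a k, i ≤ k → k ≤ j → m a = M k → a ∉ Z)
    {a b : G.E} (ha : m a = M i) (hb : m b = M j) (hae : a ≠ e) (haf : a ≠ f) (hbe : b ≠ e)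
    (hbf : b ≠ f) : κ a = κ b := by
  have hZ' : ∀ a k, i ≤ k → k ≤ j → m a = M k → ∀ c ∈ m a, c ∉ Z := fun a k h1 h2 h c hc =>
    hZ c k h1 h2 ((hm.eq_of_mem hc).trans h)
  induction j, hij using Nat.le_induction generalizing b with
  | base => exact hκ.eq_of_mem hG hD hm (ha.trans hb.symm) (hZ' a i le_rfl le_rfl ha) hae haf hbe hbf
  | succ j hij ih =>
    obtain ⟨c, d, hc, hd, hcd, hx, hy⟩ := hlink j hij (by omega)
    have hne : ∀ c, G.tail c ≠ G.tail e → c ≠ e ∧ c ≠ f := fun c hc =>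
      ⟨by rintro rfl; exact hc rfl, by rintro rfl; exact hc hD.2.2.1⟩
    rw [ih (fun k h1 h2 => hlink k h1 (by omega)) (fun a k h1 h2 => hZ a k h1 (by omega)) hc
      (hne c hx).1 (hne c hx).2 (fun a k h1 h2 => hZ' a k h1 (by omega)),
      hκ c d _ (hZ c j hij (by omega) hc) (hZ d (j + 1) (by omega) le_rfl hd) hx hy (inc_tail c)
        (.inl hcd.symm)]
    rw [hcd] at hx
    exact hκ.eq_of_mem hG hD hm (hd.trans hb.symm) (hZ' d (j + 1) (by omega) le_rfl hd)
      (hne d hx).1 (hne d hx).2 hbe hbf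

/-- In the graph `Γ` of links between cycles, `mem_of_isClosedOff` connects the cycle of `e` to that
of `f`. A cycle off a shortest path could be removed without breaking the path, which would then
carry one colour to both arcs that leave the head, against `exists_colouring`. So the shortest path
contains all cycles, and minimal length excludes further links. -/
theorem IsDiplanarObstruction.exists_isCycleChain (hG : G.IsDiplanarObstruction)
    (hD : G.IsAntiDigon e f) (hm : IsDecomp m) {a₀ : G.E} (ha₀ : m a₀ ≠ m e) (ha₀' : m a₀ ≠ m f) :
    ∃ n M, IsCycleChain m e f n M := by
  classical
  obtain ⟨hef, hxy, hft, hfh⟩ := id hD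
  let Γ : SimpleGraph (Finset G.E) :=
    { Adj := fun M M' => M ≠ M' ∧ ∃ a b, m a = M ∧ m b = M' ∧ G.tail a = G.tail b ∧
        G.tail a ≠ G.tail e ∧ G.tail a ≠ G.head e
      symm := ⟨fun M M' ⟨h, a, b, ha, hb, hab, h1, h2⟩ =>
        ⟨h.symm, b, a, hb, ha, hab.symm, hab ▸ h1, hab ▸ h2⟩⟩
      loopless := ⟨fun M h => h.1 rfl⟩ }
  obtain ⟨c, hce, hct⟩ := hm.exists_next e
  obtain ⟨d, hdf, hdt⟩ := hm.exists_next f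
  rw [hfh] at hdt
  have hcd : c ≠ d := by
    rintro rfl
    exact hm.antiDigon_ne hD (hce.symm.trans hdf)
  have hnout : ∀ c, G.tail c = G.head e → c ≠ e ∧ c ≠ f := by
    intro c hc
    constructor
    · rintro rfl; exact hxy hc
    · rintro rfl; exact hxy (hft.symm.trans hc)
  have hreach : Γ.Reachable (m e) (m f) := by
    -- The arcs of the cycles that can be reached from that of `e` are closed off by the definition
    -- of `Γ`.
    have hS : G.IsClosedOff (G.tail e) (G.head e) {a | Γ.Reachable (m e) (m a)} := by
      intro a b w hx hy ha hb haS
      obtain ⟨a', ha', rfl⟩ := hm.exists_tail_of_inc ha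
      obtain ⟨b', hb', hb''⟩ := hm.exists_tail_of_inc hb
      by_cases hab : m a = m b
      · change Γ.Reachable _ _
        rw [← hab]; exact haS
      · exact SimpleGraph.Reachable.trans haS
          (SimpleGraph.Adj.reachable (G := Γ) ⟨hab, a', b', ha', hb', hb''.symm, hx, hy⟩)
    have := hG.mem_of_isClosedOff hD hS hct hdt
      (show Γ.Reachable (m e) (m c) by rw [hce])
    change Γ.Reachable (m e) (m d) at this
    rwa [hdf] at this
  obtain ⟨p, hp⟩ := hreach.exists_walk_length_eq_dist
  set n := p.length with hn
  have h0 : p.getVert 0 = m e := p.getVert_zero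
  have hl : p.getVert n = m f := p.getVert_length
  have hadj : ∀ i < n, Γ.Adj (p.getVert i) (p.getVert (i + 1)) := fun i hi => p.adj_getVert_succ hi
  have harc : ∀ i ≤ n, ∃ a, m a = p.getVert i := by
    intro i hi
    rcases i with _ | i
    · exact ⟨e, h0.symm⟩
    · obtain ⟨-, a, b, -, hb, -⟩ := hadj i (by omega)
      exact ⟨b, hb⟩
  -- On a shortest walk the position is the distance from the start; this gives injectivity and,
  -- with the triangle inequality, the condition on adjacent positions.
  have hdist : ∀ i ≤ n, Γ.dist (m e) (p.getVert i) = i := by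
    intro i hi
    have h1 : Γ.dist (m e) (p.getVert i) ≤ i :=
      (SimpleGraph.dist_le (p.take i)).trans (by simp [SimpleGraph.Walk.take_length])
    have h2 : Γ.dist (p.getVert i) (m f) ≤ n - i :=
      (SimpleGraph.dist_le (p.drop i)).trans (by simp [SimpleGraph.Walk.drop_length, hn])
    have h3 : Γ.dist (m e) (m f) ≤ Γ.dist (m e) (p.getVert i) + Γ.dist (p.getVert i) (m f) :=
      SimpleGraph.Reachable.dist_triangle_left (p.take i).reachable _
    omega
  have hinj : ∀ i ≤ n, ∀ j ≤ n, p.getVert i = p.getVert j → i = j := fun i hi j hj h => by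
    rw [← hdist i hi, ← hdist j hj, h]
  have hall : ∀ a, ∃ i ≤ n, m a = p.getVert i := by
    intro a
    by_contra! hna
    have hmae : m a ≠ m e := by rw [← h0]; exact hna 0 (by omega)
    have hmaf : m a ≠ m f := by rw [← hl]; exact hna n le_rfl
    have hav : ∀ b ∈ m a, ¬ (G.Inc b (G.tail e) ∨ G.Inc b (G.head e)) := by
      intro b hb h
      have := hm.eq_of_inc_antiDigon hG.1 hD h
      rw [hm.eq_of_mem hb] at this
      exact this.elim hmae hmaf
    obtain ⟨κ, hκ, hκ'⟩ := hG.exists_colouring hD (hm.balanced a) ⟨a, hm.mem_self a⟩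
      (fun b hb h => hav b hb (.inl h)) (fun b hb h => hav b hb (.inr h))
    refine hκ' c d hct hdt hcd ?_
    exact IsColouringOff.eq_of_links hG.1 hD hm hκ (M := p.getVert) (Nat.zero_le n)
      (fun k _ hk => (hadj k hk).2)
      (fun b k _ hk hb hba => hna k hk ((hm.eq_of_mem hba).symm.trans hb))
      (hce.trans h0.symm) (hdf.trans hl.symm) (hnout c hct).1 (hnout c hct).2 (hnout d hdt).1
      (hnout d hdt).2
  refine ⟨n, p.getVert, ?_, h0, hl, harc, hall, hinj, fun i hi => (hadj i hi).2, ?_⟩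
  -- The cycle of `a₀` is neither the first nor the last one, so there are at least three.
  · obtain ⟨i, hi, hia⟩ := hall a₀
    have h1 : i ≠ 0 := by rintro rfl; exact ha₀ (hia.trans h0)
    have h2 : i ≠ n := by rintro rfl; exact ha₀' (hia.trans hl)
    omega
  · intro a b i j hi hj ha hb hab hx hy
    by_cases hij : p.getVert i = p.getVert j
    · exact .inl (hinj i hi j hj hij)
    · have hadj' : Γ.Adj (p.getVert i) (p.getVert j) := ⟨hij, a, b, ha, hb, hab, hx, hy⟩
      have h1 : Γ.dist (p.getVert i) (p.getVert j) = 1 := SimpleGraph.dist_eq_one_iff_adj.2 hadj'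
      have h2 := SimpleGraph.Reachable.dist_triangle_left (G := Γ) (p.take i).reachable
        (p.getVert j)
      have h3 := SimpleGraph.Reachable.dist_triangle_left (G := Γ) (p.take j).reachable
        (p.getVert i)
      rw [SimpleGraph.dist_comm (G := Γ) (u := p.getVert j)] at h3
      rw [hdist i hi, hdist j hj] at h2 h3
      have hne : i ≠ j := by rintro rfl; exact hij rfl
      omega

end Chain

end FinDigraph

namespace FinDigraph

variable {G : FinDigraph.{u}}

/-! ### Two consecutive cycles -/

open Classical in
/-- The arcs `c i, …, c (j - 1)`. -/
noncomputable def segment (c : ℕ → G.E) (i j : ℕ) : Finset G.E := (Finset.Ico i j).image c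

theorem mem_segment {c : ℕ → G.E} {i j : ℕ} {a : G.E} :
    a ∈ segment c i j ↔ ∃ k, i ≤ k ∧ k < j ∧ c k = a := by
  simp [segment, and_assoc]

theorem IsCyc.arc_inj {n : ℕ} {c : ℕ → G.E} (h : G.IsCyc n c) {i j : ℕ} (hi : i < n) (hj : j < n)
    (hij : c i = c j) : i = j := h.inj i hi j hj (by rw [hij])

theorem IsCyc.mem_segment_iff {n : ℕ} {c : ℕ → G.E} (h : G.IsCyc n c) {i j k : ℕ} (hj : j ≤ n)
    (hk : k < n) : c k ∈ segment c i j ↔ i ≤ k ∧ k < j := by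
  rw [mem_segment]
  constructor
  · rintro ⟨l, h1, h2, h3⟩
    have := h.arc_inj (by omega) hk h3
    subst this; exact ⟨h1, h2⟩
  · rintro ⟨h1, h2⟩; exact ⟨k, h1, h2, rfl⟩

theorem IsCyc.sum_segment {n : ℕ} {c : ℕ → G.E} (h : G.IsCyc n c) {i j : ℕ} (hij : i ≤ j)
    (hj : j ≤ n) (g : G.V → ℤ) :
    ∑ a ∈ segment c i j, (g (G.head a) - g (G.tail a)) = g (G.tail (c j)) - g (G.tail (c i)) := by
  classical
  rw [segment, Finset.sum_image]
  · rw [Finset.sum_congr rfl fun k _ => by rw [h.next k],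
      Finset.sum_Ico_eq_sum_range]
    have := Finset.sum_range_sub (fun k => g (G.tail (c (i + k)))) (j - i)
    simp only [add_zero, Nat.add_sub_cancel' hij] at this
    rw [← this]
    rfl
  · intro k hk l hl hkl
    simp only [Finset.coe_Ico, Set.mem_Ico] at hk hl
    exact h.arc_inj (by omega) (by omega) hkl

/-- Two disjoint directed cycles `c` and `c'` such that the removal of arcs of these cycles
separates the arcs in `L` from the arcs in `R`. -/
structure IsLinkedPair (x y : G.V) (p q : ℕ) (c c' : ℕ → G.E) (L R : G.E → Prop) : Prop where
  cyc : G.IsCyc p c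
  cyc' : G.IsCyc q c'
  disj : ∀ i j, c i ≠ c' j
  colouring : ∀ Z : Finset G.E, Balanced Z → Z.Nonempty →
    (∀ a ∈ Z, a ∈ Set.range c ∨ a ∈ Set.range c') → (∀ a ∈ Z, ¬ G.Inc a x ∧ ¬ G.Inc a y) →
    ∃ κ, G.IsColouringOff x y Z κ ∧ ∀ g h, g ∉ Z → h ∉ Z → L g → R h → κ g ≠ κ h
  base : L (c 0)
  base' : R (c' 0)
  base_ne : ∀ j, G.tail (c 0) ≠ G.tail (c' j)
  base_ne' : ∀ j, G.tail (c' 0) ≠ G.tail (c j)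
  ne_of_common : ∀ i j, G.tail (c i) = G.tail (c' j) → G.tail (c i) ≠ x ∧ G.tail (c i) ≠ y
  eq_last : ∀ k, 0 < k → k < p → G.tail (c k) = x ∨ G.tail (c k) = y → k = p - 1
  eq_last' : ∀ k, 0 < k → k < q → G.tail (c' k) = x ∨ G.tail (c' k) = y → k = q - 1
  mid : ∀ k, (∀ j, G.tail (c k) ≠ G.tail (c' j)) → G.tail (c k) ≠ x → G.tail (c k) ≠ y →
    L (c k) ∧ ∀ j, G.tail (c j) ≠ x ∧ G.tail (c j) ≠ y
  mid' : ∀ k, (∀ j, G.tail (c' k) ≠ G.tail (c j)) → G.tail (c' k) ≠ x → G.tail (c' k) ≠ y →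
    R (c' k) ∧ ∀ j, G.tail (c' j) ≠ x ∧ G.tail (c' j) ≠ y
  ends : (L (c (p - 1)) ∧ ∀ k, G.tail (c k) ≠ x ∧ G.tail (c k) ≠ y) ∨
    (R (c' (q - 1)) ∧ ∀ k, G.tail (c' k) ≠ x ∧ G.tail (c' k) ≠ y)

namespace IsLinkedPair

variable {x y : G.V} {p q : ℕ} {c c' : ℕ → G.E} {L R : G.E → Prop}

theorem symm (h : IsLinkedPair x y p q c c' L R) : IsLinkedPair x y q p c' c R L where
  cyc := h.cyc'
  cyc' := h.cyc
  disj i j := (h.disj j i).symm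
  colouring Z h1 h2 h3 h4 := by
    obtain ⟨κ, hκ, hκ'⟩ := h.colouring Z h1 h2 (fun a ha => (h3 a ha).symm) h4
    exact ⟨κ, hκ, fun g k hg hk hR hL => (hκ' k g hk hg hL hR).symm⟩
  base := h.base'
  base' := h.base
  base_ne := h.base_ne'
  base_ne' := h.base_ne
  ne_of_common i j hij := hij ▸ h.ne_of_common j i hij.symm
  eq_last := h.eq_last'
  eq_last' := h.eq_last
  mid := h.mid'
  mid' := h.mid
  ends := h.ends.symm

/-- Before a common vertex, the cycle avoids `x` and `y`. -/
theorem tail_ne (h : IsLinkedPair x y p q c c' L R) {i i' k : ℕ} (hi : i < p)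
    (hii' : G.tail (c i) = G.tail (c' i')) (hk : 0 < k) (hki : k ≤ i) :
    G.tail (c k) ≠ x ∧ G.tail (c k) ≠ y := by
  by_contra hne
  have hor : G.tail (c k) = x ∨ G.tail (c k) = y := by tauto
  have := h.eq_last k hk (by omega) hor
  obtain rfl : k = i := by omega
  have := h.ne_of_common _ _ hii'
  tauto

theorem pos_of_common (h : IsLinkedPair x y p q c c' L R) {i i' : ℕ}
    (hii' : G.tail (c i) = G.tail (c' i')) : 0 < i := by
  rcases i with _ | i
  · exact absurd hii' (h.base_ne i')
  · omega

theorem segment_avoids (h : IsLinkedPair x y p q c c' L R) {i i' j j' : ℕ} (hj : j < p)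
    (hii' : G.tail (c i) = G.tail (c' i')) (hjj' : G.tail (c j) = G.tail (c' j')) :
    ∀ a ∈ segment c i j, ¬ G.Inc a x ∧ ¬ G.Inc a y := by
  intro a ha
  obtain ⟨k, hik, hkj, rfl⟩ := mem_segment.1 ha
  have hi := h.pos_of_common hii'
  have h1 := h.tail_ne hj hjj' (k := k) (by omega) (by omega)
  have h2 := h.tail_ne hj hjj' (k := k + 1) (by omega) (by omega)
  rw [← h.cyc.next] at h2
  exact ⟨fun ha => ha.elim h1.1 h2.1, fun ha => ha.elim h1.2 h2.2⟩

/-- Common vertices occur in the same order on the two cycles. -/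
theorem order (h : IsLinkedPair x y p q c c' L R) {i j i' j' : ℕ} (hij : i < j) (hj : j < p)
    (hi' : i' < q) (hj' : j' < q) (hii' : G.tail (c i) = G.tail (c' i'))
    (hjj' : G.tail (c j) = G.tail (c' j')) : i' < j' := by
  classical
  by_contra hcon
  have hne : i' ≠ j' := by
    rintro rfl
    have := h.cyc.inj i (by omega) j hj (hii'.trans hjj'.symm)
    omega
  have hlt : j' < i' := by omega
  have h0 := h.pos_of_common hii'
  have h0' := h.symm.pos_of_common hjj'.symm
  -- If the order were reversed, these two segments would form a closed walk, hence a balanced set.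
  let Z : Finset G.E := segment c i j ∪ segment c' j' i'
  have hmem : ∀ k < p, c k ∈ Z ↔ i ≤ k ∧ k < j := fun k hk => by
    rw [Finset.mem_union, h.cyc.mem_segment_iff hj.le hk, or_iff_left]
    rw [mem_segment]
    rintro ⟨l, _, _, hl⟩
    exact h.disj k l hl.symm
  have hmem' : ∀ k < q, c' k ∈ Z ↔ j' ≤ k ∧ k < i' := fun k hk => by
    rw [Finset.mem_union, h.cyc'.mem_segment_iff hi'.le hk, or_iff_right]
    rw [mem_segment]
    rintro ⟨l, _, _, hl⟩
    exact h.disj l k hl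
  have hdisj : Disjoint (segment c i j) (segment c' j' i') := by
    rw [Finset.disjoint_left]
    intro a ha ha'
    obtain ⟨k, _, _, rfl⟩ := mem_segment.1 ha
    obtain ⟨l, _, _, hl⟩ := mem_segment.1 ha'
    exact h.disj k l hl.symm
  have hbal : Balanced Z := fun g => by
    rw [Finset.sum_union hdisj, h.cyc.sum_segment hij.le hj.le, h.cyc'.sum_segment hlt.le hi'.le,
      hii', hjj']
    ring
  obtain ⟨κ, hκ, hLR⟩ := h.colouring Z hbal ⟨c i, (hmem i (by omega)).2 ⟨le_rfl, hij⟩⟩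
    (fun a ha => by
      rcases Finset.mem_union.1 ha with ha | ha
      · obtain ⟨k, _, _, rfl⟩ := mem_segment.1 ha; exact .inl ⟨k, rfl⟩
      · obtain ⟨k, _, _, rfl⟩ := mem_segment.1 ha; exact .inr ⟨k, rfl⟩)
    (fun a ha => by
      rcases Finset.mem_union.1 ha with ha | ha
      · exact h.segment_avoids hj hii' hjj' a ha
      · exact h.symm.segment_avoids hi' hjj'.symm hii'.symm a ha)
  have hnot : ∀ k < p, (k < i ∨ j ≤ k) → c k ∉ Z := fun k hk h' => by
    rw [hmem k hk]; omega
  have hnot' : ∀ k < q, (k < j' ∨ i' ≤ k) → c' k ∉ Z := fun k hk h' => by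
    rw [hmem' k hk]; omega
  have hp := h.cyc.pos
  have hq := h.cyc'.pos
  -- The beginning of one cycle, up to its earlier common vertex, and the remainder of the cycle
  -- that avoids `x` and `y` survive the removal and join an arc of `R` to an arc of `L`.
  rcases h.ends with ⟨hL, hxy⟩ | ⟨hR, hxy⟩
  · refine hLR (c (p - 1)) (c' 0) (hnot _ (by omega) (by omega)) (hnot' _ hq (by omega)) hL
      h.base' ?_
    have h1 : κ (c' 0) = κ (c' (j' - 1)) := hκ.trail (by omega)
      (fun k _ hk => hnot' k (by omega) (by omega)) h.cyc'.next
      (fun k h1 h2 => h.symm.tail_ne hj' hjj'.symm h1 (by omega))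
    have h2 : κ (c j) = κ (c (p - 1)) := hκ.trail (by omega)
      (fun k h1 h2 => hnot k (by omega) (by omega)) h.cyc.next (fun k h1 h2 => hxy k)
    have h3 : κ (c' (j' - 1)) = κ (c j) := hκ _ _ (G.tail (c j)) (hnot' _ (by omega) (by omega))
      (hnot _ hj (by omega)) (hxy j).1 (hxy j).2
      (.inr (by rw [h.cyc'.next, Nat.sub_add_cancel h0', hjj'])) (inc_tail _)
    rw [h1, h3, h2]
  · refine hLR (c 0) (c' (q - 1)) (hnot _ hp (by omega)) (hnot' _ (by omega) (by omega)) h.base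
      hR ?_
    have h1 : κ (c 0) = κ (c (i - 1)) := hκ.trail (by omega)
      (fun k _ hk => hnot k (by omega) (by omega)) h.cyc.next
      (fun k h1 h2 => h.tail_ne (i := i) (by omega) hii' h1 (by omega))
    have h2 : κ (c' i') = κ (c' (q - 1)) := hκ.trail (by omega)
      (fun k h1 h2 => hnot' k (by omega) (by omega)) h.cyc'.next (fun k h1 h2 => hxy k)
    have h3 : κ (c (i - 1)) = κ (c' i') := hκ _ _ (G.tail (c' i')) (hnot _ (by omega) (by omega))
      (hnot' _ hi' (by omega)) (hxy i').1 (hxy i').2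
      (.inr (by rw [h.cyc.next, Nat.sub_add_cancel h0, hii'])) (inc_tail _)
    rw [h1, h3, h2]

/-- Between two common vertices there are only common vertices. -/
theorem common_of_between (h : IsLinkedPair x y p q c c' L R) {i j k i' j' : ℕ} (hik : i < k)
    (hkj : k < j) (hj : j < p) (hi' : i' < q) (hj' : j' < q)
    (hii' : G.tail (c i) = G.tail (c' i')) (hjj' : G.tail (c j) = G.tail (c' j')) :
    ∃ k', G.tail (c k) = G.tail (c' k') := by
  classical
  by_contra! hcon
  have hlt := h.order (hik.trans hkj) hj hi' hj' hii' hjj'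
  have h0 := h.pos_of_common hii'
  have h0' := h.symm.pos_of_common hii'.symm
  have hkxy := h.tail_ne hj hjj' (k := k) (by omega) (by omega)
  obtain ⟨hL, hxy⟩ := h.mid k hcon hkxy.1 hkxy.2
  -- The cycle `c` outside the segment from `i` to `j` and the parallel segment of `c'` form a
  -- closed walk. The segment of `c` that is kept contains the supposed vertex `k`.
  let A : Finset G.E := segment c 0 p \ segment c i j
  let Z : Finset G.E := A ∪ segment c' i' j'
  have hAC : ∀ a ∈ A, ∃ k, c k = a := fun a ha => by
    obtain ⟨k, _, _, rfl⟩ := mem_segment.1 (Finset.mem_sdiff.1 ha).1; exact ⟨k, rfl⟩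
  have hmem : ∀ k < p, c k ∈ Z → k < i ∨ j ≤ k := fun k hk hkZ => by
    rcases Finset.mem_union.1 hkZ with h1 | h1
    · have := (Finset.mem_sdiff.1 h1).2
      rw [h.cyc.mem_segment_iff hj.le hk] at this
      omega
    · obtain ⟨l, _, _, hl⟩ := mem_segment.1 h1
      exact absurd hl.symm (h.disj k l)
  have hmem' : ∀ k < q, c' k ∈ Z ↔ i' ≤ k ∧ k < j' := fun k hk => by
    rw [Finset.mem_union, h.cyc'.mem_segment_iff hj'.le hk, or_iff_right]
    intro h1
    obtain ⟨l, hl⟩ := hAC _ h1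
    exact h.disj l k hl
  have hdisj : Disjoint A (segment c' i' j') := by
    rw [Finset.disjoint_left]
    intro a ha ha'
    obtain ⟨k, rfl⟩ := hAC a ha
    obtain ⟨l, _, _, hl⟩ := mem_segment.1 ha'
    exact h.disj k l hl.symm
  have hsub : segment c i j ⊆ segment c 0 p := by
    intro a ha
    obtain ⟨k, h1, h2, rfl⟩ := mem_segment.1 ha
    exact mem_segment.2 ⟨k, by omega, by omega, rfl⟩
  have hbal : Balanced Z := fun g => by
    have h1 := Finset.sum_sdiff (f := fun a => g (G.head a) - g (G.tail a)) hsub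
    rw [h.cyc.sum_segment (Nat.zero_le p) le_rfl, h.cyc.sum_segment (by omega) hj.le] at h1
    have h2 := h.cyc.period 0
    rw [zero_add] at h2
    rw [h2, hii', hjj'] at h1
    rw [Finset.sum_union hdisj, h.cyc'.sum_segment hlt.le hj'.le]
    linarith
  obtain ⟨κ, hκ, hLR⟩ := h.colouring Z hbal ⟨c' i', (hmem' i' hi').2 ⟨le_rfl, hlt⟩⟩
    (fun a ha => by
      rcases Finset.mem_union.1 ha with ha | ha
      · obtain ⟨k, rfl⟩ := hAC a ha; exact .inl ⟨k, rfl⟩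
      · obtain ⟨k, _, _, rfl⟩ := mem_segment.1 ha; exact .inr ⟨k, rfl⟩)
    (fun a ha => by
      rcases Finset.mem_union.1 ha with ha | ha
      · obtain ⟨k, rfl⟩ := hAC a ha
        have h2 := hxy (k + 1)
        rw [← h.cyc.next] at h2
        exact ⟨fun ha => ha.elim (hxy k).1 h2.1, fun ha => ha.elim (hxy k).2 h2.2⟩
      · exact h.symm.segment_avoids hj' hii'.symm hjj'.symm a ha)
  have hnot : ∀ k < p, i ≤ k → k < j → c k ∉ Z := fun k hk h1 h2 h3 => by
    have := hmem k hk h3; omega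
  have hnot' : ∀ k < q, (k < i' ∨ j' ≤ k) → c' k ∉ Z := fun k hk h' => by
    rw [hmem' k hk]; omega
  -- The colour passes from `c' 0` along `c'` to the common vertex at `i`, and from there along `c`
  -- to `c k`.
  refine hLR (c k) (c' 0) (hnot k (by omega) hik.le hkj) (hnot' _ h.cyc'.pos (by omega)) hL
    h.base' ?_
  have h1 : κ (c' 0) = κ (c' (i' - 1)) := hκ.trail (by omega)
    (fun k _ hk => hnot' k (by omega) (by omega)) h.cyc'.next
    (fun k h1 h2 => h.symm.tail_ne hi' hii'.symm h1 (by omega))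
  have h2 : κ (c i) = κ (c k) := hκ.trail (by omega)
    (fun k h1 h2 => hnot k (by omega) (by omega) (by omega)) h.cyc.next (fun k h1 h2 => hxy k)
  have h3 : κ (c' (i' - 1)) = κ (c i) := hκ _ _ (G.tail (c i)) (hnot' _ (by omega) (by omega))
    (hnot _ (by omega) le_rfl (by omega)) (hxy i).1 (hxy i).2
    (.inr (by rw [h.cyc'.next, Nat.sub_add_cancel h0', hii'])) (inc_tail _)
  rw [h1, h3, h2]

theorem exists_index_lt (h : IsLinkedPair x y p q c c' L R) {k k' : ℕ}
    (hk : G.tail (c k) = G.tail (c' k')) : ∃ l < q, G.tail (c k) = G.tail (c' l) :=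
  ⟨k' % q, Nat.mod_lt _ h.cyc'.pos, by rw [h.cyc'.apply_mod, hk]⟩

/-- Between two common vertices, the arcs of the two cycles are parallel. -/
theorem parallel (h : IsLinkedPair x y p q c c' L R) {i j i' j' : ℕ} (hij : i < j)
    (hj : j < p) (hi' : i' < q) (hj' : j' < q)
    (hii' : G.tail (c i) = G.tail (c' i')) (hjj' : G.tail (c j) = G.tail (c' j')) :
    i' + 1 < q ∧ G.tail (c (i + 1)) = G.tail (c' (i' + 1)) := by
  have h1 : ∃ k' < q, G.tail (c (i + 1)) = G.tail (c' k') := by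
    by_cases hlt : i + 1 < j
    · obtain ⟨k', hk'⟩ := h.common_of_between (Nat.lt_succ_self i) hlt hj hi' hj' hii' hjj'
      exact h.exists_index_lt hk'
    · obtain rfl : j = i + 1 := by omega
      exact ⟨j', hj', hjj'⟩
  obtain ⟨k', hk'q, hk'⟩ := h1
  have hlt := h.order (Nat.lt_succ_self i) (by omega) hi' hk'q hii' hk'
  by_cases hk1 : k' = i' + 1
  · subst hk1; exact ⟨hk'q, hk'⟩
  · exfalso
    -- A skipped vertex of `c'` would be common too, and its index on `c` would lie strictly between
    -- `i` and `i + 1`.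
    obtain ⟨l, hl⟩ := h.symm.common_of_between (Nat.lt_succ_self i') (by omega) hk'q
      (i' := i) (j' := i + 1) (by omega) (by omega) hii'.symm hk'.symm
    obtain ⟨l, hlp, hl⟩ := h.symm.exists_index_lt hl
    have h2 := h.symm.order (Nat.lt_succ_self i') (by omega) (by omega : i < p) hlp hii'.symm hl
    have h3 := h.symm.order (i := i' + 1) (j := k') (by omega) hk'q hlp (by omega : i + 1 < p) hl
      hk'.symm
    omega

end IsLinkedPair

end FinDigraph

namespace FinDigraph

variable {G : FinDigraph.{u}}

/-! ### The common vertices of consecutive cycles -/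

theorem IsQuarticEulerian.exists_tail_eq (hG : G.IsQuarticEulerian) (a : G.E) :
    ∃ b, b ≠ a ∧ G.tail b = G.tail a := by
  classical
  have h := (hG (G.tail a)).2
  rw [outDegree_eq] at h
  obtain ⟨b, hb, hba⟩ := Finset.exists_mem_ne (h.symm ▸ Nat.one_lt_two) a
  exact ⟨b, hba, by simpa using hb⟩

theorem IsDecomp.eq_or_eq_of_inc {m : G.E → Finset G.E} (hG : G.IsQuarticEulerian)
    (hm : IsDecomp m) {a b d : G.E} (hne : m a ≠ m b) (hab : G.tail a = G.tail b)
    (hd : G.Inc d (G.tail a)) : m d = m a ∨ m d = m b := by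
  obtain ⟨d', hd', ht⟩ := hm.exists_tail_of_inc hd
  rw [← hd']
  rcases hG.eq_or_eq_of_tail (a := a) (b := b) (by rintro rfl; exact hne rfl) hab.symm ht with
    rfl | rfl
  · exact .inl rfl
  · exact .inr rfl

theorem IsAntiDigon.ne_of_tail_ne {e f a : G.E} (hD : G.IsAntiDigon e f)
    (ha : G.tail a ≠ G.tail e) : a ≠ e ∧ a ≠ f :=
  ⟨by rintro rfl; exact ha rfl, by rintro rfl; exact ha hD.2.2.1⟩

namespace IsCycleChain

variable {e f : G.E} {m : G.E → Finset G.E} {n : ℕ} {M : ℕ → Finset G.E}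

theorem ne (hM : IsCycleChain m e f n M) {i j : ℕ} (hi : i ≤ n) (hj : j ≤ n) (hij : i ≠ j) :
    M i ≠ M j := fun h => hij (hM.inj i hi j hj h)

theorem avoids (hG : G.IsQuarticEulerian) (hD : G.IsAntiDigon e f) (hm : IsDecomp m)
    (hM : IsCycleChain m e f n M) {i : ℕ} (hi : 0 < i) (hin : i < n) {a : G.E} (ha : m a = M i) :
    ¬ G.Inc a (G.tail e) ∧ ¬ G.Inc a (G.head e) := by
  have key : ¬ (m a = m e ∨ m a = m f) := by
    rw [ha, ← hM.zero, ← hM.last]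
    rintro (h | h)
    · exact hM.ne (by omega) (by omega) (by omega) h
    · exact hM.ne (by omega) (by omega) (by omega) h
  exact ⟨fun h => key (hm.eq_of_inc_antiDigon hG hD (.inl h)),
    fun h => key (hm.eq_of_inc_antiDigon hG hD (.inr h))⟩

theorem symm (hD : G.IsAntiDigon e f) (hM : IsCycleChain m e f n M) :
    IsCycleChain m f e n (fun i => M (n - i)) where
  two_le := hM.two_le
  zero := hM.last
  last := by simp [hM.zero]
  exists_arc i hi := hM.exists_arc _ (by omega)
  exists_index a := by
    obtain ⟨i, hi, h⟩ := hM.exists_index a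
    exact ⟨n - i, by omega, by rw [Nat.sub_sub_self hi, h]⟩
  inj i hi j hj h := by
    have := hM.inj _ (by omega) _ (by omega) h
    omega
  link i hi := by
    obtain ⟨a, b, ha, hb, hab, hx, hy⟩ := hM.link (n - (i + 1)) (by omega)
    refine ⟨b, a, ?_, ha, hab.symm, ?_, ?_⟩
    · rw [hb]; congr 1; omega
    · rw [← hab, hD.2.2.1]; exact hx
    · rw [← hab, hD.2.2.2]; exact hy
  near a b i j hi hj ha hb hab hx hy := by
    rw [hD.2.2.1] at hx
    rw [hD.2.2.2] at hy
    have := hM.near a b (n - i) (n - j) (by omega) (by omega) ha hb hab hx hy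
    omega

/-- Outside the anti-digon, every vertex lies on two consecutive cycles. -/
theorem exists_neighbour (hG : G.IsQuarticEulerian) (hm : IsDecomp m)
    (hM : IsCycleChain m e f n M) {i : ℕ} (hi : i ≤ n) {a : G.E} (ha : m a = M i)
    (hx : G.tail a ≠ G.tail e) (hy : G.tail a ≠ G.head e) :
    ∃ b j, j ≤ n ∧ m b = M j ∧ G.tail b = G.tail a ∧ (j = i + 1 ∨ i = j + 1) := by
  obtain ⟨b, hba, hb⟩ := hG.exists_tail_eq a
  obtain ⟨j, hj, hbj⟩ := hM.exists_index b
  refine ⟨b, j, hj, hbj, hb, ?_⟩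
  rcases hM.near a b i j hi hj ha hbj hb.symm hx hy with rfl | h | h
  · exact absurd (hm.tail_inj (hbj.trans ha.symm) hb) hba
  · exact .inl h
  · exact .inr h

/-- The ends of the anti-digon lie on the first and on the last cycle only. -/
theorem tail_ne_of_common (hG : G.IsQuarticEulerian) (hD : G.IsAntiDigon e f) (hm : IsDecomp m)
    (hM : IsCycleChain m e f n M) {i : ℕ} (hi : i < n) {a b : G.E} (ha : m a = M i)
    (hb : m b = M (i + 1)) (hab : G.tail a = G.tail b) :
    G.tail a ≠ G.tail e ∧ G.tail a ≠ G.head e := by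
  have h2 := hM.two_le
  rcases Nat.eq_zero_or_pos i with rfl | hi0
  · have := hM.avoids hG hD hm (i := 0 + 1) (by omega) (by omega) hb
    rw [hab]
    exact ⟨fun h => this.1 (.inl h), fun h => this.2 (.inl h)⟩
  · have := hM.avoids hG hD hm (i := i) (by omega) (by omega) ha
    exact ⟨fun h => this.1 (.inl h), fun h => this.2 (.inl h)⟩

/-- The arcs of the cycle `M i` that are connected to the beginning of the sequence when arcs of
`M i` and `M (i + 1)` are removed. -/
def IsLeftArc (m : G.E → Finset G.E) (e : G.E) (M : ℕ → Finset G.E) (i : ℕ) (g : G.E) : Prop :=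
  (i = 0 ∧ m g = m e ∧ G.tail g = G.head e) ∨
    ∃ j, i = j + 1 ∧ m g = M i ∧
      ∃ b, m b = M j ∧ G.Inc g (G.tail b) ∧ G.tail b ≠ G.tail e ∧ G.tail b ≠ G.head e

/-- The cycles before `M i` are untouched by `Z`, so the colour of the first cycle is carried along
their links to `g`. -/
theorem eq_of_isLeftArc (hG : G.IsQuarticEulerian) (hD : G.IsAntiDigon e f) (hm : IsDecomp m)
    (hM : IsCycleChain m e f n M) {i : ℕ} (hi : i < n) {Z : Finset G.E} {κ : G.E → ZMod 2}
    (hκ : G.IsColouringOff (G.tail e) (G.head e) Z κ)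
    (hZ : ∀ a ∈ Z, m a = M i ∨ m a = M (i + 1)) {g d : G.E} (hg : g ∉ Z)
    (hL : IsLeftArc m e M i g) (hd : m d = m e) (hdt : G.tail d = G.head e) : κ d = κ g := by
  rcases hL with ⟨rfl, h1, h2⟩ | ⟨j, rfl, h1, b, hb, hgb, hx, hy⟩
  · rw [hm.tail_inj (h1.trans hd.symm) (h2.trans hdt.symm)]
  · have hZ' : ∀ a k, 0 ≤ k → k ≤ j → m a = M k → a ∉ Z := by
      intro a k _ hk ha haZ
      rcases hZ a haZ with h | h
      · exact hM.ne (by omega) (by omega) (by omega) (ha.symm.trans h)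
      · exact hM.ne (by omega) (by omega) (by omega) (ha.symm.trans h)
    have hd' := hD.ne_of_tail_ne (a := d) (by rw [hdt]; exact hD.2.1.symm)
    have hb' := hD.ne_of_tail_ne hx
    rw [hκ.eq_of_links hG hD hm (Nat.zero_le j) (fun k _ hk => hM.link k (by omega)) hZ'
      (hd.trans hM.zero.symm) hb hd'.1 hd'.2 hb'.1 hb'.2]
    exact hκ b g _ (hZ' b j (by omega) le_rfl hb) hg hx hy (inc_tail b) hgb

/-- The cycle `M i`, starting with an arc that is connected to the beginning of the sequence. -/
theorem exists_cyc_left (hG : G.IsQuarticEulerian) (hD : G.IsAntiDigon e f) (hm : IsDecomp m)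
    (hM : IsCycleChain m e f n M) {i : ℕ} (hi : i < n) :
    ∃ p c, G.IsCyc p c ∧ Set.range c = M i ∧ IsLeftArc m e M i (c 0) ∧
      (∀ b, m b = M (i + 1) → G.tail (c 0) ≠ G.tail b) ∧
      (∀ k, 0 < k → k < p → G.tail (c k) = G.tail e ∨ G.tail (c k) = G.head e → k = p - 1) ∧
      (∀ k, (∀ b, m b = M (i + 1) → G.tail (c k) ≠ G.tail b) → G.tail (c k) ≠ G.tail e →
        G.tail (c k) ≠ G.head e →
        IsLeftArc m e M i (c k) ∧ ∀ j, G.tail (c j) ≠ G.tail e ∧ G.tail (c j) ≠ G.head e) ∧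
      (0 < i → IsLeftArc m e M i (c (p - 1)) ∧
        ∀ j, G.tail (c j) ≠ G.tail e ∧ G.tail (c j) ≠ G.head e) := by
  have h2 := hM.two_le
  have hav : ∀ c : ℕ → G.E, Set.range c = M i → 0 < i →
      ∀ j, G.tail (c j) ≠ G.tail e ∧ G.tail (c j) ≠ G.head e := by
    intro c hc hi0 j
    obtain ⟨a, ha⟩ := hM.exists_arc i hi.le
    have hj : m (c j) = M i := by
      rw [← ha]
      refine hm.mem_iff.1 ?_
      rw [← Finset.mem_coe, ha, ← hc]; exact ⟨j, rfl⟩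
    have := hM.avoids hG hD hm hi0 hi hj
    exact ⟨fun h => this.1 (.inl h), fun h => this.2 (.inl h)⟩
  have hmid : ∀ c : ℕ → G.E, Set.range c = M i →
      (∀ k, (∀ b, m b = M (i + 1) → G.tail (c k) ≠ G.tail b) → G.tail (c k) ≠ G.tail e →
        G.tail (c k) ≠ G.head e →
        IsLeftArc m e M i (c k) ∧ ∀ j, G.tail (c j) ≠ G.tail e ∧ G.tail (c j) ≠ G.head e) := by
    intro c hc k hk hx hy
    obtain ⟨a, ha⟩ := hM.exists_arc i hi.le
    have hj : m (c k) = M i := by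
      rw [← ha]
      refine hm.mem_iff.1 ?_
      rw [← Finset.mem_coe, ha, ← hc]; exact ⟨k, rfl⟩
    obtain ⟨b, j, hjn, hb, hbt, rfl | rfl⟩ := hM.exists_neighbour hG hm hi.le hj hx hy
    · exact absurd hbt.symm (hk b hb)
    · exact ⟨.inr ⟨j, rfl, hj, b, hb, .inl hbt.symm, hbt ▸ hx, hbt ▸ hy⟩,
        hav c hc (by omega)⟩
  rcases i with _ | i
  · obtain ⟨p, c, hc, hce, h0, hp, hlast, hk⟩ := hm.exists_cyc_after hD.2.1
    have hcm : m (c 0) = m e := hm.mem_iff.1 (by rw [← Finset.mem_coe, ← hce]; exact ⟨0, rfl⟩)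
    refine ⟨p, c, hc, hce.trans (by rw [hM.zero]), .inl ⟨rfl, hcm, h0⟩, fun b hb h => ?_,
      fun k h1 h2 h3 => ?_, hmid c (hce.trans (by rw [hM.zero])), fun h => absurd h (lt_irrefl 0)⟩
    · have := hM.avoids hG hD hm (i := 0 + 1) (by omega) (by omega) hb
      exact this.2 (.inl (h.symm.trans h0))
    · by_contra h4
      have := hk k h1 (by omega)
      tauto
  · obtain ⟨a, b, ha, hb, hab, hx, hy⟩ := hM.link i (by omega)
    -- The start is a vertex shared with the preceding cycle: the first arc leaves it and the last
    -- arc enters it, so both are left arcs.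
    obtain ⟨p, c, hc, hcb, h0⟩ := hm.exists_cyc_at b
    have hcM : Set.range c = M (i + 1) := by rw [hcb, hb]
    have hav' := hav c hcM (by omega)
    have hcm : ∀ k, m (c k) = M (i + 1) := fun k => hb ▸ hm.mem_iff.1 (by
      rw [← Finset.mem_coe, ← hcb]; exact ⟨k, rfl⟩)
    refine ⟨p, c, hc, hcM, .inr ⟨i, rfl, h0 ▸ hb, a, ha, .inl (by rw [h0, hab]), hx, hy⟩,
      fun d hd h => ?_, fun k h1 h2 h3 => ?_, hmid c hcM, fun _ =>
        ⟨.inr ⟨i, rfl, hcm _, a, ha, .inr ?_, hx, hy⟩, hav'⟩⟩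
    · rw [h0] at h
      rcases hM.near a d i (i + 1 + 1) (by omega) (by omega) ha hd (hab.trans h) hx hy with h | h | h
        <;> omega
    · have := hav' k
      tauto
    · have := hc.period 0
      rw [zero_add] at this
      rw [hc.next, Nat.sub_add_cancel hc.pos, this, h0, hab]

/-- The predicate `R` is `IsLeftArc` for the reversed chain, in which `e` and `f` change roles. Left
arcs have the colour of one arc that leaves the head of the anti-digon and right arcs that of the
other, and `exists_colouring` separates these two. -/
theorem exists_isLinkedPair (hG : G.IsDiplanarObstruction) (hD : G.IsAntiDigon e f)
    (hm : IsDecomp m) (hM : IsCycleChain m e f n M) {i : ℕ} (hi : i < n) :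
    ∃ p q c c' L R, Set.range c = M i ∧ Set.range c' = M (i + 1) ∧
      IsLinkedPair (G.tail e) (G.head e) p q c c' L R := by
  have h2 := hM.two_le
  have hM' := hM.symm hD
  obtain ⟨p, c, hc, hcM, hb, hbn, hlast, hmid, hend⟩ := hM.exists_cyc_left hG.1 hD hm hi
  obtain ⟨q, c', hc', hcM', hb', hbn', hlast', hmid', hend'⟩ :=
    hM'.exists_cyc_left hG.1 hD.symm hm (i := n - (i + 1)) (by omega)
  have e1 : n - (n - (i + 1)) = i + 1 := by omega
  have e2 : n - (n - (i + 1) + 1) = i := by omega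
  rw [hD.2.2.1, hD.2.2.2] at *
  simp only [e1, e2] at hcM' hbn' hmid'
  obtain ⟨a₁, ha₁⟩ := hM.exists_arc i hi.le
  obtain ⟨a₂, ha₂⟩ := hM.exists_arc (i + 1) hi
  have hcm : ∀ k, m (c k) = M i := fun k => by
    rw [← ha₁]; exact hm.mem_iff.1 (by rw [← Finset.mem_coe, ha₁, ← hcM]; exact ⟨k, rfl⟩)
  have hcm' : ∀ k, m (c' k) = M (i + 1) := fun k => by
    rw [← ha₂]; exact hm.mem_iff.1 (by rw [← Finset.mem_coe, ha₂, ← hcM']; exact ⟨k, rfl⟩)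
  have hcs : ∀ b, m b = M i → ∃ k, c k = b := fun b hb => by
    have : b ∈ Set.range c := by rw [hcM, ← ha₁]; exact hm.mem_iff.2 (hb.trans ha₁.symm)
    exact this
  have hcs' : ∀ b, m b = M (i + 1) → ∃ k, c' k = b := fun b hb => by
    have : b ∈ Set.range c' := by rw [hcM', ← ha₂]; exact hm.mem_iff.2 (hb.trans ha₂.symm)
    exact this
  refine ⟨p, q, c, c', _, _, hcM, hcM', hc, hc', fun k l h => ?_, fun Z hZ hne hZc hZx => ?_, hb,
    hb', fun k => hbn _ (hcm' k), fun k => hbn' _ (hcm k), fun k l h => ?_, hlast, hlast',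
    fun k hk => hmid k fun b hb => ?_, fun k hk => hmid' k fun b hb => ?_, ?_⟩
  · refine hM.ne (i := i) (j := i + 1) (by omega) (by omega) (by omega) ?_
    rw [← hcm k, h, hcm']
  · obtain ⟨κ, hκ, hκ'⟩ := hG.exists_colouring hD hZ hne (fun a ha => (hZx a ha).1)
      (fun a ha => (hZx a ha).2)
    refine ⟨κ, hκ, fun g h hg hh hL hR => ?_⟩
    obtain ⟨d, hd, hdt⟩ := hm.exists_next e
    obtain ⟨d', hd', hdt'⟩ := hm.exists_next f
    have hZm : ∀ a ∈ Z, m a = M i ∨ m a = M (i + 1) := by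
      intro a ha
      rcases hZc a ha with ⟨k, rfl⟩ | ⟨k, rfl⟩
      · exact .inl (hcm k)
      · exact .inr (hcm' k)
    rw [← hM.eq_of_isLeftArc hG.1 hD hm hi hκ hZm hg hL hd hdt]
    have hκf : G.IsColouringOff (G.tail f) (G.head f) Z κ := by
      rw [hD.2.2.1, hD.2.2.2]; exact hκ
    rw [← hM'.eq_of_isLeftArc hG.1 hD.symm hm (i := n - (i + 1)) (by omega) hκf
      (by simp only [e1, e2]; exact fun a ha => (hZm a ha).symm) hh hR hd' hdt']
    refine hκ' d d' hdt (hdt'.trans hD.2.2.2) ?_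
    rintro rfl
    exact hm.antiDigon_ne hD (hd.symm.trans hd')
  · exact hM.tail_ne_of_common hG.1 hD hm hi (hcm k) (hcm' l) h
  · obtain ⟨l, rfl⟩ := hcs' b hb
    exact hk l
  · obtain ⟨l, rfl⟩ := hcs b hb
    exact hk l
  -- As `2 ≤ n`, the two cycles are not both at the ends of the chain, so one of them avoids the
  -- anti-digon.
  · rcases Nat.eq_zero_or_pos i with rfl | hi0
    · exact .inr (hend' (by omega))
    · exact .inl (hend hi0)

/-- Two consecutive cycles have a single common vertex, or two common vertices that are joined by
an arc of either cycle. -/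
theorem exists_common (hG : G.IsDiplanarObstruction) (hD : G.IsAntiDigon e f)
    (hm : IsDecomp m) (hM : IsCycleChain m e f n M) {i : ℕ} (hi : i < n) :
    ∃ a b a' b', m a = M i ∧ m b = M (i + 1) ∧ m a' = M i ∧ m b' = M (i + 1) ∧
      G.tail a = G.tail b ∧ G.tail a' = G.tail b' ∧
      (∀ g h, m g = M i → m h = M (i + 1) → G.tail g = G.tail h →
        G.tail g = G.tail a ∨ G.tail g = G.tail a') ∧
      (G.tail a ≠ G.tail a' → G.head a = G.tail a' ∧ G.head b = G.tail a') := by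
  classical
  obtain ⟨p, q, c, c', L, R, hcM, hcM', h⟩ := hM.exists_isLinkedPair hG hD hm hi
  have h2 := hM.two_le
  obtain ⟨a₁, ha₁⟩ := hM.exists_arc i hi.le
  obtain ⟨a₂, ha₂⟩ := hM.exists_arc (i + 1) hi
  have hcm : ∀ k, m (c k) = M i := fun k => by
    rw [← ha₁]; exact hm.mem_iff.1 (by rw [← Finset.mem_coe, ha₁, ← hcM]; exact ⟨k, rfl⟩)
  have hcm' : ∀ k, m (c' k) = M (i + 1) := fun k => by
    rw [← ha₂]; exact hm.mem_iff.1 (by rw [← Finset.mem_coe, ha₂, ← hcM']; exact ⟨k, rfl⟩)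
  -- The positions on `c` of the common vertices; the least and the greatest one provide the
  -- witnesses.
  let S : Finset ℕ := (Finset.range p).filter fun k => ∃ k', G.tail (c k) = G.tail (c' k')
  have hS : ∀ g h, m g = M i → m h = M (i + 1) → G.tail g = G.tail h → ∃ k ∈ S, c k = g := by
    intro g d hg hd hgd
    have hgc : g ∈ Set.range c := by rw [hcM, ← ha₁]; exact hm.mem_iff.2 (hg.trans ha₁.symm)
    have hdc : d ∈ Set.range c' := by rw [hcM', ← ha₂]; exact hm.mem_iff.2 (hd.trans ha₂.symm)
    obtain ⟨k, hk, rfl⟩ := h.cyc.mem_range_iff.1 hgc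
    obtain ⟨k', rfl⟩ := hdc
    exact ⟨k, Finset.mem_filter.2 ⟨Finset.mem_range.2 hk, k', hgd⟩, rfl⟩
  have hSne : S.Nonempty := by
    obtain ⟨a, b, ha, hb, hab, -⟩ := hM.link i hi
    obtain ⟨k, hk, -⟩ := hS a b ha hb hab
    exact ⟨k, hk⟩
  have hSm : ∀ k ∈ S, k < p ∧ ∃ k' < q, G.tail (c k) = G.tail (c' k') := by
    intro k hk
    obtain ⟨h1, k', h3⟩ := Finset.mem_filter.1 hk
    exact ⟨Finset.mem_range.1 h1, h.exists_index_lt h3⟩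
  obtain ⟨hjp, j', hj', hjj⟩ := hSm _ (S.min'_mem hSne)
  obtain ⟨hlp, l', hl', hll⟩ := hSm _ (S.max'_mem hSne)
  set j := S.min' hSne
  set l := S.max' hSne
  have hle : ∀ k ∈ S, j ≤ k ∧ k ≤ l := fun k hk => ⟨S.min'_le k hk, S.le_max' k hk⟩
  -- Otherwise `c j` and `c' j'` form an anti-digon, and the two arcs that leave its head end at the
  -- same vertex. The anti-digon then does not separate them, against `exists_colouring` for the
  -- removal of some other cycle.
  have hshort : l ≤ j + 1 := by
    by_contra! hcon
    obtain ⟨hq1, h1⟩ := h.parallel (by omega : j < l) hlp hj' hl' hjj hll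
    obtain ⟨hq2, h3⟩ := h.parallel (by omega : j + 1 < l) hlp hq1 hl' h1 hll
    have hD' : G.IsAntiDigon (c j) (c' j') := by
      refine ⟨h.disj _ _, fun h => ?_, hjj.symm, ?_⟩
      · rw [IsCyc.next ‹IsLinkedPair _ _ _ _ _ _ _ _›.cyc] at h
        have := IsCyc.inj ‹IsLinkedPair _ _ _ _ _ _ _ _›.cyc j hjp (j + 1) (by omega) h
        omega
      · rw [h.cyc.next, h.cyc'.next, h1]
    -- A third cycle exists because `2 ≤ n`. It avoids the new anti-digon, whose ends are already on
    -- two cycles.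
    obtain ⟨t, ht, hti, hti'⟩ : ∃ t ≤ n, t ≠ i ∧ t ≠ i + 1 := by
      rcases Nat.eq_zero_or_pos i with rfl | hi0
      · exact ⟨n, le_rfl, by omega, by omega⟩
      · exact ⟨0, by omega, by omega, by omega⟩
    obtain ⟨z, hz⟩ := hM.exists_arc t ht
    have hnz : ∀ k k', G.tail (c k) = G.tail (c' k') → ∀ a ∈ m z, ¬ G.Inc a (G.tail (c k)) := by
      intro k k' hkk a ha hinc
      have hne : m (c k) ≠ m (c' k') := by
        rw [hcm, hcm']; exact hM.ne (by omega) (by omega) (by omega)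
      have := hm.eq_or_eq_of_inc hG.1 hne hkk hinc
      rw [hm.mem_iff.1 ha, hz, hcm, hcm'] at this
      rcases this with h | h
      · exact hM.ne ht (by omega) hti h
      · exact hM.ne ht (by omega) hti' h
    obtain ⟨κ, hκ, hκ'⟩ := hG.exists_colouring hD' (hm.balanced z) ⟨z, hm.mem_self z⟩
      (hnz j j' hjj) (by rw [h.cyc.next]; exact hnz _ _ h1)
    refine hκ' (c (j + 1)) (c' (j' + 1)) (h.cyc.next j).symm (by rw [h.cyc.next, h1]) (h.disj _ _)
      (hκ _ _ (G.tail (c (j + 2))) ?_ ?_ ?_ ?_ (.inr (h.cyc.next _)) (.inr ?_))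
    · exact fun hcon => hnz _ _ h1 _ hcon (inc_tail _)
    · exact fun hcon => hnz _ _ h1 _ hcon (.inl h1.symm)
    · intro h4
      have := h.cyc.inj _ (by omega) _ hjp h4
      omega
    · intro h4
      rw [h.cyc.next] at h4
      have := h.cyc.inj _ (by omega) _ (by omega) h4
      omega
    · rw [h.cyc'.next]; exact h3.symm
  refine ⟨c j, c' j', c l, c' l', hcm _, hcm' _, hcm _, hcm' _, hjj, hll, ?_, ?_⟩
  · intro g d hg hd hgd
    obtain ⟨k, hk, rfl⟩ := hS g d hg hd hgd
    have := hle k hk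
    obtain h1 | h1 : k = j ∨ k = l := by omega
    · exact .inl (by rw [h1])
    · exact .inr (by rw [h1])
  · intro hne
    have hjl : j < l := by
      have := (hle l (S.max'_mem hSne)).1
      rcases this.lt_or_eq with h | h
      · exact h
      · exact absurd (by rw [h]) hne
    obtain ⟨-, h1⟩ := h.parallel hjl hlp hj' hl' hjj hll
    have hl : l = j + 1 := by omega
    rw [hl]
    exact ⟨h.cyc.next _, by rw [h.cyc'.next, h1]⟩

end IsCycleChain

end FinDigraph

namespace FinDigraph

variable {G : FinDigraph.{u}}

/-! ### Cyclic sequences of vertices and anti-digons -/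

theorem IsQuarticEulerian.exists_tail (hG : G.IsQuarticEulerian) (v : G.V) :
    ∃ a, G.tail a = v := by
  classical
  have h := (hG v).2
  rw [outDegree_eq] at h
  obtain ⟨a, ha⟩ := Finset.card_pos.1 (h.symm ▸ Nat.two_pos)
  exact ⟨a, by simpa using ha⟩

/-- A cyclic sequence of `N` objects, given by their entries `X k` and their exits `Y k`: single
vertices if `X k = Y k`, and otherwise anti-digons with the arcs `A k` and `B k`. The arcs `R k`
and `L k` lead from the exit of an object to the entry of the next one and of the previous one,
respectively. -/
structure IsNecklace (G : FinDigraph.{u}) (N : ℕ) (X Y : ℕ → G.V) (A B R L : ℕ → G.E) :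
    Prop where
  two_le : 2 ≤ N
  period_X : Function.Periodic X N
  period_Y : Function.Periodic Y N
  period_A : Function.Periodic A N
  period_B : Function.Periodic B N
  period_R : Function.Periodic R N
  period_L : Function.Periodic L N
  exists_index : ∀ v, ∃ k, v = X k ∨ v = Y k
  modEq_of_X : ∀ {k l}, X k = X l → k ≡ l [MOD N]
  modEq_of_Y : ∀ {k l}, Y k = Y l → k ≡ l [MOD N]
  modEq_of_XY : ∀ {k l}, X k = Y l → k ≡ l [MOD N]
  arc_A : ∀ {k}, X k ≠ Y k → G.tail (A k) = X k ∧ G.head (A k) = Y k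
  arc_B : ∀ {k}, X k ≠ Y k → G.tail (B k) = X k ∧ G.head (B k) = Y k
  A_ne_B : ∀ k, A k ≠ B k
  arc_R : ∀ k, G.tail (R k) = Y k ∧ G.head (R k) = X (k + 1)
  arc_L : ∀ k, G.tail (L k) = Y (k + 1) ∧ G.head (L k) = X k
  R_ne_L : ∀ k, R (k + 1) ≠ L k

/-- On a directed cycle that consists of two pairs of vertices, where the second vertex of each pair
follows the first one, the first vertex of a pair follows the second vertex of the other one. -/
theorem IsDecomp.head_eq_of_pairs {m : G.E → Finset G.E} (hm : IsDecomp m) {p p' q q' : G.E}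
    (hp' : m p' = m p) (hq : m q = m p)
    (hall : ∀ g, m g = m p → G.tail g = G.tail p ∨ G.tail g = G.tail p' ∨
      G.tail g = G.tail q ∨ G.tail g = G.tail q')
    (hpq : G.tail p ≠ G.tail q) (hpq' : G.tail p' ≠ G.tail q)
    (hpp : G.tail p ≠ G.tail p' → G.head p = G.tail p')
    (hqq : G.tail q ≠ G.tail q' → G.head q = G.tail q') : G.head p' = G.tail q := by
  obtain ⟨g, hg, hgt⟩ := hm.exists_next p'
  -- Otherwise the cycle would close up after the first pair and never reach `q`.
  have hX : G.head p' ≠ G.tail p := by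
    intro h
    have := hm.closed_eq (a := p) (fun b => b = p ∨ b = p') (.inl rfl) (fun b b' hb hb' hor hbb => by
      rcases hor with rfl | rfl
      · by_cases hne : G.tail b = G.tail p'
        · obtain rfl := hm.tail_inj (hb.trans hp'.symm) hne
          exact .inl (hm.tail_inj hb' (hbb.trans h))
        · exact .inr (hm.tail_inj (hb'.trans hp'.symm) (hbb.trans (hpp hne)))
      · exact .inl (hm.tail_inj hb' (hbb.trans h))) hq
    rcases this with rfl | rfl
    · exact hpq rfl
    · exact hpq' rfl
  rcases hall g (hg.trans hp') with h | h | h | h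
  · exact absurd (hgt.symm.trans h) hX
  · by_cases hne : G.tail p = G.tail p'
    · exact absurd (hgt.symm.trans (h.trans hne.symm)) hX
    · have := hm.head_inj hp' ((hgt.symm.trans h).trans (hpp hne).symm)
      exact absurd (by rw [this]) hne
  · exact hgt.symm.trans h
  · by_cases hne : G.tail q = G.tail q'
    · exact (hgt.symm.trans h).trans hne.symm
    · have := hm.head_inj (hp'.trans hq.symm) ((hgt.symm.trans h).trans (hqq hne).symm)
      exact absurd (by rw [this]) hpq'

/-- The index `n` gives the pair of the last and the first cycle, whose common vertices are the ends
of the original anti-digon by `near`. -/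
theorem IsCycleChain.exists_common_mod {e f : G.E} {m : G.E → Finset G.E} {n : ℕ}
    {M : ℕ → Finset G.E} (hG : G.IsDiplanarObstruction) (hD : G.IsAntiDigon e f)
    (hm : IsDecomp m) (hM : IsCycleChain m e f n M) (i : ℕ) (hi : i < n + 1) :
    ∃ a b a' b', m a = M i ∧ m b = M ((i + 1) % (n + 1)) ∧ m a' = M i ∧
      m b' = M ((i + 1) % (n + 1)) ∧
      G.tail a = G.tail b ∧ G.tail a' = G.tail b' ∧
      (∀ g h, m g = M i → m h = M ((i + 1) % (n + 1)) → G.tail g = G.tail h →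
        G.tail g = G.tail a ∨ G.tail g = G.tail a') ∧
      (G.tail a ≠ G.tail a' → G.head a = G.tail a' ∧ G.head b = G.tail a') := by
  have h2 := hM.two_le
  rcases (Nat.lt_succ_iff.1 hi).lt_or_eq with hi | rfl
  · rw [Nat.mod_eq_of_lt (by omega : i + 1 < n + 1)]
    exact hM.exists_common hG hD hm hi
  · rw [Nat.mod_self, hM.zero, hM.last]
    obtain ⟨a, ha, hat⟩ := hm.exists_next f
    obtain ⟨b, hb, hbt⟩ := hm.exists_next e
    refine ⟨f, e, a, b, rfl, rfl, ha, hb, hD.2.2.1, ?_, fun g h hg hh hgh => ?_, fun _ => ?_⟩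
    · rw [hat, hbt, hD.2.2.2]
    · by_contra! hcon
      rw [hD.2.2.1, hat, hD.2.2.2] at hcon
      have := hM.near g h i 0 le_rfl (by omega) (hg.trans hM.last.symm) (hh.trans hM.zero.symm)
        hgh hcon.1 hcon.2
      omega
    · exact ⟨hat.symm, by rw [hat, hD.2.2.2]⟩

/-- Object `k` consists of the common vertices of the cycles `μ k` and `μ (k + 1)`. The cycle `μ (k
+ 1)` passes only through objects `k` and `k + 1`, so its arcs outside these objects are one arc in
each direction between them. -/
theorem IsCycleChain.exists_isNecklace {e f : G.E} {m : G.E → Finset G.E} {n : ℕ}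
    {M : ℕ → Finset G.E} (hG : G.IsDiplanarObstruction) (hD : G.IsAntiDigon e f)
    (hm : IsDecomp m) (hM : IsCycleChain m e f n M) :
    ∃ X Y A B R L, G.IsNecklace (n + 1) X Y A B R L := by
  have h2 := hM.two_le
  have : Nonempty G.E := ⟨e⟩
  choose! a₀ b₀ a₁ b₁ h₀ using hM.exists_common_mod hG hD hm
  have hlt : ∀ k, k % (n + 1) < n + 1 := fun k => Nat.mod_lt _ (by omega)
  let μ : ℕ → Finset G.E := fun k => M (k % (n + 1))
  let a : ℕ → G.E := fun k => a₀ (k % (n + 1))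
  let b : ℕ → G.E := fun k => b₀ (k % (n + 1))
  let a' : ℕ → G.E := fun k => a₁ (k % (n + 1))
  let b' : ℕ → G.E := fun k => b₁ (k % (n + 1))
  have hμ : ∀ k, m (a k) = μ k ∧ m (b k) = μ (k + 1) ∧ m (a' k) = μ k ∧ m (b' k) = μ (k + 1) ∧
      G.tail (a k) = G.tail (b k) ∧ G.tail (a' k) = G.tail (b' k) ∧
      (∀ g h, m g = μ k → m h = μ (k + 1) → G.tail g = G.tail h →
        G.tail g = G.tail (a k) ∨ G.tail g = G.tail (a' k)) ∧
      (G.tail (a k) ≠ G.tail (a' k) →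
        G.head (a k) = G.tail (a' k) ∧ G.head (b k) = G.tail (a' k)) := by
    intro k
    have := h₀ (k % (n + 1)) (hlt k)
    rw [Nat.mod_add_mod] at this
    exact this
  have hinj : ∀ k l, μ k = μ l → k ≡ l [MOD n + 1] := fun k l h =>
    hM.inj _ (Nat.lt_succ_iff.1 (hlt k)) _ (Nat.lt_succ_iff.1 (hlt l)) h
  have hsucc : ∀ k, ¬ k + 1 ≡ k [MOD n + 1] := fun k h => by
    have := (Nat.modEq_iff_dvd' (Nat.le_succ k)).1 h.symm
    have := Nat.le_of_dvd (by omega) this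
    omega
  have hsucc2 : ∀ k, ¬ k + 2 ≡ k [MOD n + 1] := fun k h => by
    have := (Nat.modEq_iff_dvd' (Nat.le_add_right k 2)).1 h.symm
    have := Nat.le_of_dvd (by omega) this
    omega
  -- A vertex lies on just two cycles, and since there are at least three cycles, an unordered pair
  -- of cyclically consecutive ones determines its index.
  have hobj : ∀ k l g h, m g = μ k → m h = μ (k + 1) → G.tail g = G.tail h → ∀ g' h', m g' = μ l →
      m h' = μ (l + 1) → G.tail g' = G.tail h' → G.tail g = G.tail g' → k ≡ l [MOD n + 1] := by
    intro k l g h hg hh hgh g' h' hg' hh' hgh' hgg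
    have hne : m g ≠ m h := by
      rw [hg, hh]; exact fun h => hsucc k (hinj _ _ h).symm
    have h1 := hm.eq_or_eq_of_inc hG.1 hne hgh (.inl hgg.symm)
    have h3 := hm.eq_or_eq_of_inc hG.1 hne hgh (.inl (hgh'.symm.trans hgg.symm))
    rw [hg, hh, hg'] at h1
    rw [hg, hh, hh'] at h3
    rcases h1 with h1 | h1
    · exact (hinj _ _ h1).symm
    · exfalso
      have h1' : l + 1 ≡ k + 2 [MOD n + 1] := (hinj _ _ h1).add_right 1
      rcases h3 with h3 | h3
      · exact hsucc2 k (h1'.symm.trans (hinj _ _ h3))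
      · exact hsucc (k + 1) (h1'.symm.trans (hinj _ _ h3))
  -- The other cycle through a vertex of `μ (k + 1)` is `μ k` or `μ (k + 2)`: by `near` off the
  -- anti-digon, and by the wrap-around at its ends.
  have hvert : ∀ k g, m g = μ (k + 1) →
      (G.tail g = G.tail (a k) ∨ G.tail g = G.tail (a' k)) ∨
      (G.tail g = G.tail (a (k + 1)) ∨ G.tail g = G.tail (a' (k + 1))) := by
    intro k g hg
    have hex : ∃ h, G.tail h = G.tail g ∧ (m h = μ k ∨ m h = μ (k + 2)) := by
      obtain ⟨h, hne, hhg⟩ := hG.1.exists_tail_eq g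
      refine ⟨h, hhg, ?_⟩
      obtain ⟨j, hj, hhj⟩ := hM.exists_index h
      have hjm : M j = μ j := by simp only [μ, Nat.mod_eq_of_lt (Nat.lt_succ_iff.2 hj)]
      have hmod : (k + 1) % (n + 1) ≡ k + 1 [MOD n + 1] := Nat.mod_modEq _ _
      have hi := Nat.lt_succ_iff.1 (hlt (k + 1))
      change m g = M ((k + 1) % (n + 1)) at hg
      generalize (k + 1) % (n + 1) = i at hmod hi hg
      have hij : i ≠ j := by
        rintro rfl
        exact hne (hm.tail_inj (hhj.trans hg.symm) hhg)
      have hcases : j + 1 ≡ i [MOD n + 1] ∨ j ≡ i + 1 [MOD n + 1] := by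
        by_cases hxy : G.tail g = G.tail e ∨ G.tail g = G.head e
        · have h1 := hm.eq_of_inc_antiDigon hG.1 hD (a := g) (hxy.imp .inl .inl)
          have h3 := hm.eq_of_inc_antiDigon hG.1 hD (a := h) (by rw [← hhg] at hxy; exact hxy.imp .inl .inl)
          rw [← hM.zero, ← hM.last, hg] at h1
          rw [← hM.zero, ← hM.last, hhj] at h3
          have h1' : i = 0 ∨ i = n := h1.imp (hM.inj _ hi _ (by omega)) (hM.inj _ hi _ le_rfl)
          have h3' : j = 0 ∨ j = n := h3.imp (hM.inj _ hj _ (by omega)) (hM.inj _ hj _ le_rfl)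
          have h0 : 0 ≡ n + 1 [MOD n + 1] := by simp [Nat.ModEq]
          obtain ⟨rfl, rfl⟩ | ⟨rfl, rfl⟩ : (i = 0 ∧ j = n) ∨ (i = n ∧ j = 0) := by omega
          · exact .inl h0.symm
          · exact .inr h0
        · push Not at hxy
          rcases hM.near g h i j hi hj hg hhj hhg.symm hxy.1 hxy.2 with h1 | h1 | h1
          · exact absurd h1 hij
          · exact .inr (by rw [h1])
          · exact .inl (by rw [h1])
      rw [hhj, hjm]
      rcases hcases with h1 | h1
      · have h3 : j ≡ k [MOD n + 1] := Nat.ModEq.add_right_cancel' 1 (h1.trans hmod)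
        exact .inl (congrArg M h3)
      · have h3 : j ≡ k + 2 [MOD n + 1] := h1.trans (hmod.add_right 1)
        exact .inr (congrArg M h3)
    obtain ⟨h, hhg, hh | hh⟩ := hex
    · have := (hμ k).2.2.2.2.2.2.1 h g hh hg hhg
      rw [hhg] at this
      exact .inl this
    · exact .inr ((hμ (k + 1)).2.2.2.2.2.2.1 g h hg hh hhg.symm)
  have hXX : ∀ k l, G.tail (a k) = G.tail (a l) → k ≡ l [MOD n + 1] := fun k l h =>
    hobj k l _ _ (hμ k).1 (hμ k).2.1 (hμ k).2.2.2.2.1 _ _ (hμ l).1 (hμ l).2.1 (hμ l).2.2.2.2.1 h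
  have hYY : ∀ k l, G.tail (a' k) = G.tail (a' l) → k ≡ l [MOD n + 1] := fun k l h =>
    hobj k l _ _ (hμ k).2.2.1 (hμ k).2.2.2.1 (hμ k).2.2.2.2.2.1 _ _ (hμ l).2.2.1 (hμ l).2.2.2.1
      (hμ l).2.2.2.2.2.1 h
  have hXY : ∀ k l, G.tail (a k) = G.tail (a' l) → k ≡ l [MOD n + 1] := fun k l h =>
    hobj k l _ _ (hμ k).1 (hμ k).2.1 (hμ k).2.2.2.2.1 _ _ (hμ l).2.2.1 (hμ l).2.2.2.1
      (hμ l).2.2.2.2.2.1 h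
  have hR : ∀ k, G.head (b' k) = G.tail (a (k + 1)) := by
    intro k
    refine hm.head_eq_of_pairs (p := b k) (q' := a' (k + 1)) ?_ ?_ ?_ ?_ ?_ ?_ ?_
    · rw [(hμ k).2.1, (hμ k).2.2.2.1]
    · rw [(hμ k).2.1, (hμ (k + 1)).1]
    · intro g hg
      rw [← (hμ k).2.2.2.2.1, ← (hμ k).2.2.2.2.2.1]
      have := hvert k g (hg.trans (hμ k).2.1)
      tauto
    · rw [← (hμ k).2.2.2.2.1]
      exact fun h => hsucc k (hXX _ _ h).symm
    · rw [← (hμ k).2.2.2.2.2.1]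
      exact fun h => hsucc k (hXY _ _ h.symm)
    · rw [← (hμ k).2.2.2.2.1, ← (hμ k).2.2.2.2.2.1]
      exact fun h => ((hμ k).2.2.2.2.2.2.2 h).2
    · exact fun h => ((hμ (k + 1)).2.2.2.2.2.2.2 h).1
  have hL : ∀ k, G.head (a' (k + 1)) = G.tail (a k) := by
    intro k
    rw [(hμ k).2.2.2.2.1]
    refine hm.head_eq_of_pairs (p := a (k + 1)) (q' := b' k) ?_ ?_ ?_ ?_ ?_ ?_ ?_
    · rw [(hμ (k + 1)).1, (hμ (k + 1)).2.2.1]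
    · rw [(hμ k).2.1, (hμ (k + 1)).1]
    · intro g hg
      rw [← (hμ k).2.2.2.2.1, ← (hμ k).2.2.2.2.2.1]
      have := hvert k g (hg.trans (hμ (k + 1)).1)
      tauto
    · rw [← (hμ k).2.2.2.2.1]
      exact fun h => hsucc k (hXX _ _ h)
    · rw [← (hμ k).2.2.2.2.1]
      exact fun h => hsucc k (hXY _ _ h.symm).symm
    · exact fun h => ((hμ (k + 1)).2.2.2.2.2.2.2 h).1
    · rw [← (hμ k).2.2.2.2.1, ← (hμ k).2.2.2.2.2.1]
      exact fun h => ((hμ k).2.2.2.2.2.2.2 h).2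
  have hper : ∀ {α : Type u} (g : ℕ → α), Function.Periodic (fun k => g (k % (n + 1))) (n + 1) :=
    fun g k => by simp only [Nat.add_mod_right]
  refine ⟨fun k => G.tail (a k), fun k => G.tail (a' k), a, b, b', fun k => a' (k + 1), by omega,
    hper fun k => G.tail (a₀ k), hper fun k => G.tail (a₁ k), hper a₀, hper b₀, hper b₁, ?_, ?_,
    hXX _ _, hYY _ _, hXY _ _, fun h => ⟨rfl, ((hμ _).2.2.2.2.2.2.2 h).1⟩,
    fun h => ⟨(hμ _).2.2.2.2.1.symm, ((hμ _).2.2.2.2.2.2.2 h).2⟩, fun k h => ?_,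
    fun k => ⟨(hμ _).2.2.2.2.2.1.symm, hR k⟩, fun k => ⟨rfl, hL k⟩, fun k h => ?_⟩
  · exact fun k => by
      show a₁ ((k + (n + 1) + 1) % (n + 1)) = a₁ ((k + 1) % (n + 1))
      rw [add_right_comm, Nat.add_mod_right]
  · intro v
    obtain ⟨g, rfl⟩ := hG.1.exists_tail v
    obtain ⟨i, hi, hg⟩ := hM.exists_index g
    -- The index `i` modulo `n + 1`, written as a successor to fit `hvert`.
    have : m g = μ (i + n + 1) := by
      rw [hg]
      show M i = M _
      rw [add_assoc, Nat.add_mod_right, Nat.mod_eq_of_lt (Nat.lt_succ_iff.2 hi)]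
    rcases hvert (i + n) g this with h | h
    · exact ⟨_, h⟩
    · exact ⟨_, h⟩
  · have := congrArg m h
    rw [(hμ k).1, (hμ k).2.1] at this
    exact hsucc k (hinj _ _ this).symm
  · have := congrArg m h
    rw [(hμ (k + 1)).2.2.2.1, (hμ (k + 1)).2.2.1] at this
    exact hsucc (k + 1) (hinj _ _ this)

end FinDigraph

namespace FinDigraph

variable {G : FinDigraph.{u}}

/-! ### Isomorphisms with the three families -/

theorem IsQuarticEulerian.card_arcs (hG : G.IsQuarticEulerian) :
    Nat.card G.E = 2 * Nat.card G.V := by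
  rw [← Nat.card_congr (Equiv.sigmaFiberEquiv G.tail), Nat.card_sigma,
    Finset.sum_congr rfl fun v _ => show Nat.card {a // G.tail a = v} = 2 from (hG v).2]
  simp [mul_comm, Nat.card_eq_fintype_card]

/-- Both digraphs have twice as many arcs as vertices, so surjectivity on the arcs is enough. -/
theorem IsQuarticEulerian.isomorphic (hG : G.IsQuarticEulerian) {H : FinDigraph.{v}}
    (hH : Nat.card H.E = 2 * Nat.card H.V) {φ : H.V → G.V} (hφ : Function.Bijective φ)
    {ψ : H.E → G.E} (hψ : Function.Surjective ψ) (ht : ∀ a, G.tail (ψ a) = φ (H.tail a))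
    (hh : ∀ a, G.head (ψ a) = φ (H.head a)) : G.Isomorphic H := by
  have hcard : Nat.card H.E = Nat.card G.E := by
    rw [hH, hG.card_arcs, Nat.card_congr (Equiv.ofBijective φ hφ)]
  have hψ' : Function.Bijective ψ := (Nat.bijective_iff_surjective_and_card ψ).2 ⟨hψ, hcard⟩
  refine ⟨(Equiv.ofBijective φ hφ).symm, (Equiv.ofBijective ψ hψ').symm, fun a => ?_, fun a => ?_⟩
  · obtain ⟨b, rfl⟩ := hψ a
    rw [ht, Equiv.ofBijective_symm_apply_apply, Equiv.ofBijective_symm_apply_apply]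
  · obtain ⟨b, rfl⟩ := hψ a
    rw [hh, Equiv.ofBijective_symm_apply_apply, Equiv.ofBijective_symm_apply_apply]

theorem periodic_finRotate {α : Type*} {N : ℕ} {X : ℕ → α} (hX : Function.Periodic X N)
    (i : Fin N) : X (finRotate N i) = X (i + 1) := by
  have : NeZero N := ⟨by have := i.2; omega⟩
  rw [finRotate_apply, Fin.val_add, hX.map_mod_nat, Fin.val_one']
  rw [← hX.map_mod_nat (_ + _), Nat.add_mod_mod, hX.map_mod_nat]

namespace IsNecklace

variable {N : ℕ} {X Y : ℕ → G.V} {A B R L : ℕ → G.E}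

/-- The exit of an object has the out-arcs `R k` and `L (k - 1)`, and the entry of an anti-digon has
`A k` and `B k`; degree two leaves no others. -/
theorem exists_arc (hG : G.IsQuarticEulerian) (h : G.IsNecklace N X Y A B R L) (a : G.E) :
    ∃ k < N, (X k ≠ Y k ∧ (a = A k ∨ a = B k)) ∨ a = R k ∨ a = L k := by
  have h2 := h.two_le
  suffices hs : ∃ k, (X k ≠ Y k ∧ (a = A k ∨ a = B k)) ∨ a = R k ∨ a = L k by
    obtain ⟨k, hk⟩ := hs
    refine ⟨k % N, Nat.mod_lt _ (by omega), ?_⟩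
    rwa [h.period_X.map_mod_nat, h.period_Y.map_mod_nat, h.period_A.map_mod_nat,
      h.period_B.map_mod_nat, h.period_R.map_mod_nat, h.period_L.map_mod_nat]
  obtain ⟨k, hk⟩ := h.exists_index (G.tail a)
  by_cases hY : G.tail a = Y k
  -- Here `k + (N - 1)` plays the part of `k - 1` modulo `N`.
  · have hp := h.period_Y k
    have hk' : k + N = k + (N - 1) + 1 := by omega
    rcases hG.eq_or_eq_of_tail (h.R_ne_L (k + (N - 1)))
      (by rw [(h.arc_L _).1, (h.arc_R _).1]) (c := a)
      (by rw [(h.arc_R _).1, ← hk', hp, hY]) with h1 | h1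
    · exact ⟨_, .inr (.inl h1)⟩
    · exact ⟨_, .inr (.inr h1)⟩
  · have hX := hk.resolve_right hY
    have hne : X k ≠ Y k := by rw [← hX]; exact hY
    exact ⟨k, .inl ⟨hne, hG.eq_or_eq_of_tail (h.A_ne_B k)
      (by rw [(h.arc_A hne).1, (h.arc_B hne).1]) (by rw [(h.arc_A hne).1, hX])⟩⟩

theorem exists_index_lt (h : G.IsNecklace N X Y A B R L) (v : G.V) :
    ∃ k < N, v = X k ∨ v = Y k := by
  obtain ⟨k, hk⟩ := h.exists_index v
  refine ⟨k % N, Nat.mod_lt _ (by have := h.two_le; omega), ?_⟩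
  rwa [h.period_X.map_mod_nat, h.period_Y.map_mod_nat]

theorem shift (h : G.IsNecklace N X Y A B R L) (r : ℕ) :
    G.IsNecklace N (fun k => X (k + r)) (fun k => Y (k + r)) (fun k => A (k + r))
      (fun k => B (k + r)) (fun k => R (k + r)) (fun k => L (k + r)) where
  two_le := h.two_le
  period_X k := (congrArg X (add_right_comm _ _ _)).trans (h.period_X _)
  period_Y k := (congrArg Y (add_right_comm _ _ _)).trans (h.period_Y _)
  period_A k := (congrArg A (add_right_comm _ _ _)).trans (h.period_A _)
  period_B k := (congrArg B (add_right_comm _ _ _)).trans (h.period_B _)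
  period_R k := (congrArg R (add_right_comm _ _ _)).trans (h.period_R _)
  period_L k := (congrArg L (add_right_comm _ _ _)).trans (h.period_L _)
  exists_index v := by
    have h2 := h.two_le
    obtain ⟨k, hk⟩ := h.exists_index v
    -- This is `k - r` modulo `N`.
    refine ⟨k + r * (N - 1), ?_⟩
    have : k + r * (N - 1) + r = k + r * N := by
      obtain ⟨N, rfl⟩ : ∃ N', N = N' + 1 := ⟨N - 1, by omega⟩
      simp; ring
    simp only [this]
    have hX := h.period_X.nat_mul r k
    have hY := h.period_Y.nat_mul r k
    simp only [Nat.cast_id] at hX hY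
    rwa [hX, hY]
  modEq_of_X hkl := (h.modEq_of_X hkl).add_right_cancel' r
  modEq_of_Y hkl := (h.modEq_of_Y hkl).add_right_cancel' r
  modEq_of_XY hkl := (h.modEq_of_XY hkl).add_right_cancel' r
  arc_A := h.arc_A
  arc_B := h.arc_B
  A_ne_B k := h.A_ne_B _
  arc_R k := by rw [add_right_comm]; exact h.arc_R _
  arc_L k := by rw [add_right_comm]; exact h.arc_L _
  R_ne_L k := by rw [add_right_comm]; exact h.R_ne_L _

theorem isomorphic_antiLadder (hG : G.IsQuarticEulerian) (h : G.IsNecklace N X Y A B R L)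
    (hne : ∀ k, X k ≠ Y k) : G.Isomorphic (antiLadder N) := by
  have heq : ∀ {k l : Fin N}, (k : ℕ) ≡ l [MOD N] → k = l := fun {k l} hkl =>
    Fin.ext (hkl.eq_of_lt_of_lt k.2 l.2)
  refine hG.isomorphic (H := antiLadder N) ?_ (φ := fun v => if v.2 then Y v.1.1 else X v.1.1)
    ⟨?_, ?_⟩
    (ψ := fun a => match a with
      | (i, .inl false) => A i
      | (i, .inl true) => B i
      | (i, .inr false) => R i
      | (i, .inr true) => L i) ?_ ?_ ?_
  · show Nat.card (Fin N × (Bool ⊕ Bool)) = 2 * Nat.card (Fin N × Bool)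
    simp; ring
  · rintro ⟨i, _ | _⟩ ⟨j, _ | _⟩ hij
    · obtain rfl := heq (h.modEq_of_X hij); rfl
    · obtain rfl := heq (h.modEq_of_XY hij); exact absurd hij (hne _)
    · obtain rfl := heq (h.modEq_of_XY hij.symm); exact absurd hij.symm (hne _)
    · obtain rfl := heq (h.modEq_of_Y hij); rfl
  · intro v
    obtain ⟨k, hk, rfl | rfl⟩ := h.exists_index_lt v
    · exact ⟨(⟨k, hk⟩, false), rfl⟩
    · exact ⟨(⟨k, hk⟩, true), rfl⟩
  · intro a
    obtain ⟨k, hk, ⟨-, rfl | rfl⟩ | rfl | rfl⟩ := h.exists_arc hG a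
    · exact ⟨(⟨k, hk⟩, .inl false), rfl⟩
    · exact ⟨(⟨k, hk⟩, .inl true), rfl⟩
    · exact ⟨(⟨k, hk⟩, .inr false), rfl⟩
    · exact ⟨(⟨k, hk⟩, .inr true), rfl⟩
  · rintro ⟨i, (_ | _) | (_ | _)⟩
    · exact (h.arc_A (hne _)).1
    · exact (h.arc_B (hne _)).1
    · exact (h.arc_R _).1
    · exact (h.arc_L _).1.trans (periodic_finRotate h.period_Y i).symm
  · rintro ⟨i, (_ | _) | (_ | _)⟩
    · exact (h.arc_A (hne _)).2
    · exact (h.arc_B (hne _)).2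
    · exact (h.arc_R _).2.trans (periodic_finRotate h.period_X i).symm
    · exact (h.arc_L _).2

end IsNecklace

/-- The occurrences of a periodic property cut a period into intervals. -/
theorem exists_strictMono_of_periodic {N : ℕ} (hN : 0 < N) {P : ℕ → Prop}
    (hP : Function.Periodic P N) (h0 : P 0) :
    ∃ (t : ℕ → ℕ) (p : ℕ), StrictMono t ∧ t 0 = 0 ∧ t p = N ∧ (∀ i, P (t i)) ∧
      ∀ i k, t i < k → k < t (i + 1) → ¬ P k := by
  classical
  have hinf : (Set.ofPred P).Infinite := by
    refine Set.infinite_of_not_bddAbove ?_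
    rintro ⟨b, hb⟩
    have h1 : P ((b + 1) * N) := by
      have := hP.nat_mul (b + 1) 0
      simp only [Nat.cast_id, zero_add] at this
      rw [this]; exact h0
    have := hb h1
    nlinarith
  have hmono := Nat.nth_strictMono hinf
  -- The occurrences are enumerated in order, and `p` is their number in one period.
  refine ⟨Nat.nth P, Nat.count P N, hmono, ?_, Nat.nth_count ?_, Nat.nth_mem_of_infinite hinf, ?_⟩
  · have := Nat.nth_count h0
    rwa [Nat.count_zero] at this
  · have := hP 0
    rw [zero_add] at this
    rw [this]; exact h0
  · intro i k h1 h2 hk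
    rw [← Nat.nth_count hk, hmono.lt_iff_lt] at h1 h2
    omega

/-- The single vertices, at positions `t i`, cut the necklace into blocks. As no two of them are
consecutive, each block contains an anti-digon. -/
theorem IsNecklace.isomorphic_blockCycle {N : ℕ} {X Y : ℕ → G.V} {A B R L : ℕ → G.E}
    (hG : G.IsQuarticEulerian) (h : G.IsNecklace N X Y A B R L) (h0 : X 0 = Y 0)
    (hne : ∀ k, X k = Y k → X (k + 1) ≠ Y (k + 1)) :
    ∃ (p : ℕ) (n : Fin p → ℕ), 1 ≤ p ∧ (∀ i, 1 ≤ n i) ∧ G.Isomorphic (blockCycle n) := by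
  have h2 := h.two_le
  obtain ⟨t, p, hmono, ht0, htp, hP, hgap⟩ := exists_strictMono_of_periodic (N := N)
    (P := fun k => X k = Y k) (by omega) (fun k => by
      show (X (k + N) = Y (k + N)) = (X k = Y k)
      rw [h.period_X, h.period_Y]) h0
  have hp : 1 ≤ p := by
    rcases Nat.eq_zero_or_pos p with rfl | h
    · omega
    · exact h
  have hstep : ∀ i, t i + 1 < t (i + 1) := by
    intro i
    have h1 : t i < t (i + 1) := hmono (Nat.lt_succ_self i)
    have h3 : t i + 1 ≠ t (i + 1) := fun h => hne _ (hP i) (by rw [h]; exact hP _)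
    omega
  let n : Fin p → ℕ := fun i => t (i + 1) - t i - 1
  have hn : ∀ i : Fin p, t i + (n i + 1) = t (i + 1) := fun i => by
    have := hstep i
    simp only [n]; omega
  have hle : ∀ i : Fin p, t (i + 1) ≤ N := fun i => htp ▸ hmono.monotone i.2
  have hXY : ∀ (i : Fin p) (j : Fin (n i)), X (t i + j.succ) ≠ Y (t i + j.succ) := fun i j =>
    hgap i _ (by simp) (by have := hn i; have := j.2; simp only [Fin.val_succ]; omega)
  -- Every position in a period is uniquely `t i + j` with `j ≤ n i`; the offset 0 is the left
  -- vertex of block `i`.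
  have hpos : ∀ (i i' : Fin p) (j : Fin (n i + 1)) (j' : Fin (n i' + 1)),
      t i + j ≡ t i' + j' [MOD N] → i = i' ∧ (j : ℕ) = j' := by
    intro i i' j j' hij
    have h1 := hn i
    have h3 := hn i'
    have := j.2
    have := j'.2
    have := hle i
    have := hle i'
    have heq := hij.eq_of_lt_of_lt (by omega) (by omega)
    have hii : i = i' := by
      rcases lt_trichotomy i i' with hlt' | rfl | hlt'
      · have := hmono.monotone (show (i : ℕ) + 1 ≤ i' from hlt'); omega
      · rfl
      · have := hmono.monotone (show (i' : ℕ) + 1 ≤ i from hlt'); omega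
    subst hii
    exact ⟨rfl, by omega⟩
  have hex : ∀ k < N, ∃ (i : Fin p) (j : Fin (n i + 1)), t i + j = k := by
    intro k hk
    have hfind : ∃ i, k < t i := ⟨k + 1, (Nat.lt_succ_self k).trans_le hmono.le_apply⟩
    obtain ⟨i, hi⟩ : ∃ i, Nat.find hfind = i + 1 := by
      refine Nat.exists_eq_succ_of_ne_zero fun h => ?_
      have := Nat.find_spec hfind
      rw [h, ht0] at this
      omega
    have h1 : k < t (i + 1) := hi ▸ Nat.find_spec hfind
    have h3 : t i ≤ k := not_lt.1 (Nat.find_min hfind (by omega))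
    have hip : i < p := hmono.lt_iff_lt.1 (by omega)
    have := hn ⟨i, hip⟩
    simp only at this
    exact ⟨⟨i, hip⟩, ⟨k - t i, by omega⟩, by simp only; omega⟩
  -- The right vertex of the last block is at `t p = N`, which wraps around to `t 0 = 0`.
  have hnext : ∀ {Z : ℕ → G.V}, Function.Periodic Z N → ∀ i : Fin p,
      Z (t (finRotate p i)) = Z (t i + n i + 1) := by
    intro Z hZ i
    have : NeZero p := ⟨by omega⟩
    rw [add_assoc, hn, finRotate_apply, Fin.val_add, Fin.val_one', Nat.add_mod_mod]
    rcases (show (i : ℕ) + 1 ≤ p from i.2).lt_or_eq with hi | hi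
    · rw [Nat.mod_eq_of_lt hi]
    · rw [hi, Nat.mod_self, ht0, htp, ← hZ 0, zero_add]
  let φ : (blockCycle n).V → G.V := fun v => match v with
    | .inl i => X (t i)
    | .inr ⟨i, j, s⟩ => if s then Y (t i + j.succ) else X (t i + j.succ)
  have hleft : ∀ (i : Fin p) (g : Fin (n i + 1)) (s : Bool),
      φ (leftOfGap n i g s) = if s then Y (t i + g) else X (t i + g) := by
    intro i g s
    refine Fin.cases ?_ (fun j => ?_) g
    · show X (t i) = _
      cases s
      · rfl
      · exact hP i
    · rfl
  have hright : ∀ (i : Fin p) (g : Fin (n i + 1)) (s : Bool),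
      φ (rightOfGap n i g s) = if s then Y (t i + g + 1) else X (t i + g + 1) := by
    intro i g s
    refine Fin.lastCases ?_ (fun j => ?_) g
    · rw [rightOfGap, Fin.lastCases_last]
      show X (t (finRotate p i)) = _
      cases s
      · exact hnext h.period_X i
      · exact (hP _).trans (hnext h.period_Y i)
    · rw [rightOfGap, Fin.lastCases_castSucc]
      rfl
  refine ⟨p, n, hp, fun i => ?_, hG.isomorphic ?_ (φ := φ) ⟨?_, ?_⟩
    (ψ := fun a => match a with
      | .inl ⟨i, j, s⟩ => if s then B (t i + j.succ) else A (t i + j.succ)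
      | .inr ⟨i, g, s⟩ => if s then L (t i + g) else R (t i + g)) ?_ ?_ ?_⟩
  · have := hstep i
    simp only [n]; omega
  · show Nat.card ((Σ i : Fin p, Fin (n i) × Bool) ⊕ (Σ i : Fin p, Fin (n i + 1) × Bool)) =
      2 * Nat.card (Fin p ⊕ (Σ i : Fin p, Fin (n i) × Bool))
    simp [add_mul, Finset.sum_add_distrib]
    ring
  · have hsucc : ∀ {i : Fin p} {j j' : Fin (n i)}, (j.succ : ℕ) = j'.succ → j = j' := fun h =>
      Fin.succ_injective _ (Fin.ext h)
    rintro (i | ⟨i, j, _ | _⟩) (i' | ⟨i', j', _ | _⟩) hij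
    · obtain ⟨rfl, -⟩ := hpos i i' 0 0 (h.modEq_of_X hij)
      rfl
    · have := (hpos i i' 0 j'.succ (h.modEq_of_X hij)).2
      simp at this
    · have := (hpos i i' 0 j'.succ (h.modEq_of_XY hij)).2
      simp at this
    · have := (hpos i i' j.succ 0 (h.modEq_of_X hij)).2
      simp at this
    · obtain ⟨rfl, hj⟩ := hpos i i' j.succ j'.succ (h.modEq_of_X hij)
      rw [hsucc hj]
    · obtain ⟨rfl, hj⟩ := hpos i i' j.succ j'.succ (h.modEq_of_XY hij)
      obtain rfl := hsucc hj
      exact absurd hij (hXY i j)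
    · have := (hpos i i' j.succ 0 (h.modEq_of_XY hij.symm).symm).2
      simp at this
    · obtain ⟨rfl, hj⟩ := hpos i i' j.succ j'.succ (h.modEq_of_XY hij.symm).symm
      obtain rfl := hsucc hj
      exact absurd hij.symm (hXY i j)
    · obtain ⟨rfl, hj⟩ := hpos i i' j.succ j'.succ (h.modEq_of_Y hij)
      rw [hsucc hj]
  · intro v
    obtain ⟨k, hk, hv⟩ := h.exists_index_lt v
    obtain ⟨i, g, rfl⟩ := hex k hk
    rcases hv with rfl | rfl
    · exact ⟨leftOfGap n i g false, hleft i g false⟩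
    · exact ⟨leftOfGap n i g true, hleft i g true⟩
  · intro a
    obtain ⟨k, hk, ha⟩ := h.exists_arc hG a
    obtain ⟨i, g, rfl⟩ := hex k hk
    rcases ha with ⟨hne, ha⟩ | rfl | rfl
    · refine Fin.cases (fun hne ha => ?_) (fun j hne ha => ?_) g hne ha
      · exact absurd (hP i) hne
      · rcases ha with rfl | rfl
        · exact ⟨.inl ⟨i, j, false⟩, rfl⟩
        · exact ⟨.inl ⟨i, j, true⟩, rfl⟩
    · exact ⟨.inr ⟨i, g, false⟩, rfl⟩
    · exact ⟨.inr ⟨i, g, true⟩, rfl⟩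
  · rintro (⟨i, j, _ | _⟩ | ⟨i, g, _ | _⟩)
    · exact (h.arc_A (hXY i j)).1
    · exact (h.arc_B (hXY i j)).1
    · exact (h.arc_R _).1.trans (hleft i g true).symm
    · exact (h.arc_L _).1.trans (hright i g true).symm
  · rintro (⟨i, j, _ | _⟩ | ⟨i, g, _ | _⟩)
    · exact (h.arc_A (hXY i j)).2
    · exact (h.arc_B (hXY i j)).2
    · exact (h.arc_R _).2.trans (hright i g false).symm
    · exact (h.arc_L _).2.trans (hleft i g false).symm

/-- A digraph without digons that is a necklace belongs to one of the two families. -/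
theorem IsNecklace.isomorphic {N : ℕ} {X Y : ℕ → G.V} {A B R L : ℕ → G.E}
    (hG : G.IsQuarticEulerian) (hdigon : ∀ a b : G.E, ¬ G.IsDigon a b)
    (h : G.IsNecklace N X Y A B R L) :
    (∃ n : ℕ, 2 ≤ n ∧ G.Isomorphic (antiLadder n)) ∨
      (∃ (p : ℕ) (n : Fin p → ℕ), 1 ≤ p ∧ (∀ i, 1 ≤ n i) ∧ G.Isomorphic (blockCycle n)) := by
  by_cases hne : ∀ k, X k ≠ Y k
  · exact .inl ⟨N, h.two_le, h.isomorphic_antiLadder hG hne⟩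
  · push Not at hne
    obtain ⟨r, hr⟩ := hne
    refine .inr ((h.shift r).isomorphic_blockCycle hG (by simpa using hr) fun k hk hk' => ?_)
    have h' := h.shift r
    -- Two consecutive single vertices would be joined by a digon; they are distinct because `2 ≤
    -- N`.
    refine hdigon (R (k + r)) (L (k + r)) ⟨?_, ?_, ?_⟩
    · rw [(h'.arc_R k).1, (h'.arc_R k).2]
      intro heq
      have h1 := h'.modEq_of_XY heq.symm
      have := Nat.le_of_dvd (by omega) ((Nat.modEq_iff_dvd' (Nat.le_succ k)).1 h1.symm)
      have := h.two_le
      omega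
    · rw [(h'.arc_L k).1, (h'.arc_R k).2]; exact hk'.symm
    · rw [(h'.arc_L k).2, (h'.arc_R k).1]; exact hk

end FinDigraph

namespace FinDigraph

variable {G : FinDigraph.{u}}

/-! ### The case where all directed cycles meet the anti-digon -/

/-- A sequence of distinct vertices `u k, …, u 1, u 0` in which all arcs that leave a vertex other
than `u 0` lead to the next one. -/
structure IsDoublePath (G : FinDigraph.{u}) (k : ℕ) (u : ℕ → G.V) : Prop where
  inj : ∀ i ≤ k, ∀ j ≤ k, u i = u j → i = j
  head_eq : ∀ i < k, ∀ a, G.tail a = u (i + 1) → G.head a = u i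

/-- The two arcs that leave `u (i + 1)` already exhaust the in-degree of `u i`. -/
theorem IsDoublePath.tail_eq (hG : G.IsQuarticEulerian) {k : ℕ} {u : ℕ → G.V}
    (h : G.IsDoublePath k u) {i : ℕ} (hi : i < k) {a : G.E} (ha : G.head a = u i) :
    G.tail a = u (i + 1) := by
  obtain ⟨b, hb⟩ := hG.exists_tail (u (i + 1))
  obtain ⟨c, hcb, hc⟩ := hG.exists_tail_eq b
  have hb' := h.head_eq i hi b hb
  have hc' := h.head_eq i hi c (hc.trans hb)
  rcases hG.eq_or_eq_of_head hcb.symm (hc'.trans hb'.symm) (ha.trans hb'.symm) with rfl | rfl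
  · exact hb
  · exact hc.trans hb

theorem IsDoublePath.card_le {k : ℕ} {u : ℕ → G.V} (h : G.IsDoublePath k u) :
    k + 1 ≤ Nat.card G.V := by
  have := Nat.card_le_card_of_injective (fun i : Fin (k + 1) => u i) fun i j hij =>
    Fin.ext (h.inj i (by omega) j (by omega) hij)
  simpa using this

/-- If every unused vertex had an arc to an unused vertex, a directed cycle would avoid the path and
hence `e`. So some unused vertex `w` sends both arcs into the path, and by `tail_eq` only `u k` can
receive them. -/
theorem IsDoublePath.extend (hG : G.IsQuarticEulerian) {e : G.E}
    (hmeet : ∀ C : Set G.E, G.IsDirectedCycle C → G.Meets C e) {k : ℕ} (hk : 1 ≤ k)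
    {u : ℕ → G.V} (h : G.IsDoublePath k u) (h0 : u 0 = G.head e) (h1 : u 1 = G.tail e)
    {v : G.V} (hv : ∀ i ≤ k, v ≠ u i) :
    ∃ u', G.IsDoublePath (k + 1) u' ∧ u' 0 = G.head e ∧ u' 1 = G.tail e := by
  classical
  obtain ⟨w, hw, hwout⟩ : ∃ w, (∀ i ≤ k, w ≠ u i) ∧
      ∀ a, G.tail a = w → ∃ i ≤ k, G.head a = u i := by
    by_contra! hcon
    obtain ⟨a, ha, ha'⟩ := hcon v hv
    obtain ⟨n, c, hc, hcZ⟩ := exists_cyc_subset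
      (Z := {a : G.E | (∀ i ≤ k, G.tail a ≠ u i) ∧ ∀ i ≤ k, G.head a ≠ u i})
      ⟨a, by rw [ha]; exact hv, ha'⟩ fun b hb => by
        obtain ⟨d, hd, hd'⟩ := hcon _ hb.2
        exact ⟨d, ⟨by rw [hd]; exact hb.2, hd'⟩, hd⟩
    obtain ⟨b, hb, hbe⟩ := hmeet _ (isDirectedCycle_iff.2 ⟨n, c, hc, rfl⟩)
    rcases hbe with hbe | hbe
    · exact (hcZ hb).1 1 hk (hbe.trans h1.symm)
    · exact (hcZ hb).1 0 (by omega) (hbe.trans h0.symm)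
  have hwk : ∀ a, G.tail a = w → G.head a = u k := by
    intro a ha
    obtain ⟨i, hi, hai⟩ := hwout a ha
    rcases hi.lt_or_eq with hi | rfl
    · exact absurd (ha.symm.trans (h.tail_eq hG hi hai)) (hw _ hi)
    · exact hai
  refine ⟨fun i => if i ≤ k then u i else w, ⟨fun i hi j hj hij => ?_, fun i hi a ha => ?_⟩, ?_, ?_⟩
  · by_cases hik : i ≤ k <;> by_cases hjk : j ≤ k <;> simp only [hik, hjk, if_true, if_false] at hij
    · exact h.inj i hik j hjk hij
    · exact absurd hij.symm (hw i hik)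
    · exact absurd hij (hw j hjk)
    · omega
  · simp only [Nat.lt_succ_iff.1 hi, if_true]
    by_cases hik : i + 1 ≤ k
    · simp only [hik, if_true] at ha
      exact h.head_eq i hik a ha
    · simp only [hik, if_false] at ha
      obtain rfl : i = k := by omega
      exact hwk a ha
  · simp [h0]
  · simp [hk, h1]

theorem IsDoublePath.isomorphic (hG : G.IsQuarticEulerian) {k : ℕ} {u : ℕ → G.V}
    (h : G.IsDoublePath k u) (hu : ∀ v, ∃ i ≤ k, v = u i)
    (h0 : ∀ a, G.tail a = u 0 → G.head a = u k) : G.Isomorphic (doubledCycle (k + 1)) := by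
  choose α hα using hG.exists_tail
  choose β hβ using fun v => hG.exists_tail_eq (α v)
  have hhead : ∀ (i : Fin (k + 1)) a, G.tail a = u (k - i) →
      G.head a = u (k - (finRotate (k + 1) i : Fin (k + 1))) := by
    intro i a ha
    rcases (Nat.lt_succ_iff.1 i.2).lt_or_eq with hi | hi
    · rw [finRotate_of_lt hi]
      refine h.head_eq _ (by simp only; omega) a ?_
      rw [ha]; congr 1; simp only; omega
    · obtain rfl : i = Fin.last k := Fin.ext hi
      rw [finRotate_last]
      refine h0 a ?_
      rw [ha]; simp
  -- The arcs run from `u k` down to `u 0`, so the indices are reversed.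
  refine hG.isomorphic (H := doubledCycle (k + 1)) ?_ (φ := fun i : Fin (k + 1) => u (k - i))
    ⟨fun (i j : Fin (k + 1)) hij => ?_, fun v => ?_⟩
    (ψ := fun a : Fin (k + 1) × Bool => if a.2 then β (u (k - a.1)) else α (u (k - a.1)))
    (fun a => ?_) ?_ ?_
  · show Nat.card (Fin (k + 1) × Bool) = 2 * Nat.card (Fin (k + 1))
    simp; ring
  · have := h.inj _ (by omega) _ (by omega) hij
    exact Fin.ext (by omega)
  · obtain ⟨i, hi, rfl⟩ := hu v
    exact ⟨(⟨k - i, by omega⟩ : Fin (k + 1)), congrArg u (Nat.sub_sub_self hi)⟩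
  · obtain ⟨i, hi, hai⟩ := hu (G.tail a)
    have hi' : u (k - (k - i)) = u i := congrArg u (Nat.sub_sub_self hi)
    rcases hG.eq_or_eq_of_tail (hβ (u i)).1.symm (hβ (u i)).2 (hai.trans (hα _).symm) with rfl | rfl
    · exact ⟨((⟨k - i, by omega⟩ : Fin (k + 1)), false), congrArg α hi'⟩
    · exact ⟨((⟨k - i, by omega⟩ : Fin (k + 1)), true), congrArg β hi'⟩
  · rintro ⟨i, _ | _⟩
    · exact hα _
    · exact (hβ _).2.trans (hα _)
  · rintro ⟨i, _ | _⟩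
    · exact hhead i _ (hα _)
    · exact hhead i _ ((hβ _).2.trans (hα _))

/-- A longest double path that ends with the anti-digon is spanning by `extend`. The arcs that leave
`u 0` must go to `u k`, the only vertex with free in-degree, and `k = 1` would give a digon. -/
theorem IsQuarticEulerian.isomorphic_doubledCycle (hG : G.IsQuarticEulerian)
    (hdigon : ∀ a b : G.E, ¬ G.IsDigon a b) {e f : G.E} (hD : G.IsAntiDigon e f)
    (hmeet : ∀ C : Set G.E, G.IsDirectedCycle C → G.Meets C e) :
    ∃ n : ℕ, 3 ≤ n ∧ G.Isomorphic (doubledCycle n) := by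
  classical
  let P : ℕ → Prop := fun k => ∃ u, G.IsDoublePath k u ∧ u 0 = G.head e ∧ u 1 = G.tail e
  have hP1 : P 1 := by
    refine ⟨fun i => if i = 0 then G.head e else G.tail e, ⟨fun i hi j hj hij => ?_,
      fun i hi a ha => ?_⟩, by simp, by simp⟩
    · by_cases hi0 : i = 0 <;> by_cases hj0 : j = 0 <;>
        simp only [hi0, hj0, if_true, if_false] at hij
      · omega
      · exact absurd hij.symm hD.2.1
      · exact absurd hij hD.2.1
      · omega
    · obtain rfl : i = 0 := by omega
      simp only [zero_add, one_ne_zero, if_false] at ha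
      simp only [if_true]
      rcases hG.eq_or_eq_of_tail hD.1 hD.2.2.1 ha with rfl | rfl
      · rfl
      · exact hD.2.2.2
  have hcard : ∀ k, P k → k ≤ Nat.card G.V := fun k ⟨u, hu, _⟩ => by
    have := hu.card_le; omega
  set k := Nat.findGreatest P (Nat.card G.V) with hkdef
  have hk1 : 1 ≤ k := Nat.le_findGreatest (hcard 1 hP1) hP1
  obtain ⟨u, hu, hu0, hu1⟩ : P k := Nat.findGreatest_spec (hcard 1 hP1) hP1
  have hall : ∀ v, ∃ i ≤ k, v = u i := by
    by_contra! hcon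
    obtain ⟨v, hv⟩ := hcon
    have hPk : P (k + 1) := hu.extend hG hmeet hk1 hu0 hu1 hv
    have := Nat.le_findGreatest (hcard _ hPk) hPk
    omega
  have h0 : ∀ a, G.tail a = u 0 → G.head a = u k := by
    intro a ha
    obtain ⟨i, hi, hai⟩ := hall (G.head a)
    rcases hi.lt_or_eq with hi | rfl
    · have := hu.inj _ (by omega) _ hi (ha.symm.trans (hu.tail_eq hG hi hai))
      omega
    · exact hai
  have hk2 : k ≠ 1 := by
    intro hk
    obtain ⟨a, ha⟩ := hG.exists_tail (u 0)
    have := h0 a ha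
    rw [hk] at this
    exact hdigon e a ⟨hD.2.1, ha.trans hu0, this.trans hu1⟩
  exact ⟨k + 1, by omega, hu.isomorphic hG hall h0⟩

/-! ### The case of a directed cycle that avoids the anti-digon -/

/-- The given cycle is made a member of the decomposition. As it avoids the tail of the anti-digon,
it differs from the cycles of `e` and `f`, so the chain has at least three cycles. -/
theorem IsDiplanarObstruction.isomorphic_of_not_meets (hG : G.IsDiplanarObstruction)
    (hdigon : ∀ a b : G.E, ¬ G.IsDigon a b) {e f : G.E} (hD : G.IsAntiDigon e f) {C : Set G.E}
    (hC : G.IsDirectedCycle C) (hCe : ¬ G.Meets C e) :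
    (∃ n : ℕ, 2 ≤ n ∧ G.Isomorphic (antiLadder n)) ∨
      (∃ (p : ℕ) (n : Fin p → ℕ), 1 ≤ p ∧ (∀ i, 1 ≤ n i) ∧ G.Isomorphic (blockCycle n)) := by
  classical
  obtain ⟨k, c, hc, rfl⟩ := isDirectedCycle_iff.1 hC
  have hcC : Set.range c = (Set.range c).toFinset := by simp
  obtain ⟨m, hm, hmC⟩ := hG.1.isSubquartic.exists_decomp hc hcC
  have hne : ∀ g, G.tail g = G.tail e → m (c 0) ≠ m g := by
    intro g hg h
    have hg' : g ∈ m (c 0) := hm.mem_iff.2 h.symm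
    rw [hmC (c 0) (by simp)] at hg'
    exact hCe ⟨g, by simpa using hg', .inl hg⟩
  obtain ⟨n, M, hM⟩ := hG.exists_isCycleChain hD hm (hne e rfl) (hne f hD.2.2.1)
  obtain ⟨X, Y, A, B, R, L, h⟩ := hM.exists_isNecklace hG hD hm
  exact h.isomorphic hG.1 hdigon

end FinDigraph

theorem mainTheorem1 (G : FinDigraph.{u}) (hG : G.IsDiplanarObstruction)
    (hdigon : ∀ a b : G.E, ¬ G.IsDigon a b)
    (e f : G.E) (hD : G.IsAntiDigon e f) :
    ((∀ C : Set G.E, G.IsDirectedCycle C → G.Meets C e) →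
      ∃ n : ℕ, 3 ≤ n ∧ G.Isomorphic (FinDigraph.doubledCycle n)) ∧
    (¬ (∀ C : Set G.E, G.IsDirectedCycle C → G.Meets C e) →
      (∃ n : ℕ, 2 ≤ n ∧ G.Isomorphic (FinDigraph.antiLadder n)) ∨
      (∃ (p : ℕ) (n : Fin p → ℕ), 1 ≤ p ∧ (∀ i, 1 ≤ n i) ∧
        G.Isomorphic (FinDigraph.blockCycle n))) := by
  refine ⟨fun h => hG.1.isomorphic_doubledCycle hdigon hD h, fun h => ?_⟩
  push Not at h
  obtain ⟨C, hC, hCe⟩ := h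
  exact hG.isomorphic_of_not_meets hdigon hD hC hCe
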